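/- Let $S$ be a noetherian $\mathbb{C}$-scheme, let $f\colon X\to S$ be a smooth morphism of schemes, and let $Y\subset X$ be a relative divisor with normal crossings, with ideal sheaf $I\subset\mathcal{O}_X$. This means that $X$ is covered by affine open subschemes $U$, each admitting an étale $S$-morphism $U\to\mathbb{A}^n_S$ with coordinates $x_1,\dots,x_n\in\mathcal{O}_X(U)$ such that $I|_U$ is generated by $x_1x_2\cdots x_m$ for some $0\le m\le n$ ($n$ and $m$ may depend on $U$). Put $X^*=X\setminus Y$, with inclusion $j\colon X^*\hookrightarrow X$. Let $\mathrm{Der}_Y(X/S)$ be the sheaf of $S$-derivations $D$ of $\mathcal{O}_X$ with $D(I)\subset I$. An integrable logarithmic connection on $X/S$ is a coherent $\mathcal{O}_X$-module $E$ with an $\mathcal{O}_X$-linear map of sheaves $\nabla\colon \mathrm{Der}_Y(X/S)\to \mathcal{E}nd_{f^{-1}\mathcal{O}_S}(E)$, $D\mapsto\nabla_D$, such that $\nabla_D(ae)=D(a)e+a\nabla_D(e)$ and $\nabla_{[D,D']}=[\nabla_D,\nabla_{D'}]$ for all local sections. Morphisms are the $\mathcal{O}_X$-linear maps commuting with all $\nabla_D$.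 Denote the resulting category by $\mathfrak{c}^{\log}_Y(X/S)$, and let $\mathfrak{c}(X^*/S)$ be the category defined in the same way on $X^*$ with all $S$-derivations of $\mathcal{O}_{X^*}$. Let $\mathfrak{c}^{rs}_Y(X^*/S)$ be the full subcategory of $\mathfrak{c}(X^*/S)$ of the regular-singular objects, that is, those isomorphic to $j^*\overline{E}$ for some $\overline{E}$ in $\mathfrak{c}^{\log}_Y(X/S)$. Then the following hold. 1. If $F\to E$ is a monomorphism in $\mathfrak{c}(X^*/S)$ and $E$ is regular-singular, then $F$ is regular-singular. 2. If $E\to Q$ is an epimorphism in $\mathfrak{c}(X^*/S)$ and $E$ is regular-singular, then $Q$ is regular-singular. 3. If $E$ and $F$ are regular-singular, then the module $E\otimes_{\mathcal{O}_{X^*}}F$ with the connection $\nabla_D(e\otimes e')=\nabla_D(e)\otimes e'+e\otimes\nabla_D(e')$ belongs to $\mathfrak{c}(X^*/S)$ and is regular-singular. 4. If $E$ is regular-singular, then the module $E^\vee=\mathcal{H}om_{\mathcal{O}_{X^*}}(E,\mathcal{O}_{X^*})$ with the connection $(\nabla_D\varphi)(e)=D(\varphi(e))-\varphi(\nabla_D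 e)$ belongs to $\mathfrak{c}(X^*/S)$ and is regular-singular. -/

import Mathlib

open CategoryTheory AlgebraicGeometry TopologicalSpace Opposite

universe u

noncomputable section

namespace RegSing

variable {X S : Scheme.{u}}

/-- Restriction of functions from an open subset to a smaller one. -/
def resO {U V : X.Opens} (h : V ≤ U) : Γ(X, U) →+* Γ(X, V) :=
  (X.presheaf.map (homOfLE h).op).hom

/-- Restriction of sections of a sheaf of modules to a smaller open subset. -/
def resM (M : X.Modules) {U V : X.Opens} (h : V ≤ U) : Γ(M, U) →+ Γ(M, V) :=
  (M.presheaf.map (homOfLE h).op).hom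

lemma resO_resO {U V W : X.Opens} (h : V ≤ U) (h' : W ≤ V) (a : Γ(X, U)) :
    resO h' (resO h a) = resO (h'.trans h) a := by
  simp only [resO, ← CommRingCat.comp_apply, ← Functor.map_comp]
  rfl

lemma resO_self {U : X.Opens} (a : Γ(X, U)) : resO le_rfl a = a := by
  simp [resO]

lemma resM_resM (M : X.Modules) {U V W : X.Opens} (h : V ≤ U) (h' : W ≤ V) (m : Γ(M, U)) :
    resM M h' (resM M h m) = resM M (h'.trans h) m := by
  simp only [resM, ← AddCommGrpCat.comp_apply, ← Functor.map_comp]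
  rfl

lemma resM_self (M : X.Modules) {U : X.Opens} (m : Γ(M, U)) : resM M le_rfl m = m := by
  simp [resM]

lemma resM_smul (M : X.Modules) {U V : X.Opens} (h : V ≤ U) (a : Γ(X, U)) (m : Γ(M, U)) :
    resM M h (a • m) = resO h a • resM M h m :=
  M.map_smul (homOfLE h) a m

lemma resM_app {M N : X.Modules} (φ : M ⟶ N) {U V : X.Opens} (h : V ≤ U) (m : Γ(M, U)) :
    resM N h (φ.app U m) = φ.app V (resM M h m) :=
  (CategoryTheory.congr_fun (φ.mapPresheaf.naturality (homOfLE h).op) m).symm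

lemma eqO_of_locally {U : X.Opens} (a b : Γ(X, U))
    (H : ∀ x ∈ U, ∃ (V : X.Opens) (h : V ≤ U), x ∈ V ∧ resO h a = resO h b) : a = b := by
  choose! V hV hx he using H
  refine X.sheaf.eq_of_locally_eq' (fun x : U => V x.1) U (fun x => homOfLE (hV x.1 x.2)) ?_ _ _
    (fun x => he x.1 x.2)
  intro x hxU
  exact Opens.mem_iSup.2 ⟨⟨x, hxU⟩, hx x hxU⟩

lemma eqM_of_locally (M : X.Modules) {U : X.Opens} (a b : Γ(M, U))
    (H : ∀ x ∈ U, ∃ (V : X.Opens) (h : V ≤ U), x ∈ V ∧ resM M h a = resM M h b) : a = b := by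
  choose! V hV hx he using H
  refine TopCat.Sheaf.eq_of_locally_eq' ⟨_, M.isSheaf⟩ (fun x : U => V x.1) U
    (fun x => homOfLE (hV x.1 x.2)) ?_ _ _ (fun x => he x.1 x.2)
  intro x hxU
  exact Opens.mem_iSup.2 ⟨⟨x, hxU⟩, hx x hxU⟩

/-! ### Logarithmic derivations -/

/-- Let `f : X ⟶ S` and let `I` be the ideal sheaf of `Y ⊆ X`. `LogDer f I U` is the set of sections
over `U` of `Der_Y(X/S)`, the sheaf of `S`-derivations of `𝒪_X` which stabilize `I`:
a compatible family of derivations of the rings `Γ(X, V)`, `V ≤ U`, killing the functions which come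
from `S` and preserving `I` (it suffices to test the latter on affine opens).
For `I = ⊤`, i.e. `Y = ∅`, this is `Der(X/S)`, the dual of `Ω¹_{X/S}`. -/
structure LogDer (f : X ⟶ S) (I : X.IdealSheafData) (U : X.Opens) where
  app (V : X.Opens) (h : V ≤ U) : Derivation ℤ Γ(X, V) Γ(X, V)
  app_res {V W : X.Opens} (hV : V ≤ U) (h : W ≤ V) (a : Γ(X, V)) :
    resO h (app V hV a) = app W (h.trans hV) (resO h a)
  app_base {V : X.Opens} (hV : V ≤ U) (T : S.Opens) (hT : V ≤ f ⁻¹ᵁ T) (s : Γ(S, T)) :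
    app V hV (f.appLE T V hT s) = 0
  app_ideal (V : X.affineOpens) (hV : V.1 ≤ U) (a : Γ(X, V.1)) (ha : a ∈ I.ideal V) :
    app V.1 hV a ∈ I.ideal V

namespace LogDer

variable {f : X ⟶ S} {I : X.IdealSheafData} {U : X.Opens}

@[ext] lemma ext' {D D' : LogDer f I U} (h : ∀ V hV a, D.app V hV a = D'.app V hV a) : D = D' := by
  cases D; cases D'; congr; funext V hV; ext a; exact h V hV a

/-- The derivation of `Γ(X, U)` given by a section over `U` of the sheaf of derivations. -/
def val (D : LogDer f I U) : Derivation ℤ Γ(X, U) Γ(X, U) := D.app U le_rfl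

/-- Restriction of derivations to a smaller open subset. -/
def restrict (D : LogDer f I U) {V : X.Opens} (h : V ≤ U) : LogDer f I V where
  app W hW := D.app W (hW.trans h)
  app_res hV h' a := D.app_res (hV.trans h) h' a
  app_base hV T hT s := D.app_base _ T hT s
  app_ideal V' hV a ha := D.app_ideal V' _ a ha

instance : Add (LogDer f I U) where
  add D D' :=
    { app := fun V h => D.app V h + D'.app V h
      app_res := fun hV h a => by simp [D.app_res, D'.app_res]
      app_base := fun hV T hT s => by simp [D.app_base, D'.app_base]
      app_ideal := fun V hV a ha => (I.ideal V).add_mem (D.app_ideal V hV a ha)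
        (D'.app_ideal V hV a ha) }

instance : SMul Γ(X, U) (LogDer f I U) where
  smul c D :=
    { app := fun V h => resO h c • D.app V h
      app_res := fun hV h a => by simp [D.app_res, resO_resO]
      app_base := fun hV T hT s => by simp [D.app_base]
      app_ideal := fun V hV a ha => (I.ideal V).mul_mem_left _ (D.app_ideal V hV a ha) }

instance : Bracket (LogDer f I U) (LogDer f I U) where
  bracket D D' :=
    { app := fun V h => ⁅D.app V h, D'.app V h⁆
      app_res := fun hV h a => by simp [Derivation.commutator_apply, D.app_res, D'.app_res]
      app_base := fun hV T hT s => by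
        simp [Derivation.commutator_apply, D.app_base, D'.app_base]
      app_ideal := fun V hV a ha => by
        rw [Derivation.commutator_apply]
        exact (I.ideal V).sub_mem (D.app_ideal V hV _ (D'.app_ideal V hV a ha))
          (D'.app_ideal V hV _ (D.app_ideal V hV a ha)) }

end LogDer


lemma ideal_eq_top (I : X.IdealSheafData) (V : X.affineOpens)
    (h : Disjoint (V.1 : Set X) (I.support : Set X)) : I.ideal V = ⊤ := by
  have := (V.2.fromSpec_image_zeroLocus _).trans_subset
    ((I.zeroLocus_inter_subset_supportSet V).trans (fun x hx => hx : I.supportSet ⊆ I.support))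
  rw [← PrimeSpectrum.zeroLocus_empty_iff_eq_top]
  by_contra hne
  obtain ⟨y, hy⟩ := Set.nonempty_iff_ne_empty.2 hne
  refine Set.disjoint_left.1 h ?_ (this ⟨y, hy, rfl⟩)
  rw [SetLike.mem_coe, ← SetLike.mem_coe, ← V.2.range_fromSpec]
  exact ⟨y, rfl⟩

section Extend

variable {X' : Scheme.{u}} (j : X' ⟶ X) [IsOpenImmersion j]

/-- For an open immersion `j` and `W` contained in its image, functions on `W` are the same as
functions on `j⁻¹ W`. -/
def openImmersionEquiv (W : X.Opens) (h : W ≤ j.opensRange) : Γ(X, W) ≃+* Γ(X', j ⁻¹ᵁ W) :=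
  haveI := j.isIso_app W h
  (asIso (j.app W)).commRingCatIsoToRingEquiv

lemma openImmersionEquiv_apply (W : X.Opens) (h : W ≤ j.opensRange) (a : Γ(X, W)) :
    openImmersionEquiv j W h a = j.app W a := rfl

lemma openImmersionEquiv_symm_eq (W : X.Opens) (h : W ≤ j.opensRange) (a : Γ(X, W))
    (b : Γ(X', j ⁻¹ᵁ W)) : (openImmersionEquiv j W h).symm b = a ↔ b = j.app W a := by
  rw [RingEquiv.symm_apply_eq]; rfl

lemma resO_app {V W : X.Opens} (h : W ≤ V) (a : Γ(X, V)) :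
    j.app W (resO h a) = resO (show j ⁻¹ᵁ W ≤ j ⁻¹ᵁ V from fun _ hx => h hx) (j.app V a) :=
  CategoryTheory.congr_fun (j.naturality (homOfLE h).op) a

lemma preimage_le {V : X'.Opens} {W : X.Opens} (h : W ≤ j ''ᵁ V) : j ⁻¹ᵁ W ≤ V := by
  intro x hx
  obtain ⟨y, hy, hyx⟩ := h hx
  exact j.isOpenEmbedding.injective hyx ▸ hy

lemma image_le_range (V : X'.Opens) : j ''ᵁ V ≤ j.opensRange := by
  rintro _ ⟨y, _, rfl⟩
  exact ⟨y, rfl⟩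

variable {f : X ⟶ S} {I : X.IdealSheafData}

/-- Let `j : X' ⟶ X` be an open immersion whose image does not meet `Y`. A derivation over an open
`V` of `X'` is viewed as a derivation over the open `j(V)` of `X`; it stabilizes the ideal of `Y`
because this is the unit ideal on `j(V)`. -/
def LogDer.extend (hI : Disjoint (j.opensRange : Set X) (I.support : Set X))
    {V : X'.Opens} (D : LogDer (j ≫ f) ⊤ V) : LogDer f I (j ''ᵁ V) where
  app W h :=
    let e := openImmersionEquiv j W (h.trans (image_le_range j V))
    Derivation.mk' (AddMonoidHom.toIntLinearMap
      (e.symm.toAddMonoidHom.comp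
        ((D.app (j ⁻¹ᵁ W) (preimage_le j h)).toLinearMap.toAddMonoidHom.comp e.toAddMonoidHom)))
      (by intro a b; simp)
  app_res {W W'} hW h a := by
    have h1 := hW.trans (image_le_range j V)
    have h2 := (h.trans hW).trans (image_le_range j V)
    change resO h ((openImmersionEquiv j W h1).symm (D.app _ (preimage_le j hW) (j.app W a))) =
      (openImmersionEquiv j W' h2).symm
        (D.app _ (preimage_le j (h.trans hW)) (j.app W' (resO h a)))
    symm
    rw [openImmersionEquiv_symm_eq, resO_app, resO_app]
    rw [← D.app_res]
    congr 1
    exact ((openImmersionEquiv j W h1).apply_symm_apply _).symm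
  app_base {W} hW T hT s := by
    have h1 := hW.trans (image_le_range j V)
    change (openImmersionEquiv j W h1).symm (D.app _ (preimage_le j hW)
      (j.app W (f.appLE T W hT s))) = 0
    rw [openImmersionEquiv_symm_eq, map_zero]
    have := D.app_base (preimage_le j hW) T (fun x hx => hT hx) s
    rw [← Scheme.Hom.appLE_comp_appLE j f T W _ hT le_rfl] at this
    rw [Scheme.Hom.app_eq_appLE]
    exact this
  app_ideal W hW a _ := by
    rw [ideal_eq_top I W]
    · trivial
    · exact hI.mono_left (fun x hx => image_le_range j V (hW hx))

lemma app_appIso_inv_eq (V : X'.Opens) (b : Γ(X', V)) :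
    j.app (j ''ᵁ V) ((j.appIso V).inv b) = resO (j.preimage_image_eq V).le b :=
  CategoryTheory.congr_fun (j.appIso_inv_app V) b

lemma LogDer.extend_appIso_inv (hI : Disjoint (j.opensRange : Set X) (I.support : Set X))
    {V : X'.Opens} (D : LogDer (j ≫ f) ⊤ V) (a : Γ(X', V)) :
    (D.extend j hI : LogDer f I _).val ((j.appIso V).inv a) = (j.appIso V).inv (D.val a) := by
  change (openImmersionEquiv j _ (image_le_range j V)).symm (D.app _ _ (j.app _ _)) = _
  rw [openImmersionEquiv_symm_eq, app_appIso_inv_eq, app_appIso_inv_eq]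
  exact (D.app_res le_rfl (j.preimage_image_eq V).le a).symm

lemma resO_appIso_inv {V W : X'.Opens} (h : W ≤ V) (a : Γ(X', V)) :
    (j.appIso W).inv (resO h a) = resO (j.image_mono h) ((j.appIso V).inv a) :=
  CategoryTheory.congr_fun (j.appIso_inv_naturality (homOfLE h).op) a

end Extend

/-! ### Connections -/

/-- An integrable logarithmic `S`-connection on the `𝒪_X`-module `M`, for the closed subscheme `Y`
with ideal sheaf `I`: an `𝒪_X`-linear morphism of sheaves `D ↦ ∇_D` from `Der_Y(X/S)` to the
endomorphisms of `M`, compatible with brackets and such that `∇_D (a m) = D(a) m + a ∇_D(m)`.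
As `D` kills functions coming from `S`, the latter rule contains the `𝒪_S`-linearity of `∇_D`.
For `I = ⊤`, i.e. `Y = ∅`, this is an integrable `S`-connection on `M`. -/
structure Nabla (f : X ⟶ S) (I : X.IdealSheafData) (M : X.Modules) where
  app {U : X.Opens} (D : LogDer f I U) : Γ(M, U) →+ Γ(M, U)
  leibniz {U : X.Opens} (D : LogDer f I U) (a : Γ(X, U)) (m : Γ(M, U)) :
    app D (a • m) = D.val a • m + a • app D m
  add_der {U : X.Opens} (D D' : LogDer f I U) (m : Γ(M, U)) :
    app (D + D') m = app D m + app D' m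
  smul_der {U : X.Opens} (a : Γ(X, U)) (D : LogDer f I U) (m : Γ(M, U)) :
    app (a • D) m = a • app D m
  bracket {U : X.Opens} (D D' : LogDer f I U) (m : Γ(M, U)) :
    app ⁅D, D'⁆ m = app D (app D' m) - app D' (app D m)
  res {U V : X.Opens} (h : V ≤ U) (D : LogDer f I U) (m : Γ(M, U)) :
    resM M h (app D m) = app (D.restrict h) (resM M h m)

/-- An `𝒪_X`-module endowed with an integrable logarithmic `S`-connection. -/
structure LogConn (f : X ⟶ S) (I : X.IdealSheafData) where
  mod : X.Modules
  nabla : Nabla f I mod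

namespace LogConn

variable {f : X ⟶ S} {I : X.IdealSheafData}

/-- Arrows are the horizontal morphisms of `𝒪_X`-modules. -/
@[ext]
structure Hom (E F : LogConn f I) where
  hom : E.mod ⟶ F.mod
  horizontal {U : X.Opens} (D : LogDer f I U) (m : Γ(E.mod, U)) :
    hom.app U (E.nabla.app D m) = F.nabla.app D (hom.app U m)

instance : Category (LogConn f I) where
  Hom := Hom
  id E := ⟨𝟙 _, fun D m => by simp⟩
  comp φ ψ := ⟨φ.hom ≫ ψ.hom, fun D m => by simp [φ.horizontal, ψ.horizontal]⟩

end LogConn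

section Restrict
variable {X' : Scheme.{u}} (j : X' ⟶ X) [IsOpenImmersion j] (f : X ⟶ S) {I : X.IdealSheafData}
  (hI : Disjoint (j.opensRange : Set X) (I.support : Set X))

/-- The restriction to `X'` of a logarithmic connection, for an open immersion `j : X' ⟶ X` whose
image does not meet `Y`; it is an `S`-connection without singularities. -/
def Nabla.restrict {M : X.Modules} (n : Nabla f I M) : Nabla (j ≫ f) ⊤ (M.restrict j) where
  app {V} D := (n.app (D.extend j hI : LogDer f I (j ''ᵁ V)) : Γ(M, j ''ᵁ V) →+ Γ(M, j ''ᵁ V))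
  leibniz {V} D a m := by
    have := n.leibniz (D.extend j hI : LogDer f I (j ''ᵁ V)) ((j.appIso V).inv a) m
    rw [LogDer.extend_appIso_inv] at this
    exact this
  add_der {V} D D' m := by
    have : ((D + D').extend j hI : LogDer f I (j ''ᵁ V)) = D.extend j hI + D'.extend j hI := by
      ext W hW a
      exact map_add (openImmersionEquiv j W (hW.trans (image_le_range j V))).symm _ _
    exact (congrArg (fun D => n.app D m) this).trans (n.add_der _ _ _)
  smul_der {V} a D m := by
    have : ((a • D).extend j hI : LogDer f I (j ''ᵁ V)) =
        ((j.appIso V).inv a : Γ(X, j ''ᵁ V)) • D.extend j hI := by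
      ext W hW b
      have h1 := hW.trans (image_le_range j V)
      refine (openImmersionEquiv_symm_eq j W h1 _ _).2 ?_
      change resO _ a * D.app _ _ _ = j.app W (resO _ _ * _)
      rw [map_mul, resO_app, app_appIso_inv_eq, resO_resO]
      congr 1
      exact ((openImmersionEquiv j W h1).apply_symm_apply _).symm
    exact (congrArg (fun D => n.app D m) this).trans (n.smul_der _ _ _)
  bracket {V} D D' m := by
    have : (⁅D, D'⁆.extend j hI : LogDer f I (j ''ᵁ V)) = ⁅D.extend j hI, D'.extend j hI⁆ := by
      ext W hW b
      have h1 := hW.trans (image_le_range j V)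
      refine (openImmersionEquiv_symm_eq j W h1 _ _).2 ?_
      let e := openImmersionEquiv j W h1
      let A := D.app _ (preimage_le j hW)
      let A' := D'.app _ (preimage_le j hW)
      change ⁅A, A'⁆ (e b) = e (e.symm (A (e (e.symm (A' (e b))))) - e.symm (A' (e (e.symm (A (e b))))))
      simp [Derivation.commutator_apply]
    exact (congrArg (fun D => n.app D m) this).trans (n.bracket _ _ _)
  res {V W} h D m := n.res (j.image_mono h) _ _

/-- Restriction of logarithmic connections along `j`, as a functor. -/
def restrictFunctor : LogConn f I ⥤ LogConn (j ≫ f) ⊤ where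
  obj E := ⟨E.mod.restrict j, E.nabla.restrict j f hI⟩
  map {E F} φ := ⟨(Scheme.Modules.restrictFunctor j).map φ.hom, fun {V} D m => φ.horizontal _ _⟩
  map_id E := LogConn.Hom.ext ((Scheme.Modules.restrictFunctor j).map_id _)
  map_comp φ ψ := LogConn.Hom.ext ((Scheme.Modules.restrictFunctor j).map_comp _ _)

end Restrict

/-! ### Coherent modules, regular-singular connections -/

/-- Coherent modules on a locally noetherian scheme: quasi-coherent modules having a finite module
of sections over each affine open. -/
structure IsCoherent (M : X.Modules) : Prop where
  isQuasicoherent : M.IsQuasicoherent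
  finite (U : X.Opens) (hU : IsAffineOpen U) : Module.Finite Γ(X, U) Γ(M, U)

lemma IsCoherent.restrict {X' : Scheme.{u}} (j : X' ⟶ X) [IsOpenImmersion j] {M : X.Modules}
    (h : IsCoherent M) : IsCoherent (M.restrict j) where
  isQuasicoherent := by
    have := h.isQuasicoherent
    infer_instance
  finite U hU := by
    have := h.finite (j ''ᵁ U) (hU.image_of_isOpenImmersion j)
    let σ : Γ(X, j ''ᵁ U) →+* Γ(X', U) := (j.appIso U).commRingCatIsoToRingEquiv.toRingHom
    haveI : RingHomSurjective σ := ⟨(j.appIso U).commRingCatIsoToRingEquiv.surjective⟩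
    let g : Γ(M, j ''ᵁ U) →ₛₗ[σ] Γ(M.restrict j, U) :=
      { toFun := fun m => m
        map_add' := fun _ _ => rfl
        map_smul' := fun r m => by
          change r • m = ((j.appIso U).inv ((j.appIso U).hom r)) • m
          rw [Iso.hom_inv_id_apply] }
    exact Module.Finite.of_surjective g (fun m => ⟨m, rfl⟩)

/-- The property that the module underlying a logarithmic connection is coherent. -/
def coherentProp (f : X ⟶ S) (I : X.IdealSheafData) : ObjectProperty (LogConn f I) :=
  fun E => IsCoherent E.mod

/-- The category of integrable logarithmic `S`-connections `(E, ∇)` on `X` with `E` coherent. -/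
abbrev CLog (f : X ⟶ S) (I : X.IdealSheafData) := (coherentProp f I).FullSubcategory

/-- The category of integrable `S`-connections `(E, ∇)` on `X` with `E` coherent: there is no
divisor, so that its ideal is the unit ideal. -/
abbrev C (f : X ⟶ S) := CLog f ⊤

/-- The open subscheme `X* = X ∖ Y`, for `Y` defined by the ideal sheaf `I`. -/
def complementOpen (I : X.IdealSheafData) : X.Opens := I.support.compl

lemma complementOpen_disjoint (I : X.IdealSheafData) :
    Disjoint ((complementOpen I).ι.opensRange : Set X) (I.support : Set X) := by
  rw [Scheme.Opens.opensRange_ι]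
  exact disjoint_compl_left

/-- The structural morphism `X* ⟶ S`. -/
abbrev starHom (f : X ⟶ S) (I : X.IdealSheafData) : (complementOpen I : Scheme.{u}) ⟶ S :=
  (complementOpen I).ι ≫ f

/-- The restriction functor from logarithmic connections on `X` to connections on `X*`. -/
def restrictCLog (f : X ⟶ S) (I : X.IdealSheafData) : CLog f I ⥤ C (starHom f I) :=
  ObjectProperty.lift _ ((coherentProp f I).ι ⋙ restrictFunctor _ f (complementOpen_disjoint I))
    (fun E => E.property.restrict _)

/-- The regular-singular `S`-connections on `X*`: those which are isomorphic to the restriction of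
some coherent logarithmic connection on `X` (a logarithmic model). -/
def regularSingular (f : X ⟶ S) (I : X.IdealSheafData) : ObjectProperty (C (starHom f I)) :=
  (restrictCLog f I).essImage

/-- `I` is the ideal of a relative (effective) divisor with normal crossings: `X` is covered by
affine opens `U` endowed with functions `x_1, …, x_n` such that `U ⟶ 𝔸ⁿ_S` is étale and such that
`I` is generated on `U` by `x_1 ⋯ x_m` for some `m ≤ n`. -/
structure IsRelativeNCD (f : X ⟶ S) (I : X.IdealSheafData) : Prop where
  exists_coord (p : X) : ∃ (U : X.Opens) (hU : IsAffineOpen U) (_ : p ∈ U) (n m : ℕ) (_ : m ≤ n)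
    (x : Fin n → Γ(X, U)),
    Etale (AffineSpace.homOfVector (U.ι ≫ f)
      (fun i : ULift.{u} (Fin n) => U.topIso.inv (x i.down))) ∧
    I.ideal ⟨U, hU⟩ = Ideal.span {∏ i : Fin n with i.val < m, x i}

/-! ### Duals -/

section Dual

/-- Sections over `U` of `ℋom(M, 𝒪_X)`: compatible families of linear maps
`Γ(M, V) → Γ(X, V)`, `V ≤ U`. -/
structure DualSec (M : X.Modules) (U : X.Opens) : Type u where
  app (V : X.Opens) (hV : V ≤ U) : Γ(M, V) →ₗ[Γ(X, V)] Γ(X, V)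
  app_res {V W : X.Opens} (hV : V ≤ U) (h : W ≤ V) (m : Γ(M, V)) :
    resO h (app V hV m) = app W (h.trans hV) (resM M h m)

namespace DualSec

variable {M : X.Modules} {U : X.Opens}

@[ext] lemma ext' {φ ψ : DualSec M U} (h : ∀ V hV m, φ.app V hV m = ψ.app V hV m) : φ = ψ := by
  cases φ; cases ψ; congr; funext V hV; exact LinearMap.ext (h V hV)

instance : Zero (DualSec M U) := ⟨⟨fun _ _ => 0, fun _ _ _ => by simp⟩⟩

instance : Add (DualSec M U) :=
  ⟨fun φ ψ => ⟨fun V hV => φ.app V hV + ψ.app V hV, fun hV h m => by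
    simp [φ.app_res hV h, ψ.app_res hV h]⟩⟩

instance : Neg (DualSec M U) :=
  ⟨fun φ => ⟨fun V hV => -φ.app V hV, fun hV h m => by simp [φ.app_res hV h]⟩⟩

lemma add_app (φ ψ : DualSec M U) (V) (hV : V ≤ U) (m : Γ(M, V)) :
    (φ + ψ).app V hV m = φ.app V hV m + ψ.app V hV m := rfl

lemma neg_app (φ : DualSec M U) (V) (hV : V ≤ U) (m : Γ(M, V)) :
    (-φ).app V hV m = -φ.app V hV m := rfl

lemma zero_app (V) (hV : V ≤ U) (m : Γ(M, V)) : (0 : DualSec M U).app V hV m = 0 := rfl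

instance : AddCommGroup (DualSec M U) :=
  { AddGroup.ofLeftAxioms
      (fun φ ψ χ => by ext V hV m; simp [add_app, add_assoc])
      (fun φ => by ext V hV m; simp [add_app, zero_app])
      (fun φ => by ext V hV m; simp [add_app, zero_app, neg_app]) with
    add_comm := fun φ ψ => by ext V hV m; simp [add_app, add_comm] }

lemma sub_app (φ ψ : DualSec M U) (V) (hV : V ≤ U) (m : Γ(M, V)) :
    (φ - ψ).app V hV m = φ.app V hV m - ψ.app V hV m := by
  rw [sub_eq_add_neg, add_app, neg_app, sub_eq_add_neg]

instance : SMul Γ(X, U) (DualSec M U) where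
  smul a φ := ⟨fun V hV => resO hV a • φ.app V hV, fun hV h m => by
    simp [φ.app_res hV h m, resO_resO]⟩

lemma smul_app (a : Γ(X, U)) (φ : DualSec M U) (V) (hV : V ≤ U) (m : Γ(M, V)) :
    (a • φ).app V hV m = resO hV a * φ.app V hV m := rfl

instance : Module Γ(X, U) (DualSec M U) where
  one_smul φ := by ext V hV m; simp [smul_app]
  mul_smul a b φ := by ext V hV m; simp [smul_app, mul_assoc]
  smul_zero a := by ext V hV m; simp [smul_app, zero_app]
  smul_add a φ ψ := by ext V hV m; simp [smul_app, add_app, mul_add]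
  add_smul a b φ := by ext V hV m; simp [smul_app, add_app, add_mul]
  zero_smul φ := by ext V hV m; simp [smul_app, zero_app]

/-- Restriction to a smaller open subset. -/
def res {V : X.Opens} (h : V ≤ U) : DualSec M U →+ DualSec M V where
  toFun φ := ⟨fun W hW => φ.app W (hW.trans h), fun hW h' m => φ.app_res (hW.trans h) h' m⟩
  map_zero' := rfl
  map_add' _ _ := rfl

end DualSec

variable (M : X.Modules)

/-- The presheaf of abelian groups underlying `ℋom(M, 𝒪_X)`. -/
def dualPresheaf : TopCat.Presheaf Ab.{u} X where
  obj U := AddCommGrpCat.of (DualSec M U.unop)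
  map i := AddCommGrpCat.ofHom (DualSec.res i.unop.le)

lemma isSheaf_dualPresheaf : (dualPresheaf M).IsSheaf := by
  rw [TopCat.Presheaf.isSheaf_iff_isSheafUniqueGluing]
  intro ι U sf hsf
  let T : ∀ i, DualSec M (U i) := sf
  have hcomp : ∀ i j V (hi : V ≤ U i) (hj : V ≤ U j) (m : Γ(M, V)),
      (T i).app V hi m = (T j).app V hj m := by
    intro i j V hi hj m
    have := hsf i j
    have h2 := congrArg (fun φ : DualSec M (U i ⊓ U j) => φ.app V (le_inf hi hj) m) this
    exact h2
  have key : ∀ V : X.Opens, V ≤ iSup U → ∀ m : Γ(M, V), ∃! a : Γ(X, V), ∀ i,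
      resO (inf_le_left : V ⊓ U i ≤ V) a =
        (T i).app (V ⊓ U i) inf_le_right (resM M inf_le_left m) := by
    intro V hV m
    refine X.sheaf.existsUnique_gluing' (fun i => V ⊓ U i) V (fun i => homOfLE inf_le_left) ?_
      (fun i => (T i).app (V ⊓ U i) inf_le_right (resM M inf_le_left m))
      ?_
    · rw [← inf_iSup_eq]; exact le_inf le_rfl hV
    · intro i j
      change resO inf_le_left _ = resO inf_le_right _
      rw [(T i).app_res, (T j).app_res, resM_resM,
        resM_resM]
      exact hcomp i j _ _ _ _
  choose! g hg hgu using key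
  have hsep : ∀ V : X.Opens, V ≤ iSup U → ∀ a b : Γ(X, V),
      (∀ i, resO (inf_le_left : V ⊓ U i ≤ V) a = resO inf_le_left b) → a = b := by
    intro V hV a b h
    refine eqO_of_locally a b (fun x hx => ?_)
    obtain ⟨i, hi⟩ := Opens.mem_iSup.1 (hV hx)
    exact ⟨V ⊓ U i, inf_le_left, ⟨hx, hi⟩, h i⟩
  let φ : DualSec M (iSup U) := ⟨fun V hV =>
    { toFun := g V
      map_add' := fun m m' => by
        refine hsep V hV _ _ fun i => ?_
        rw [map_add, hg V hV, hg V hV, hg V hV, map_add, map_add]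
      map_smul' := fun a m => by
        refine hsep V hV _ _ fun i => ?_
        simp only [RingHom.id_apply, smul_eq_mul]
        rw [map_mul, hg V hV, hg V hV, resM_smul, map_smul, smul_eq_mul] }, by
    intro V W hV h m
    refine hsep W (h.trans hV) _ _ fun i => ?_
    change resO _ (resO _ (g V m)) = resO _ (g W (resM M h m))
    rw [hg W (h.trans hV), resO_resO, ← resO_resO (inf_le_left : V ⊓ U i ≤ V)
      (inf_le_inf_right _ h), hg V hV, (T i).app_res, resM_resM, resM_resM]⟩
  refine ⟨φ, ?_, ?_⟩
  · intro i
    apply DualSec.ext'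
    intro V hV m
    change g V m = _
    refine (hgu V (hV.trans (le_iSup U i)) m _ (fun j => ?_)).symm
    rw [(T i).app_res]
    exact hcomp _ _ _ _ _ _
  · intro ψ hψ
    apply DualSec.ext'
    intro V hV m
    change _ = g V m
    refine hgu V hV m _ (fun i => ?_)
    refine (DualSec.app_res (U := iSup U) ψ hV inf_le_left m).trans ?_
    exact congrArg (fun φ : DualSec M (U i) => φ.app (V ⊓ U i) inf_le_right (resM M inf_le_left m))
      (hψ i)

instance (U : X.Opensᵒᵖ) : Module (X.ringCatSheaf.obj.obj U) ((dualPresheaf M).obj U) :=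
  inferInstanceAs (Module Γ(X, U.unop) (DualSec M U.unop))

/-- The dual `ℋom(M, 𝒪_X)` of an `𝒪_X`-module. -/
def dual : X.Modules :=
  { val := PresheafOfModules.ofPresheaf (R := X.ringCatSheaf.obj) (dualPresheaf M) (by
      intro U V i a φ
      apply DualSec.ext'
      intro W hW m
      exact congrArg₂ (· * ·) (resO_resO (U := U.unop) i.unop.le hW a).symm rfl)
    isSheaf := isSheaf_dualPresheaf M }

variable {M} {f : X ⟶ S} {I : X.IdealSheafData}

/-- The rule `(∇_D φ)(m) = D(φ(m)) - φ(∇_D m)`. -/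
def Nabla.dualApp (n : Nabla f I M) {U : X.Opens} (D : LogDer f I U) :
    DualSec M U →+ DualSec M U where
  toFun φ :=
    { app := fun V hV =>
        { toFun := fun m => D.app V hV (φ.app V hV m) - φ.app V hV (n.app (D.restrict hV) m)
          map_add' := fun m m' => by simp only [map_add]; abel
          map_smul' := fun a m => by
            have h1 := n.leibniz (D.restrict hV) a m
            have h2 : (D.restrict hV).val a = D.app V hV a := rfl
            rw [h1, h2]
            simp only [map_add, map_smul, smul_eq_mul, Derivation.leibniz, RingHom.id_apply]
            ring }
      app_res := fun {V W} hV h m => by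
        change resO h (_ - _) = D.app W _ (φ.app W _ _) - φ.app W _ (n.app _ _)
        rw [map_sub, D.app_res hV h, φ.app_res hV h, φ.app_res hV h, n.res]
        rfl }
  map_zero' := by
    apply DualSec.ext'
    intro V hV m
    change D.app V hV 0 - 0 = 0
    simp
  map_add' φ ψ := by
    apply DualSec.ext'
    intro V hV m
    change D.app V hV (φ.app V hV m + ψ.app V hV m) - (φ.app V hV _ + ψ.app V hV _) =
      (D.app V hV _ - φ.app V hV _) + (D.app V hV _ - ψ.app V hV _)
    rw [map_add]
    abel

lemma Nabla.dualApp_app (n : Nabla f I M) {U : X.Opens} (D : LogDer f I U) (φ : DualSec M U)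
    (V : X.Opens) (hV : V ≤ U) (m : Γ(M, V)) : (n.dualApp D φ).app V hV m =
      D.app V hV (φ.app V hV m) - φ.app V hV (n.app (D.restrict hV) m) := rfl

/-- The connection `(∇_D φ)(m) = D(φ(m)) - φ(∇_D m)` on the dual module. -/
def Nabla.dual (n : Nabla f I M) : Nabla f I (dual M) where
  app {U} D := (n.dualApp D : DualSec M U →+ DualSec M U)
  leibniz {U} D a φ := by
    refine DualSec.ext' (M := M) (U := U) fun V hV m => ?_
    change D.app V hV (resO hV a * DualSec.app φ V hV m) - resO hV a * DualSec.app φ V hV _ =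
      resO hV (D.app U le_rfl a) * DualSec.app φ V hV m +
        resO hV a * (D.app V hV (DualSec.app φ V hV m) - DualSec.app φ V hV _)
    rw [Derivation.leibniz, D.app_res, smul_eq_mul, smul_eq_mul]
    ring
  add_der {U} D D' φ := by
    refine DualSec.ext' (M := M) (U := U) fun V hV m => ?_
    change (D.app V hV (DualSec.app φ V hV m) + D'.app V hV (DualSec.app φ V hV m)) -
        DualSec.app φ V hV (n.app (D.restrict hV + D'.restrict hV) m) =
      (D.app V hV (DualSec.app φ V hV m) - DualSec.app φ V hV (n.app (D.restrict hV) m)) +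
      (D'.app V hV (DualSec.app φ V hV m) - DualSec.app φ V hV (n.app (D'.restrict hV) m))
    rw [n.add_der, map_add]
    abel
  smul_der {U} a D φ := by
    refine DualSec.ext' (M := M) (U := U) fun V hV m => ?_
    have h : (a • D).restrict hV = resO hV a • D.restrict hV := by
      ext W hW b
      change resO _ a * _ = resO _ (resO _ a) * _
      rw [resO_resO]
      rfl
    change resO hV a * (D.app V hV (DualSec.app φ V hV m)) -
        DualSec.app φ V hV (n.app ((a • D).restrict hV) m) =
      resO hV a * (D.app V hV (DualSec.app φ V hV m) - DualSec.app φ V hV (n.app (D.restrict hV) m))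
    rw [h, n.smul_der, map_smul, smul_eq_mul]
    ring
  bracket {U} D D' φ := by
    refine DualSec.ext' (M := M) (U := U) fun V hV m => ?_
    have key (P Q : LogDer f I U) : (n.dualApp P (n.dualApp Q φ)).app V hV m =
        P.app V hV (Q.app V hV (DualSec.app φ V hV m) -
          DualSec.app φ V hV (n.app (Q.restrict hV) m)) -
        (Q.app V hV (DualSec.app φ V hV (n.app (P.restrict hV) m)) -
          DualSec.app φ V hV (n.app (Q.restrict hV) (n.app (P.restrict hV) m))) := rfl
    refine Eq.trans ?_ (DualSec.sub_app (M := M) (n.dualApp D (n.dualApp D' φ))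
      (n.dualApp D' (n.dualApp D φ)) V hV m).symm
    rw [key D D', key D' D]
    change ⁅D.app V hV, D'.app V hV⁆ (DualSec.app φ V hV m) -
        DualSec.app φ V hV (n.app ⁅D.restrict hV, D'.restrict hV⁆ m) = _
    rw [n.bracket, Derivation.commutator_apply]
    simp only [map_sub]
    abel
  res {U V} h D φ := by
    refine DualSec.ext' (M := M) (U := V) fun W hW m => ?_
    rfl

end Dual

/-! ### Tensor products -/

section Tensor

open TensorProduct

variable (M N : X.Modules)

/-- Sections of the presheaf tensor product. -/
abbrev TSec (U : X.Opens) : Type u := Γ(M, U) ⊗[Γ(X, U)] Γ(N, U)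

/-- The presheaf tensor product of two `𝒪_X`-modules. -/
def tensorPre : X.PresheafOfModules :=
  PresheafOfModules.Monoidal.tensorObj (R := X.presheaf) M.val N.val

/-- The tensor product of two `𝒪_X`-modules: the sheaf associated to the presheaf tensor product. -/
def tensor : X.Modules :=
  (PresheafOfModules.sheafification (𝟙 X.ringCatSheaf.obj)).obj (tensorPre M N)

/-- The canonical morphism from the presheaf tensor product to its associated sheaf. -/
def tensorUnitMap : tensorPre M N ⟶ (tensor M N).val :=
  (PresheafOfModules.sheafificationAdjunction (𝟙 X.ringCatSheaf.obj)).unit.app (tensorPre M N)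

/-- The canonical map from `Γ(M, U) ⊗ Γ(N, U)` to the sections over `U` of the tensor product. -/
def toTensor (U : X.Opens) : TSec M N U →ₗ[Γ(X, U)] Γ(tensor M N, U) :=
  ((tensorUnitMap M N).app (op U)).hom

/-- Restriction of sections of the presheaf tensor product. -/
def resT {U V : X.Opens} (h : V ≤ U) : TSec M N U →+ TSec M N V :=
  (((tensorPre M N).map (homOfLE h).op).hom).toAddMonoidHom

lemma resT_tmul {U V : X.Opens} (h : V ≤ U) (m : Γ(M, U)) (n : Γ(N, U)) :
    resT M N h (m ⊗ₜ n) = resM M h m ⊗ₜ resM N h n := rfl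

lemma toTensor_res {U V : X.Opens} (h : V ≤ U) (t : TSec M N U) :
    toTensor M N V (resT M N h t) = resM (tensor M N) h (toTensor M N U t) :=
  PresheafOfModules.naturality_apply (tensorUnitMap M N) (homOfLE h).op t

lemma toTensor_locInj {U : X.Opens} (s t : TSec M N U) (h : toTensor M N U s = toTensor M N U t) :
    ∀ x ∈ U, ∃ (V : X.Opens) (hV : V ≤ U), x ∈ V ∧ resT M N hV s = resT M N hV t := by
  intro x hx
  have := Presheaf.equalizerSieve_mem (J := Opens.grothendieckTopology X)
    (φ := CategoryTheory.toSheafify (Opens.grothendieckTopology X) (tensorPre M N).presheaf)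
    (X := op U) s t h
  obtain ⟨V, i, hi, hxV⟩ := this x hx
  exact ⟨V, i.le, hxV, hi⟩

lemma toTensor_locSurj {U : X.Opens} (t : Γ(tensor M N, U)) :
    ∀ x ∈ U, ∃ (V : X.Opens) (hV : V ≤ U), x ∈ V ∧
      ∃ s : TSec M N V, toTensor M N V s = resM _ hV t := by
  intro x hx
  have := Presheaf.imageSieve_mem (J := Opens.grothendieckTopology X)
    (CategoryTheory.toSheafify (Opens.grothendieckTopology X) (tensorPre M N).presheaf)
    (U := op U) t
  obtain ⟨V, i, ⟨s, hs⟩, hxV⟩ := this x hx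
  exact ⟨V, i.le, hxV, s, hs⟩

variable {M N} {f : X ⟶ S} {I : X.IdealSheafData} (nM : Nabla f I M) (nN : Nabla f I N)

/-- The rule `∇_D (m ⊗ n) = ∇_D m ⊗ n + m ⊗ ∇_D n` on the presheaf tensor product. -/
def tensorPreApp {U : X.Opens} (D : LogDer f I U) : TSec M N U →+ TSec M N U :=
  TensorProduct.liftAddHom
    { toFun := fun m =>
        { toFun := fun n => nM.app D m ⊗ₜ n + m ⊗ₜ nN.app D n
          map_zero' := by simp
          map_add' := fun n n' => by simp only [map_add, TensorProduct.tmul_add]; abel }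
      map_zero' := by ext n; simp
      map_add' := fun m m' => by
        ext n
        simp only [map_add, TensorProduct.add_tmul, AddMonoidHom.coe_mk, ZeroHom.coe_mk,
          AddMonoidHom.add_apply]
        abel }
    (fun a m n => by
      simp only [AddMonoidHom.coe_mk, ZeroHom.coe_mk, nM.leibniz, nN.leibniz,
        TensorProduct.add_tmul, TensorProduct.tmul_add, TensorProduct.smul_tmul]
      abel)

lemma tensorPreApp_tmul {U : X.Opens} (D : LogDer f I U) (m : Γ(M, U)) (n : Γ(N, U)) :
    tensorPreApp nM nN D (m ⊗ₜ n) = nM.app D m ⊗ₜ n + m ⊗ₜ nN.app D n := rfl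

lemma tensorPreApp_res {U V : X.Opens} (h : V ≤ U) (D : LogDer f I U) (t : TSec M N U) :
    resT M N h (tensorPreApp nM nN D t) = tensorPreApp nM nN (D.restrict h) (resT M N h t) := by
  induction t using TensorProduct.induction_on with
  | zero => simp only [map_zero]
  | add s t hs ht => simp only [map_add, hs, ht]
  | tmul m n =>
    simp only [tensorPreApp_tmul, map_add, resT_tmul, nM.res, nN.res]

lemma tensorPreApp_leibniz {U : X.Opens} (D : LogDer f I U) (a : Γ(X, U)) (t : TSec M N U) :
    tensorPreApp nM nN D (a • t) = D.val a • t + a • tensorPreApp nM nN D t := by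
  induction t using TensorProduct.induction_on with
  | zero => simp only [map_zero, smul_zero, add_zero]
  | add s t hs ht => simp only [map_add, hs, ht, smul_add]; abel
  | tmul m n =>
    rw [TensorProduct.smul_tmul']
    simp only [tensorPreApp_tmul, nM.leibniz, TensorProduct.add_tmul, smul_add,
      TensorProduct.smul_tmul']
    abel

lemma tensorPreApp_add {U : X.Opens} (D D' : LogDer f I U) (t : TSec M N U) :
    tensorPreApp nM nN (D + D') t = tensorPreApp nM nN D t + tensorPreApp nM nN D' t := by
  induction t using TensorProduct.induction_on with
  | zero => simp only [map_zero, add_zero]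
  | add s t hs ht => simp only [map_add, hs, ht]; abel
  | tmul m n =>
    simp only [tensorPreApp_tmul, nM.add_der, nN.add_der, TensorProduct.add_tmul,
      TensorProduct.tmul_add]
    abel

lemma tensorPreApp_smul {U : X.Opens} (a : Γ(X, U)) (D : LogDer f I U) (t : TSec M N U) :
    tensorPreApp nM nN (a • D) t = a • tensorPreApp nM nN D t := by
  induction t using TensorProduct.induction_on with
  | zero => simp only [map_zero, smul_zero]
  | add s t hs ht => simp only [map_add, hs, ht, smul_add]
  | tmul m n =>
    simp only [tensorPreApp_tmul, nM.smul_der, nN.smul_der, TensorProduct.smul_tmul',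
      TensorProduct.tmul_smul, smul_add]

lemma tensorPreApp_bracket {U : X.Opens} (D D' : LogDer f I U) (t : TSec M N U) :
    tensorPreApp nM nN ⁅D, D'⁆ t = tensorPreApp nM nN D (tensorPreApp nM nN D' t) -
      tensorPreApp nM nN D' (tensorPreApp nM nN D t) := by
  induction t using TensorProduct.induction_on with
  | zero => simp only [map_zero, sub_zero]
  | add s t hs ht => simp only [map_add, hs, ht]; abel
  | tmul m n =>
    simp only [tensorPreApp_tmul, nM.bracket, nN.bracket, map_add, TensorProduct.sub_tmul,
      TensorProduct.tmul_sub]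
    abel

/-- `s` is the image of `t` under the operator which `∇_D` on the presheaf tensor product induces
on the associated sheaf. -/
def IsTensorDer {U : X.Opens} (D : LogDer f I U) (t s : Γ(tensor M N, U)) : Prop :=
  ∀ (V : X.Opens) (hV : V ≤ U) (p : TSec M N V), toTensor M N V p = resM _ hV t →
    toTensor M N V (tensorPreApp nM nN (D.restrict hV) p) = resM _ hV s

lemma IsTensorDer.unique {U : X.Opens} {D : LogDer f I U} {t s s' : Γ(tensor M N, U)}
    (h : IsTensorDer nM nN D t s) (h' : IsTensorDer nM nN D t s') : s = s' := by
  refine eqM_of_locally _ _ _ fun x hx => ?_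
  obtain ⟨V, hV, hxV, p, hp⟩ := toTensor_locSurj M N t x hx
  exact ⟨V, hV, hxV, (h V hV p hp).symm.trans (h' V hV p hp)⟩

lemma tensorDer_wd {U : X.Opens} (D : LogDer f I U) (p q : TSec M N U)
    (h : toTensor M N U p = toTensor M N U q) :
    toTensor M N U (tensorPreApp nM nN D p) = toTensor M N U (tensorPreApp nM nN D q) := by
  refine eqM_of_locally _ _ _ fun x hx => ?_
  obtain ⟨V, hV, hxV, hpq⟩ := toTensor_locInj M N p q h x hx
  refine ⟨V, hV, hxV, ?_⟩
  rw [← toTensor_res, ← toTensor_res, tensorPreApp_res, tensorPreApp_res, hpq]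

lemma exists_tensorDer {U : X.Opens} (D : LogDer f I U) (t : Γ(tensor M N, U)) :
    ∃ s, IsTensorDer nM nN D t s := by
  choose! V hV hx p hp using toTensor_locSurj M N t
  have hcomp : ∀ (W : X.Opens) (hW : W ≤ U) (q : TSec M N W), toTensor M N W q = resM _ hW t →
      ∀ (x) (hx : x ∈ U) (W' : X.Opens) (h : W' ≤ V x) (h' : W' ≤ W),
        resM _ h (toTensor M N (V x) (tensorPreApp nM nN (D.restrict (hV x hx)) (p x))) =
        resM _ h' (toTensor M N W (tensorPreApp nM nN (D.restrict hW) q)) := by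
    intro W hW q hq x hx W' h h'
    rw [← toTensor_res, ← toTensor_res, tensorPreApp_res, tensorPreApp_res]
    refine tensorDer_wd nM nN _ _ _ ?_
    rw [toTensor_res, toTensor_res, hp x hx, hq, resM_resM, resM_resM]
  obtain ⟨s, hs, -⟩ := TopCat.Sheaf.existsUnique_gluing' ⟨_, (tensor M N).isSheaf⟩
    (fun x : U => V x.1) U (fun x => homOfLE (hV x.1 x.2))
    (fun x hxU => Opens.mem_iSup.2 ⟨⟨x, hxU⟩, hx x hxU⟩)
    (fun x => toTensor M N (V x.1) (tensorPreApp nM nN (D.restrict (hV x.1 x.2)) (p x.1)))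
    (fun x y => hcomp (V y.1) (hV y.1 y.2) (p y.1) (hp y.1 y.2) x.1 x.2 _
      inf_le_left inf_le_right)
  refine ⟨s, fun W hW q hq => ?_⟩
  refine eqM_of_locally _ _ _ fun x hxW => ?_
  refine ⟨V x ⊓ W, inf_le_right, ⟨hx x (hW hxW), hxW⟩, ?_⟩
  rw [← hcomp W hW q hq x (hW hxW) _ inf_le_left inf_le_right, resM_resM]
  have := hs ⟨x, hW hxW⟩
  change resM _ _ s = _ at this
  rw [← this, resM_resM]

/-- The operator on the tensor product sheaf induced by `∇_D ⊗ 1 + 1 ⊗ ∇_D`. -/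
def tensorApp {U : X.Opens} (D : LogDer f I U) (t : Γ(tensor M N, U)) : Γ(tensor M N, U) :=
  (exists_tensorDer nM nN D t).choose

lemma isTensorDer_tensorApp {U : X.Opens} (D : LogDer f I U) (t : Γ(tensor M N, U)) :
    IsTensorDer nM nN D t (tensorApp nM nN D t) := (exists_tensorDer nM nN D t).choose_spec

lemma resM_tensorApp {U V : X.Opens} (h : V ≤ U) (D : LogDer f I U) (t : Γ(tensor M N, U)) :
    resM _ h (tensorApp nM nN D t) = tensorApp nM nN (D.restrict h) (resM _ h t) := by
  refine IsTensorDer.unique nM nN (D := D.restrict h) (t := resM _ h t) ?_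
    (isTensorDer_tensorApp nM nN _ _)
  intro W hW p hp
  rw [resM_resM] at hp ⊢
  exact isTensorDer_tensorApp nM nN D t W _ p hp

lemma tensorApp_toTensor {U : X.Opens} (D : LogDer f I U) (p : TSec M N U) :
    tensorApp nM nN D (toTensor M N U p) = toTensor M N U (tensorPreApp nM nN D p) := by
  have := isTensorDer_tensorApp nM nN D (toTensor M N U p) U le_rfl p (resM_self _ _).symm
  rw [resM_self] at this
  exact this.symm

lemma tensor_ext_local {U : X.Opens} (t t' : Γ(tensor M N, U)) (A B : Γ(tensor M N, U))
    (H : ∀ (V : X.Opens) (h : V ≤ U) (p p' : TSec M N V), toTensor M N V p = resM _ h t →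
      toTensor M N V p' = resM _ h t' → resM _ h A = resM _ h B) : A = B := by
  refine eqM_of_locally _ _ _ fun x hx => ?_
  obtain ⟨V, hV, hxV, p, hp⟩ := toTensor_locSurj M N t x hx
  obtain ⟨W, hW, hxW, q, hq⟩ := toTensor_locSurj M N t' x hx
  refine ⟨V ⊓ W, inf_le_left.trans hV, ⟨hxV, hxW⟩, ?_⟩
  refine H _ _ (resT M N inf_le_left p) (resT M N inf_le_right q) ?_ ?_
  · rw [toTensor_res, hp, resM_resM]
  · rw [toTensor_res, hq, resM_resM]

/-- The connection on the tensor product, `∇_D (m ⊗ n) = ∇_D m ⊗ n + m ⊗ ∇_D n`. -/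
def Nabla.tensor : Nabla f I (tensor M N) where
  app {U} D := AddMonoidHom.mk' (tensorApp nM nN D) (fun t t' => by
    refine tensor_ext_local t t' _ _ fun V h p p' hp hp' => ?_
    simp only [resM_tensorApp, map_add]
    rw [← hp, ← hp', ← map_add (toTensor M N V) p p', tensorApp_toTensor, tensorApp_toTensor,
      tensorApp_toTensor, map_add, map_add])
  leibniz {U} D a t := by
    refine tensor_ext_local t t _ _ fun V h p _ hp _ => ?_
    change resM _ h (tensorApp nM nN D _) = resM _ h (_ + _ • tensorApp nM nN D t)
    have h1 : resO h (D.val a) = (D.restrict h).val (resO h a) := D.app_res le_rfl h a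
    simp only [resM_tensorApp, map_add, resM_smul]
    rw [← hp, ← map_smul (toTensor M N V) (resO h a) p, tensorApp_toTensor, tensorApp_toTensor,
      tensorPreApp_leibniz, map_add, map_smul, map_smul, h1]
  add_der {U} D D' t := by
    refine tensor_ext_local t t _ _ fun V h p _ hp _ => ?_
    change resM _ h (tensorApp nM nN _ t) = resM _ h (tensorApp nM nN D t + tensorApp nM nN D' t)
    simp only [resM_tensorApp, map_add]
    rw [← hp]
    simp only [tensorApp_toTensor]
    rw [← map_add, ← tensorPreApp_add]
    rfl
  smul_der {U} a D t := by
    refine tensor_ext_local t t _ _ fun V h p _ hp _ => ?_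
    change resM _ h (tensorApp nM nN _ t) = resM _ h (a • tensorApp nM nN D t)
    have h2 : (a • D).restrict h = resO h a • D.restrict h := by
      ext W hW b
      change resO _ a * _ = resO _ (resO _ a) * _
      rw [resO_resO]
      rfl
    simp only [resM_tensorApp, resM_smul, h2]
    rw [← hp]
    simp only [tensorApp_toTensor, tensorPreApp_smul, map_smul]
  bracket {U} D D' t := by
    refine tensor_ext_local t t _ _ fun V h p _ hp _ => ?_
    change resM _ h (tensorApp nM nN _ t) = resM _ h (tensorApp nM nN D (tensorApp nM nN D' t) -
      tensorApp nM nN D' (tensorApp nM nN D t))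
    simp only [resM_tensorApp, map_sub]
    rw [← hp]
    simp only [tensorApp_toTensor]
    rw [← map_sub, ← tensorPreApp_bracket]
    rfl
  res {U V} h D t := resM_tensorApp nM nN h D t

end Tensor

variable {f : X ⟶ S} {I : X.IdealSheafData}

/-- The tensor product of two modules with connection. -/
def LogConn.tensor (E F : LogConn f I) : LogConn f I := ⟨RegSing.tensor E.mod F.mod, E.nabla.tensor F.nabla⟩
/-- The dual of a module with connection. -/
def LogConn.dual (E : LogConn f I) : LogConn f I := ⟨RegSing.dual E.mod, E.nabla.dual⟩

end RegSing

end

noncomputable section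

namespace RegSing

variable {X S : Scheme.{u}}

/-! Everything is carried out on a logarithmic model Ē of E, a coherent logarithmic connection on X
with j^*Ē isomorphic to E. The scheme X is locally noetherian because f is locally of finite type.

Let F be a subobject of j^*Ē, and let F' ⊂ Ē be the sections whose restriction to X* lies in F. A
logarithmic derivation restricts to an ordinary derivation on X*, and F is stable under those, so F'
is stable under Der_Y(X/S) (`SubPresheaf.extend_isHorizontal`). It is quasi-coherent: if s is a
section of F' over D(g) in an affine U, some g^k s extends to a section of Ē over U, and since
j⁻¹(U) is quasi-compact a further power of g moves the restriction of this section into F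
(`SubPresheaf.extend_extends`). It is coherent because U is noetherian. On X* it is F itself, so F'
is a model of F. For a quotient Q of j^*Ē with kernel K, the quotient Ē/K' is a model of Q. Both
arguments need monomorphisms to be injective on sections and epimorphisms to be locally surjective;
this holds because kernels and cokernels are again coherent connections, against which the zero
morphism can be compared (`CLog.injective_of_mono`, `CLog.locally_surjective_of_epi`).

For tensor products and duals, the same operation on the models gives a model, because both
operations commute with restriction to an open subscheme (`tensorRestrictIso`, `dualRestrictIso`).
No model has to be locally free.

Coherence is always checked through `IsLocalizing`: for U affine, the sections over D(g) are the
localization at g of the sections over U. For a sheafified presheaf (quotient, tensor product), the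
presheaf version of this condition already makes presheaf and sheaf agree on affine opens. For the
dual it is the compatibility of Hom with localization for finitely presented modules. Isomorphisms
of connections are mostly given by their graphs (`Corr`), which need values only locally. -/

/-- Over affine opens, sections over a basic open are obtained by localization. -/
structure IsLocalizing (M : X.Modules) : Prop where
  inj {U : X.Opens} (hU : IsAffineOpen U) (g : Γ(X, U)) (m : Γ(M, U))
    (h : resM M (X.basicOpen_le g) m = 0) : ∃ k : ℕ, g ^ k • m = 0
  surj {U : X.Opens} (hU : IsAffineOpen U) (g : Γ(X, U)) (s : Γ(M, X.basicOpen g)) :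
    ∃ (k : ℕ) (m : Γ(M, U)), resM M (X.basicOpen_le g) m = resO (X.basicOpen_le g) g ^ k • s

/-! ### Quasi-coherence as localization of sections over affine opens -/

lemma fromSpec_image_top {U : X.Opens} (hU : IsAffineOpen U) : hU.fromSpec ''ᵁ ⊤ = U := by
  rw [Scheme.Hom.image_top_eq_opensRange, hU.opensRange_fromSpec]

lemma fromSpec_appIso_inv {U : X.Opens} (hU : IsAffineOpen U) (g : Γ(X, U)) :
    (hU.fromSpec.appIso ⊤).inv ((Scheme.ΓSpecIso Γ(X, U)).inv g) =
      resO (fromSpec_image_top hU).le g := by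
  have h1 : (hU.fromSpec.appIso ⊤).hom (resO (fromSpec_image_top hU).le g) =
      (Scheme.ΓSpecIso Γ(X, U)).inv g := by
    rw [Scheme.Hom.appIso_hom]
    have h2 := resO_app hU.fromSpec (fromSpec_image_top hU).le g
    rw [hU.fromSpec_app_self] at h2
    simp only [CommRingCat.comp_apply]
    rw [h2]
    simp only [resO, ← CommRingCat.comp_apply, ← Functor.map_comp, Category.assoc]
    simp
  rw [← h1, Iso.hom_inv_id_apply]

/-- Identifies the action of the global ring used in the criterion for modules on a spectrum with
the action of functions on `X`. -/
lemma smul_restrict_fromSpec (M : X.Modules) {U : X.Opens} (hU : IsAffineOpen U) (g : Γ(X, U))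
    (m : Γ(M.restrict hU.fromSpec, ⊤)) :
    g • m = (resO (fromSpec_image_top hU).le g • (show Γ(M, hU.fromSpec ''ᵁ ⊤) from m) :
      Γ(M, hU.fromSpec ''ᵁ ⊤)) := by
  rw [← fromSpec_appIso_inv, Scheme.Modules.smul_Spec_def]
  have : (Spec Γ(X, U)).presheaf.map (⊤ : (Spec Γ(X, U)).Opens).leTop.op = 𝟙 _ :=
    (Spec Γ(X, U)).presheaf.map_id _
  rw [this]
  rfl

lemma smul_restrict_fromSpec_of_le (M : X.Modules) {U : X.Opens} (hU : IsAffineOpen U)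
    (g : Γ(X, U)) (V : (Spec Γ(X, U)).Opens) (h : hU.fromSpec ''ᵁ V ≤ U)
    (m : Γ(M.restrict hU.fromSpec, V)) :
    g • m = (resO h g • (show Γ(M, hU.fromSpec ''ᵁ V) from m) : Γ(M, hU.fromSpec ''ᵁ V)) := by
  have h1 := resO_appIso_inv hU.fromSpec (le_top : V ≤ ⊤)
    ((Scheme.ΓSpecIso Γ(X, U)).inv g)
  have h2 := resO_resO (fromSpec_image_top hU).le (hU.fromSpec.image_mono (le_top : V ≤ ⊤)) g
  rw [← fromSpec_appIso_inv] at h2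
  rw [← h2, ← h1, Scheme.Modules.smul_Spec_def]
  rfl

/-- Quasi-coherence means that Γ(N, ⊤) → Γ(N, D(g)) is a localization at g for every g. Since g acts
invertibly over D(g) in any case, only the injectivity and surjectivity conditions remain. The open
is a variable `D` with an equation, so that it can be replaced by an equal one. -/
lemma isQuasicoherent_Spec_iff {R : CommRingCat.{u}} (N : (Spec R).Modules) :
    N.IsQuasicoherent ↔ ∀ (g : R) (D : (Spec R).Opens), D = PrimeSpectrum.basicOpen g →
      (∀ m : Γ(N, ⊤), resM N (le_top : D ≤ ⊤) m = 0 → ∃ k : ℕ, g ^ k • m = 0) ∧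
      ∀ s : Γ(N, D), ∃ (k : ℕ) (m : Γ(N, ⊤)), resM N (le_top : D ≤ ⊤) m = g ^ k • s := by
  rw [isQuasicoherent_iff_isIso_fromTildeΓ, isIso_fromTildeΓ_iff_isLocalizing]
  refine ⟨?_, fun H g => ?_⟩
  · rintro H g _ rfl
    have h := H g
    refine ⟨fun m hm => ?_, fun s => ?_⟩
    · obtain ⟨⟨_, k, rfl⟩, hk⟩ := (IsLocalizedModule.eq_zero_iff (Submonoid.powers g)
        ((modulesSpecToSheaf.obj N).obj.map (PrimeSpectrum.basicOpen g).leTop.op).hom).1 hm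
      exact ⟨k, hk⟩
    · obtain ⟨⟨m, ⟨_, k, rfl⟩⟩, hm⟩ := h.surj s
      exact ⟨k, m, hm.symm⟩
  · obtain ⟨h1, h2⟩ := H g _ rfl
    refine IsLocalizedModule.Away.mk_of_addCommGroup
      (Scheme.Modules.isUnit_algebraMap_end_of_le_basicOpen g le_rfl) (fun s => ?_) h1
    obtain ⟨k, m, hm⟩ := h2 s
    exact ⟨k, m, hm.symm⟩

theorem IsLocalizing.of_isQuasicoherent (M : X.Modules) [M.IsQuasicoherent] : IsLocalizing M := by
  have key {U : X.Opens} (hU : IsAffineOpen U) (g : Γ(X, U)) :=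
    (isQuasicoherent_Spec_iff (M.restrict hU.fromSpec)).1 inferInstance g _ rfl
  have hI {U : X.Opens} (hU : IsAffineOpen U) (g : Γ(X, U)) := hU.fromSpec_image_basicOpen g
  refine ⟨fun {U} hU g m h => ?_, fun {U} hU g s => ?_⟩
  · have hT := fromSpec_image_top hU
    replace key := (key hU g).1
    replace hI := hI hU g
    -- Only the equality of `hU.fromSpec ''ᵁ D` with `X.basicOpen g` matters from here on. Sections
    -- are moved between equal opens by restriction in either direction, without casts.
    generalize PrimeSpectrum.basicOpen g = D at key hI
    change (Spec Γ(X, U)).Opens at D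
    obtain ⟨k, hk⟩ := key (resM M hT.le m) (by
      change resM M (hU.fromSpec.image_mono le_top) (resM M hT.le m) = 0
      rw [resM_resM, ← resM_resM M (X.basicOpen_le g) hI.le, h, map_zero])
    refine ⟨k, ?_⟩
    have h2 := (smul_restrict_fromSpec M hU (g ^ k) (resM M hT.le m : _)).symm.trans hk
    rw [← resM_self M (g ^ k • m), ← resM_resM M hT.le hT.ge, resM_smul]
    exact (congrArg (resM M hT.ge) h2).trans (map_zero _)
  · have hT := fromSpec_image_top hU
    replace key := (key hU g).2
    replace hI := hI hU g
    generalize PrimeSpectrum.basicOpen g = D at key hI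
    change (Spec Γ(X, U)).Opens at D
    obtain ⟨k, m, hm⟩ := key (resM M hI.le s)
    change Γ(M, hU.fromSpec ''ᵁ ⊤) at m
    refine ⟨k, resM M hT.ge m, ?_⟩
    have h2 := (smul_restrict_fromSpec_of_le M hU (g ^ k) D (hI.le.trans (X.basicOpen_le g))
      (resM M hI.le s : _)).symm.trans hm.symm
    change _ = resM M (hU.fromSpec.image_mono le_top) m at h2
    have h3 := congrArg (resM M hI.ge) h2
    simp only [resM_resM, resM_smul, resM_self, resO_resO] at h3
    rw [resM_resM, ← h3, map_pow]

theorem IsLocalizing.restrict_fromSpec {M : X.Modules} (hM : IsLocalizing M) {U : X.Opens}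
    (hU : IsAffineOpen U) : (M.restrict hU.fromSpec).IsQuasicoherent := by
  rw [isQuasicoherent_Spec_iff]
  rintro g D hD
  have hT := fromSpec_image_top hU
  have hI : hU.fromSpec ''ᵁ D = X.basicOpen g := hD ▸ hU.fromSpec_image_basicOpen g
  constructor
  · intro (m : Γ(M, hU.fromSpec ''ᵁ ⊤)) hm
    obtain ⟨k, hk⟩ := hM.inj hU g (resM M hT.ge m) (by
      change resM M (hU.fromSpec.image_mono le_top) m = 0 at hm
      rw [resM_resM, ← resM_resM M (hU.fromSpec.image_mono le_top) hI.ge, hm, map_zero])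
    refine ⟨k, (smul_restrict_fromSpec M hU (g ^ k) m).trans ?_⟩
    have h3 := congrArg (resM M hT.le) hk
    rw [resM_smul, resM_resM, resM_self, map_zero] at h3
    exact h3
  · intro (s : Γ(M, hU.fromSpec ''ᵁ D))
    obtain ⟨k, m, hm⟩ := hM.surj hU g (resM M hI.ge s)
    refine ⟨k, (resM M hT.le m :), ?_⟩
    refine Eq.trans ?_
      (smul_restrict_fromSpec_of_le M hU (g ^ k) _ (hI.le.trans (X.basicOpen_le g)) s).symm
    change resM M (hU.fromSpec.image_mono le_top) (resM M hT.le m) = _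
    have h3 := congrArg (resM M hI.le) hm
    rw [resM_resM, resM_smul, resM_resM, resM_self, ← map_pow, resO_resO] at h3
    rw [← h3, resM_resM]

/-! ### From presentations over affine opens to quasi-coherence -/

/-- Transport of presentations along isomorphisms of modules on a scheme. -/
def presentationOfIso {M N : X.Modules} (e : M ≅ N) (p : SheafOfModules.Presentation.{u} M) :
    SheafOfModules.Presentation.{u} N :=
  haveI : IsIso (C := SheafOfModules.{u} X.ringCatSheaf) e.hom :=
    (inferInstance : IsIso (C := X.Modules) e.hom)
  SheafOfModules.Presentation.ofIsIso.{u, u, u} (R := X.ringCatSheaf) e.hom p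

/-- A quasi-coherent module on an affine scheme has a global presentation. -/
def presentationOfIsQuasicoherent {R : CommRingCat.{u}} (N : (Spec R).Modules)
    [N.IsQuasicoherent] : SheafOfModules.Presentation.{u} N :=
  haveI := (isQuasicoherent_iff_isIso_fromTildeΓ N).1 ‹_›
  presentationOfIso (asIso N.fromTildeΓ)
      (presentationTilde.{u} _ .univ (by simp) _ (Submodule.span_eq _))

/-- A global presentation of a quasi-coherent module over an affine open subscheme. -/
def presentationRestrictι (M : X.Modules) {U : X.Opens} (hU : IsAffineOpen U)
    [(M.restrict hU.fromSpec).IsQuasicoherent] :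
    SheafOfModules.Presentation.{u} (M.restrict U.ι) :=
  presentationOfIso
    ((Scheme.Modules.restrictFunctorComp hU.isoSpec.hom hU.fromSpec).symm.app M ≪≫
      (Scheme.Modules.restrictFunctorCongr (by simp)).app M)
    (Scheme.Modules.presentationRestrict hU.isoSpec.hom
      (presentationOfIsQuasicoherent (M.restrict hU.fromSpec)))

/-- The inverse image of a presentation on an open subscheme, over the slice site. -/
def presentationOver (M : X.Modules) {U : X.Opens} (p : SheafOfModules.Presentation.{u} (M.restrict U.ι)) :
    SheafOfModules.Presentation.{u} (SheafOfModules.over M U) :=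
  let e : SheafOfModules.{u} (X.ringCatSheaf.over U) ≌ SheafOfModules.{u} U.toScheme.ringCatSheaf := Scheme.Modules.overEquiv U
  haveI : Limits.PreservesColimitsOfSize.{u, u} e.inverse := inferInstance
  let i : e.functor.obj (SheafOfModules.over M U) ≅ M.restrict U.ι := (Scheme.Modules.overFunctorEquiv U).app M
  SheafOfModules.Presentation.ofIsIso.{u, u, u}
    (e.inverse.mapIso i.symm ≪≫
      (e.unitIso.symm.app (SheafOfModules.over M U))).hom
    (p.map e.inverse
      (Opens.sheafOfModulesEquivOverInverseUnit U _).symm)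

/-- Quasi-coherence is the existence of presentations over a cover. The affine opens form one, and
the presentation on each spectrum is carried to the open subscheme and then to the slice site. -/
theorem isQuasicoherent_of_restrict_fromSpec (M : X.Modules)
    (h : ∀ (U : X.Opens) (hU : IsAffineOpen U), (M.restrict hU.fromSpec).IsQuasicoherent) :
    M.IsQuasicoherent := by
  refine SheafOfModules.QuasicoherentData.isQuasicoherent (M := M)
    { I := X.affineOpens
      X := fun U => U.1
      coversTop := ?_
      presentation := fun U =>
        haveI := h U.1 U.2
        presentationOver M (presentationRestrictι M U.2) }
  rw [Opens.coversTop_iff]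
  exact iSup_affineOpens_eq_top X

theorem IsLocalizing.isQuasicoherent {M : X.Modules} (hM : IsLocalizing M) : M.IsQuasicoherent :=
  isQuasicoherent_of_restrict_fromSpec M fun _ hU => hM.restrict_fromSpec hU

/-! ### Bounded exponents and partitions of unity -/

section Compactness

lemma basicOpen_resO_le {U V : X.Opens} (h : V ≤ U) (g : Γ(X, U)) :
    X.basicOpen (resO h g) ≤ X.basicOpen g := by
  rw [resO]
  exact (X.basicOpen_res g (homOfLE h).op).le.trans inf_le_right

/-- A locally bounded exponent on a quasi-compact open subset is bounded. -/
lemma exists_exponent {W : X.Opens} (hW : IsCompact (W : Set X)) (p : ℕ → X.Opens → Prop)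
    (hp : ∀ k l V, k ≤ l → p k V → p l V)
    (h : ∀ x ∈ W, ∃ V : X.Opens, V ≤ W ∧ x ∈ V ∧ ∃ k, p k V) :
    ∃ k, ∀ x ∈ W, ∃ V : X.Opens, V ≤ W ∧ x ∈ V ∧ p k V := by
  choose! V hV hx k hk using h
  obtain ⟨t, ht, htW⟩ := hW.elim_nhds_subcover (fun x => (V x : Set X))
    (fun x hxW => (V x).isOpen.mem_nhds (hx x hxW))
  refine ⟨t.sup k, fun x hxW => ?_⟩
  obtain ⟨y, hy, hxy⟩ := Set.mem_iUnion₂.1 (htW hxW)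
  exact ⟨V y, hV y (ht y hy), hxy, hp _ _ _ (Finset.le_sup hy) (hk y (ht y hy))⟩

/-- A partition of unity argument: an ideal is the unit ideal if, locally on the affine open `U`,
it contains a power of an invertible function. -/
lemma ideal_eq_top_of_locally {U : X.Opens} (hU : IsAffineOpen U) (J : Ideal Γ(X, U))
    (h : ∀ x ∈ U, ∃ g : Γ(X, U), x ∈ X.basicOpen g ∧ ∃ k : ℕ, g ^ k ∈ J) : J = ⊤ := by
  -- The radical contains each `g` itself, and functions generate the unit ideal of an affine open
  -- exactly when their basic opens cover it.
  rw [← Ideal.radical_eq_top, ← Ideal.span_eq J.radical, ← hU.self_le_iSup_basicOpen_iff]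
  intro x hx
  obtain ⟨g, hxg, k, hk⟩ := h x hx
  exact Opens.mem_iSup.2 ⟨⟨g, k, hk⟩, hxg⟩

lemma exists_affine_le {W : X.Opens} {x : X} (hx : x ∈ W) :
    ∃ V : X.Opens, IsAffineOpen V ∧ x ∈ V ∧ V ≤ W := by
  obtain ⟨_, ⟨V, hV, rfl⟩, hxV, hVW⟩ := X.isBasis_affineOpens.exists_subset_of_mem_open hx W.isOpen
  exact ⟨V, hV, hxV, hVW⟩

end Compactness

/-! ### Families of submodules -/

/-- A family of submodules of the modules of sections, stable under restriction. -/
structure SubPresheaf (M : X.Modules) where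
  carrier (U : X.Opens) : Submodule Γ(X, U) Γ(M, U)
  res_mem {U V : X.Opens} (h : V ≤ U) {m : Γ(M, U)} (hm : m ∈ carrier U) :
    resM M h m ∈ carrier V

namespace SubPresheaf

variable {M : X.Modules} (N : SubPresheaf M)

/-- Membership is a local condition. -/
def IsLocal : Prop := ∀ (U : X.Opens) (m : Γ(M, U)),
  (∀ x ∈ U, ∃ (V : X.Opens) (h : V ≤ U), x ∈ V ∧ resM M h m ∈ N.carrier V) → m ∈ N.carrier U

/-- Over affine opens, sections over a basic open extend after multiplication by a power of the
equation. -/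
def Extends : Prop := ∀ {U : X.Opens} (_ : IsAffineOpen U) (g : Γ(X, U))
  (s : Γ(M, X.basicOpen g)), s ∈ N.carrier _ →
    ∃ (k : ℕ) (m : Γ(M, U)), m ∈ N.carrier U ∧
      resM M (X.basicOpen_le g) m = resO (X.basicOpen_le g) g ^ k • s

variable {N}

/-- Some g^k m|_{D(g)} extends to a section n of the family. The difference n - g^k m vanishes on
D(g), so a further power of g kills it. -/
lemma Extends.exists_pow_smul_mem_affine (hM : IsLocalizing M) (hN : N.Extends) {U : X.Opens}
    (hU : IsAffineOpen U) (g : Γ(X, U)) (m : Γ(M, U))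
    (hm : resM M (X.basicOpen_le g) m ∈ N.carrier _) : ∃ k : ℕ, g ^ k • m ∈ N.carrier U := by
  obtain ⟨k, n, hn, hk⟩ := hN hU g _ hm
  obtain ⟨l, hl⟩ := hM.inj hU g (n - g ^ k • m) (by
    rw [map_sub, hk, resM_smul, map_pow, sub_self])
  refine ⟨l + k, ?_⟩
  rw [smul_sub, smul_smul, ← pow_add, sub_eq_zero] at hl
  rw [← hl]
  exact Submodule.smul_mem _ _ hn

/-- The version needed for j⁻¹(U), which is quasi-compact but perhaps not affine: apply the affine
case on affine opens covering `W`, bound the exponents, and conclude by locality of membership. -/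
lemma Extends.exists_pow_smul_mem (hM : IsLocalizing M) (hN : N.Extends) (hl : N.IsLocal)
    {W : X.Opens} (hW : IsCompact (W : Set X)) (g : Γ(X, W)) (m : Γ(M, W))
    (hm : resM M (X.basicOpen_le g) m ∈ N.carrier _) : ∃ k : ℕ, g ^ k • m ∈ N.carrier W := by
  obtain ⟨k, hk⟩ := exists_exponent hW
    (fun k V => ∃ h : V ≤ W, resM M h (g ^ k • m) ∈ N.carrier V)
    (by
      rintro k l V hkl ⟨h, hV⟩
      refine ⟨h, ?_⟩
      rw [← Nat.sub_add_cancel hkl, pow_add, mul_smul, resM_smul]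
      exact Submodule.smul_mem _ _ hV)
    (by
      intro x hx
      obtain ⟨V, hV, hxV, hVW⟩ := exists_affine_le hx
      obtain ⟨k, hk⟩ := hN.exists_pow_smul_mem_affine hM hV (resO hVW g) (resM M hVW m) (by
        have := N.res_mem (basicOpen_resO_le hVW g) hm
        rw [resM_resM] at this ⊢
        exact this)
      refine ⟨V, hVW, hxV, k, hVW, ?_⟩
      rw [resM_smul, map_pow]
      exact hk)
  refine ⟨k, hl _ _ fun x hx => ?_⟩
  obtain ⟨V, -, hxV, h, hV⟩ := hk x hx
  exact ⟨V, h, hxV, hV⟩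

end SubPresheaf

/-! ### Sheafification -/

section Sheafify

variable (P : X.PresheafOfModules)

/-- Sections of a presheaf of modules. -/
abbrev PSec (U : X.Opens) : Type u := P.obj (op U)

instance (U : X.Opens) : Module Γ(X, U) (PSec P U) := (P.obj (op U)).isModule

/-- Restriction of sections of a presheaf of modules. -/
def resP {U V : X.Opens} (h : V ≤ U) : PSec P U →+ PSec P V :=
  ((P.map (homOfLE h).op).hom).toAddMonoidHom

lemma resP_resP {U V W : X.Opens} (h : V ≤ U) (h' : W ≤ V) (m : PSec P U) :
    resP P h' (resP P h m) = resP P (h'.trans h) m :=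
  (CategoryTheory.congr_fun (P.presheaf.map_comp (homOfLE h).op (homOfLE h').op) m).symm

/-- The sheaf associated to a presheaf of modules. -/
def sheafify : X.Modules := (PresheafOfModules.sheafification (𝟙 X.ringCatSheaf.obj)).obj P

/-- The canonical morphism to the associated sheaf. -/
def sheafifyUnit : P ⟶ (sheafify P).val :=
  (PresheafOfModules.sheafificationAdjunction (𝟙 X.ringCatSheaf.obj)).unit.app P

/-- The canonical map on sections. -/
def toSh (U : X.Opens) : PSec P U →ₗ[Γ(X, U)] Γ(sheafify P, U) :=
  ((sheafifyUnit P).app (op U)).hom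

lemma toSh_res {U V : X.Opens} (h : V ≤ U) (t : PSec P U) :
    toSh P V (resP P h t) = resM (sheafify P) h (toSh P U t) :=
  PresheafOfModules.naturality_apply (sheafifyUnit P) (homOfLE h).op t

lemma toSh_locInj {U : X.Opens} (s t : PSec P U) (h : toSh P U s = toSh P U t) :
    ∀ x ∈ U, ∃ (V : X.Opens) (hV : V ≤ U), x ∈ V ∧ resP P hV s = resP P hV t := by
  intro x hx
  have := Presheaf.equalizerSieve_mem (J := Opens.grothendieckTopology X)
    (φ := CategoryTheory.toSheafify (Opens.grothendieckTopology X) P.presheaf)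
    (X := op U) s t h
  obtain ⟨V, i, hi, hxV⟩ := this x hx
  exact ⟨V, i.le, hxV, hi⟩

lemma toSh_locSurj {U : X.Opens} (t : Γ(sheafify P, U)) :
    ∀ x ∈ U, ∃ (V : X.Opens) (hV : V ≤ U), x ∈ V ∧
      ∃ s : PSec P V, toSh P V s = resM _ hV t := by
  intro x hx
  have := Presheaf.imageSieve_mem (J := Opens.grothendieckTopology X)
    (CategoryTheory.toSheafify (Opens.grothendieckTopology X) P.presheaf)
    (U := op U) t
  obtain ⟨V, i, ⟨s, hs⟩, hxV⟩ := this x hx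
  exact ⟨V, i.le, hxV, s, hs⟩

/-- Over affine opens, sections over a basic open are obtained by localization. -/
structure PreIsLocalizing : Prop where
  inj {U : X.Opens} (hU : IsAffineOpen U) (g : Γ(X, U)) (m : PSec P U)
    (h : resP P (X.basicOpen_le g) m = 0) : ∃ k : ℕ, g ^ k • m = 0
  surj {U : X.Opens} (hU : IsAffineOpen U) (g : Γ(X, U)) (s : PSec P (X.basicOpen g)) :
    ∃ (k : ℕ) (m : PSec P U), resP P (X.basicOpen_le g) m = resO (X.basicOpen_le g) g ^ k • s

variable {P}

/-- The annihilator of a section that dies in the sheaf contains powers of functions whose basic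
opens cover `U`, so it is the unit ideal. -/
lemma PreIsLocalizing.toSh_injective (hP : PreIsLocalizing P) {U : X.Opens} (hU : IsAffineOpen U) :
    Function.Injective (toSh P U) := by
  rw [injective_iff_map_eq_zero]
  intro t ht
  have : LinearMap.ker (LinearMap.toSpanSingleton Γ(X, U) (PSec P U) t) = ⊤ := by
    refine ideal_eq_top_of_locally hU _ fun x hx => ?_
    obtain ⟨V, hV, hxV, h⟩ := toSh_locInj P t 0 (by rw [ht, map_zero]) x hx
    obtain ⟨g, hg, hxg⟩ := hU.exists_basicOpen_le ⟨x, hxV⟩ hx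
    refine ⟨g, hxg, ?_⟩
    obtain ⟨k, hk⟩ := hP.inj hU g t (by rw [← resP_resP P hV hg, h, map_zero, map_zero])
    exact ⟨k, hk⟩
  have h1 : (1 : Γ(X, U)) ∈ LinearMap.ker (LinearMap.toSpanSingleton Γ(X, U) (PSec P U) t) := by
    rw [this]; trivial
  simpa using h1

/-- A section of the sheaf comes from the presheaf only locally. On a small affine open,
`toSh_injective` turns its vanishing over the basic open into vanishing in the presheaf; the
resulting exponents are bounded by quasi-compactness. -/
lemma PreIsLocalizing.sheafify_inj (hP : PreIsLocalizing P) {U : X.Opens} (hU : IsAffineOpen U)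
    (g : Γ(X, U)) (m : Γ(sheafify P, U)) (h : resM _ (X.basicOpen_le g) m = 0) :
    ∃ k : ℕ, g ^ k • m = 0 := by
  obtain ⟨k, hk⟩ := exists_exponent hU.isCompact
    (fun k V => ∃ h : V ≤ U, resM _ h (g ^ k • m) = 0)
    (by
      rintro k l V hkl ⟨h, hV⟩
      refine ⟨h, ?_⟩
      rw [← Nat.sub_add_cancel hkl, pow_add, mul_smul, resM_smul, hV, smul_zero])
    (by
      intro x hx
      obtain ⟨V, hV, hxV, t, ht⟩ := toSh_locSurj P m x hx
      obtain ⟨W, hW, hxW, hWV⟩ := exists_affine_le hxV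
      have hWU := hWV.trans hV
      obtain ⟨k, hk⟩ := hP.inj hW (resO hWU g) (resP P hWV t) (by
        refine hP.toSh_injective (hW.basicOpen _) ?_
        rw [map_zero, toSh_res, toSh_res, ht, resM_resM, resM_resM,
          ← resM_resM _ (X.basicOpen_le g) (basicOpen_resO_le hWU g), h, map_zero])
      refine ⟨W, hWU, hxW, k, hWU, ?_⟩
      rw [resM_smul, map_pow, ← resM_resM _ hV hWV, ← ht, ← toSh_res, ← map_smul, hk, map_zero])
  refine ⟨k, eqM_of_locally _ _ _ fun x hx => ?_⟩
  obtain ⟨V, -, hxV, h, hV⟩ := hk x hx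
  exact ⟨V, h, hxV, by rw [hV, map_zero]⟩

/-- The functions a such that a • s lifts to the presheaf form an ideal. Near a point, s lifts over
some D(g); extending the lift costs a power of g, and correcting the extension by `sheafify_inj`
costs another. Hence the ideal is the unit ideal. -/
lemma PreIsLocalizing.toSh_surjective (hP : PreIsLocalizing P) {U : X.Opens}
    (hU : IsAffineOpen U) : Function.Surjective (toSh P U) := by
  intro s
  have : (LinearMap.range (toSh P U)).comap (LinearMap.toSpanSingleton Γ(X, U) _ s) = ⊤ := by
    refine ideal_eq_top_of_locally hU _ fun x hx => ?_
    obtain ⟨V, hV, hxV, t, ht⟩ := toSh_locSurj P s x hx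
    obtain ⟨g, hg, hxg⟩ := hU.exists_basicOpen_le ⟨x, hxV⟩ hx
    obtain ⟨k, t', ht'⟩ := hP.surj hU g (resP P hg t)
    obtain ⟨l, hl⟩ := hP.sheafify_inj hU g (toSh P U t' - g ^ k • s) (by
      rw [map_sub, ← toSh_res, ht', map_smul, toSh_res, ht, resM_resM, resM_smul, map_pow,
        sub_self])
    refine ⟨g, hxg, l + k, g ^ l • t', ?_⟩
    rw [smul_sub, sub_eq_zero, smul_smul, ← pow_add] at hl
    rw [map_smul, hl]
    rfl
  have h1 : (1 : Γ(X, U)) ∈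
      (LinearMap.range (toSh P U)).comap (LinearMap.toSpanSingleton Γ(X, U) _ s) := by
    rw [this]; trivial
  simpa using h1

theorem PreIsLocalizing.isLocalizing (hP : PreIsLocalizing P) : IsLocalizing (sheafify P) where
  inj hU g m h := hP.sheafify_inj hU g m h
  surj hU g s := by
    obtain ⟨t, rfl⟩ := hP.toSh_surjective (hU.basicOpen g) s
    obtain ⟨k, t', ht'⟩ := hP.surj hU g t
    exact ⟨k, toSh P _ t', by rw [← toSh_res, ht', map_smul]⟩

theorem PreIsLocalizing.isCoherent (hP : PreIsLocalizing P)
    (h : ∀ U : X.Opens, IsAffineOpen U → Module.Finite Γ(X, U) (PSec P U)) :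
    IsCoherent (sheafify P) where
  isQuasicoherent := hP.isLocalizing.isQuasicoherent
  finite U hU := by
    have := h U hU
    exact Module.Finite.of_surjective _ (hP.toSh_surjective hU)

end Sheafify

/-! ### Morphisms and gluing -/

/-- A morphism of sheaves of modules from linear maps on sections. -/
def modHom {M N : X.Modules} (φ : ∀ U : X.Opens, Γ(M, U) →ₗ[Γ(X, U)] Γ(N, U))
    (h : ∀ (U V : X.Opens) (hV : V ≤ U) (m : Γ(M, U)),
      φ V (resM M hV m) = resM N hV (φ U m)) : M ⟶ N :=
  SheafOfModules.Hom.mk (R := X.ringCatSheaf)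
    { app := fun U => ModuleCat.ofHom (φ U.unop)
      naturality := fun {U V} i => by
        ext m
        exact h U.unop V.unop i.unop.le m }

lemma modHom_ext {M N : X.Modules} {φ ψ : M ⟶ N}
    (h : ∀ (U : X.Opens) (m : Γ(M, U)), φ.app U m = ψ.app U m) : φ = ψ :=
  Scheme.Modules.hom_ext _ _ fun U => by
    ext m
    exact h U m

/-- Gluing for sections characterized by a property rather than indexed by a cover: `huniq`, applied
to restrictions, is the agreement on overlaps. The glued section restricts to every section
satisfying `R`, not only to those chosen on the cover. -/
lemma exists_glue (A : X.Modules) (U : X.Opens) (R : ∀ V : X.Opens, Γ(A, V) → Prop)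
    (hres : ∀ (V W : X.Opens) (h : W ≤ V), V ≤ U → ∀ a, R V a → R W (resM A h a))
    (huniq : ∀ V : X.Opens, V ≤ U → ∀ a a', R V a → R V a' → a = a')
    (hex : ∀ x ∈ U, ∃ V : X.Opens, V ≤ U ∧ x ∈ V ∧ ∃ a, R V a) :
    ∃ a : Γ(A, U), ∀ (V : X.Opens) (h : V ≤ U) (a' : Γ(A, V)), R V a' → resM A h a = a' := by
  choose! V hV hx a ha using hex
  obtain ⟨s, hs, -⟩ := TopCat.Sheaf.existsUnique_gluing' ⟨_, A.isSheaf⟩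
    (fun x : U => V x.1) U (fun x => homOfLE (hV x.1 x.2))
    (fun x hxU => Opens.mem_iSup.2 ⟨⟨x, hxU⟩, hx x hxU⟩)
    (fun x => a x.1)
    (fun x y => huniq _ (inf_le_left.trans (hV x.1 x.2)) _ _
      (hres _ _ inf_le_left (hV x.1 x.2) _ (ha x.1 x.2))
      (hres _ _ inf_le_right (hV y.1 y.2) _ (ha y.1 y.2)))
  refine ⟨s, fun W hW b hb => eqM_of_locally _ _ _ fun x hxW => ?_⟩
  refine ⟨V x ⊓ W, inf_le_right, ⟨hx x (hW hxW), hxW⟩, ?_⟩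
  have h1 : resM A (hV x (hW hxW)) s = a x := hs ⟨x, hW hxW⟩
  rw [resM_resM, ← resM_resM A (hV x (hW hxW)) inf_le_left, h1]
  exact huniq _ (inf_le_right.trans hW) _ _ (hres _ _ _ (hV x (hW hxW)) _ (ha x (hW hxW)))
    (hres _ _ _ hW _ hb)

variable {f : X ⟶ S} {I : X.IdealSheafData}

/-- A correspondence between modules with connection which is, locally, the graph of a
function. -/
structure Corr (B C : LogConn f I) where
  rel (U : X.Opens) : Submodule Γ(X, U) (Γ(B.mod, U) × Γ(C.mod, U))
  res {U V : X.Opens} (h : V ≤ U) {b : Γ(B.mod, U)} {c : Γ(C.mod, U)} (hbc : (b, c) ∈ rel U) :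
    (resM B.mod h b, resM C.mod h c) ∈ rel V
  nabla {U : X.Opens} (D : LogDer f I U) {b : Γ(B.mod, U)} {c : Γ(C.mod, U)}
    (hbc : (b, c) ∈ rel U) : (B.nabla.app D b, C.nabla.app D c) ∈ rel U
  unique {U : X.Opens} {c : Γ(C.mod, U)} (h : (0, c) ∈ rel U) : c = 0
  total {U : X.Opens} (b : Γ(B.mod, U)) : ∀ x ∈ U, ∃ (V : X.Opens) (h : V ≤ U), x ∈ V ∧
    ∃ c, (resM B.mod h b, c) ∈ rel V

namespace Corr

variable {B C : LogConn f I} (R : Corr B C)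

lemma eq_of_rel {U : X.Opens} {b : Γ(B.mod, U)} {c c' : Γ(C.mod, U)} (h : (b, c) ∈ R.rel U)
    (h' : (b, c') ∈ R.rel U) : c = c' := by
  have := (R.rel U).sub_mem h h'
  rw [Prod.mk_sub_mk, sub_self] at this
  exact sub_eq_zero.1 (R.unique this)

lemma exists_fun {U : X.Opens} (b : Γ(B.mod, U)) : ∃ c : Γ(C.mod, U), ∀ (V : X.Opens) (h : V ≤ U)
    (c' : Γ(C.mod, V)), (resM B.mod h b, c') ∈ R.rel V → resM C.mod h c = c' := by
  obtain ⟨c, hc⟩ := exists_glue C.mod U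
    (fun V c => ∃ h : V ≤ U, (resM B.mod h b, c) ∈ R.rel V)
    (by
      rintro V W h hV a ⟨h', ha⟩
      refine ⟨h.trans hV, ?_⟩
      have := R.res h ha
      rwa [resM_resM] at this)
    (by
      rintro V hV a a' ⟨_, h⟩ ⟨_, h'⟩
      exact R.eq_of_rel h h')
    (by
      intro x hx
      obtain ⟨V, h, hxV, c, hc⟩ := R.total b x hx
      exact ⟨V, h, hxV, c, h, hc⟩)
  exact ⟨c, fun V h c' hc' => hc V h c' ⟨h, hc'⟩⟩

/-- The function underlying a correspondence. -/
def toFun {U : X.Opens} (b : Γ(B.mod, U)) : Γ(C.mod, U) := (R.exists_fun b).choose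

lemma resM_toFun {U V : X.Opens} (h : V ≤ U) {b : Γ(B.mod, U)} {c : Γ(C.mod, V)}
    (hc : (resM B.mod h b, c) ∈ R.rel V) : resM C.mod h (R.toFun b) = c :=
  (R.exists_fun b).choose_spec V h c hc

lemma toFun_eq {U : X.Opens} {b : Γ(B.mod, U)} {c : Γ(C.mod, U)} (hc : (b, c) ∈ R.rel U) :
    R.toFun b = c := by
  rw [← R.resM_toFun le_rfl (b := b) (c := c) (by rwa [resM_self]), resM_self]

/-- Two arguments are allowed, since additivity compares the values at two sections on a common
open; linearity in one section takes `b = b'`. -/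
lemma ext_local {U : X.Opens} (b b' : Γ(B.mod, U)) {A A' : Γ(C.mod, U)}
    (H : ∀ (V : X.Opens) (h : V ≤ U) (c c' : Γ(C.mod, V)), (resM B.mod h b, c) ∈ R.rel V →
      (resM B.mod h b', c') ∈ R.rel V → resM C.mod h A = resM C.mod h A') : A = A' := by
  refine eqM_of_locally _ _ _ fun x hx => ?_
  obtain ⟨V, hV, hxV, c, hc⟩ := R.total b x hx
  obtain ⟨W, hW, hxW, c', hc'⟩ := R.total b' x hx
  refine ⟨V ⊓ W, inf_le_left.trans hV, ⟨hxV, hxW⟩, ?_⟩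
  have h1 := R.res (inf_le_left : V ⊓ W ≤ V) hc
  have h2 := R.res (inf_le_right : V ⊓ W ≤ W) hc'
  rw [resM_resM] at h1 h2
  exact H _ _ _ _ h1 h2

/-- The linear map underlying a correspondence. -/
def toLinearMap (U : X.Opens) : Γ(B.mod, U) →ₗ[Γ(X, U)] Γ(C.mod, U) where
  toFun := R.toFun
  map_add' b b' := by
    refine R.ext_local b b' fun V h c c' hc hc' => ?_
    rw [map_add, R.resM_toFun h hc, R.resM_toFun h hc', R.resM_toFun h (c := c + c')]
    rw [map_add]
    exact (R.rel V).add_mem hc hc'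
  map_smul' a b := by
    refine R.ext_local b b fun V h c _ hc _ => ?_
    rw [RingHom.id_apply, resM_smul, R.resM_toFun h hc, R.resM_toFun h (c := resO h a • c)]
    rw [resM_smul]
    exact (R.rel V).smul_mem _ hc

lemma toFun_res {U V : X.Opens} (h : V ≤ U) (b : Γ(B.mod, U)) :
    R.toFun (resM B.mod h b) = resM C.mod h (R.toFun b) := by
  refine R.ext_local (resM B.mod h b) (resM B.mod h b) fun W hW c _ hc _ => ?_
  rw [R.resM_toFun hW hc, resM_resM, R.resM_toFun _ (c := c)]
  rwa [resM_resM] at hc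

/-- The horizontal morphism underlying a correspondence. -/
def hom : B ⟶ C where
  hom := modHom R.toLinearMap fun U V h m => R.toFun_res h m
  horizontal {U} D m := by
    change R.toFun _ = C.nabla.app D (R.toFun m)
    refine R.ext_local m m fun W hW c _ hc _ => ?_
    rw [C.nabla.res, R.resM_toFun hW hc, R.resM_toFun hW (c := C.nabla.app (D.restrict hW) c)]
    rw [B.nabla.res]
    exact R.nabla _ hc

/-- Mutually inverse correspondences give an isomorphism. -/
def iso (R' : Corr C B) (h : ∀ (U : X.Opens) (b : Γ(B.mod, U)) (c : Γ(C.mod, U)),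
    (b, c) ∈ R.rel U ↔ (c, b) ∈ R'.rel U) : B ≅ C where
  hom := R.hom
  inv := R'.hom
  hom_inv_id := LogConn.Hom.ext (modHom_ext fun U b => by
    change R'.toFun (R.toFun b) = b
    refine eqM_of_locally B.mod _ _ fun x hx => ?_
    obtain ⟨V, hV, hxV, c, hc⟩ := R.total b x hx
    refine ⟨V, hV, hxV, ?_⟩
    rw [← R'.toFun_res, R.resM_toFun hV hc, R'.toFun_eq ((h _ _ _).1 hc)])
  inv_hom_id := LogConn.Hom.ext (modHom_ext fun U c => by
    change R.toFun (R'.toFun c) = c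
    refine eqM_of_locally C.mod _ _ fun x hx => ?_
    obtain ⟨V, hV, hxV, b, hb⟩ := R'.total c x hx
    refine ⟨V, hV, hxV, ?_⟩
    rw [← R.toFun_res, R'.resM_toFun hV hb, R.toFun_eq ((h _ _ _).2 hb)])

end Corr

/-! ### Subconnections -/

section Sub

variable {M : X.Modules} (N : SubPresheaf M)

/-- The presheaf underlying a family of submodules. -/
def SubPresheaf.presheaf : TopCat.Presheaf Ab.{u} X where
  obj U := AddCommGrpCat.of (N.carrier U.unop)
  map {U V} i := AddCommGrpCat.ofHom
    { toFun := fun m => ⟨resM M i.unop.le m.1, N.res_mem _ m.2⟩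
      map_zero' := Subtype.ext (map_zero (resM M i.unop.le))
      map_add' := fun _ _ => Subtype.ext (map_add (resM M i.unop.le) _ _) }
  map_id U := AddCommGrpCat.hom_ext (AddMonoidHom.ext fun m =>
    Subtype.ext (resM_self M (U := U.unop) m.1))
  map_comp i j := AddCommGrpCat.hom_ext (AddMonoidHom.ext fun m =>
    Subtype.ext (resM_resM M i.unop.le j.unop.le m.1).symm)

variable {N}

/-- Sections glue in the ambient module, and locality puts the result back into the family. -/
lemma SubPresheaf.isSheaf_presheaf (hN : N.IsLocal) : N.presheaf.IsSheaf := by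
  rw [TopCat.Presheaf.isSheaf_iff_isSheafUniqueGluing]
  intro ι U sf hsf
  let T : ∀ i, N.carrier (U i) := sf
  obtain ⟨m, hm, hmu⟩ := TopCat.Sheaf.existsUnique_gluing' ⟨_, M.isSheaf⟩ U (iSup U)
    (fun i => homOfLE (le_iSup U i)) le_rfl (fun i => (T i).1)
    (fun i j => congrArg Subtype.val (hsf i j))
  have hm' : ∀ i, resM M (le_iSup U i) m = (T i).1 := hm
  refine ⟨⟨m, hN _ _ fun x hx => ?_⟩, fun i => Subtype.ext (hm i), fun y hy => Subtype.ext
    (hmu _ fun i => congrArg Subtype.val (hy i))⟩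
  obtain ⟨i, hi⟩ := Opens.mem_iSup.1 hx
  exact ⟨U i, le_iSup U i, hi, by rw [hm']; exact (T i).2⟩

instance (U : X.Opensᵒᵖ) : Module (X.ringCatSheaf.obj.obj U) (N.presheaf.obj U) :=
  inferInstanceAs (Module Γ(X, U.unop) (N.carrier U.unop))

/-- The sheaf of modules underlying a local family of submodules. -/
def SubPresheaf.toModules (hN : N.IsLocal) : X.Modules :=
  { val := PresheafOfModules.ofPresheaf (R := X.ringCatSheaf.obj) N.presheaf (by
      intro U V i a m
      exact Subtype.ext (resM_smul M i.unop.le a _))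
    isSheaf := N.isSheaf_presheaf hN }

/-- Of the two halves of the localization property, injectivity is inherited from `M` and
surjectivity is `Extends`. Finiteness holds because the sections over an affine open form a
noetherian module. -/
lemma SubPresheaf.toModules_isCoherent [IsLocallyNoetherian X] (hN : N.IsLocal)
    (hM : IsCoherent M) (hE : N.Extends) : IsCoherent (N.toModules hN) where
  isQuasicoherent := by
    have := hM.isQuasicoherent
    have hM' := IsLocalizing.of_isQuasicoherent M
    refine IsLocalizing.isQuasicoherent ⟨fun {U} hU g m h => ?_, fun {U} hU g s => ?_⟩
    · obtain ⟨k, hk⟩ := hM'.inj hU g (show N.carrier U from m).1 (congrArg Subtype.val h)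
      exact ⟨k, Subtype.ext hk⟩
    · obtain ⟨k, m, hm, hk⟩ := hE hU g (show N.carrier _ from s).1 (show N.carrier _ from s).2
      exact ⟨k, (⟨m, hm⟩ : N.carrier U), Subtype.ext hk⟩
  finite U hU := by
    have := hM.finite U hU
    have : IsNoetherianRing Γ(X, U) := IsLocallyNoetherian.component_noetherian ⟨U, hU⟩
    exact inferInstanceAs (Module.Finite Γ(X, U) (N.carrier U))

end Sub

/-- A family of submodules is horizontal if it is stable under the connection. -/
def SubPresheaf.IsHorizontal {E : LogConn f I} (N : SubPresheaf E.mod) : Prop :=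
  ∀ (U : X.Opens) (D : LogDer f I U) (m : Γ(E.mod, U)), m ∈ N.carrier U →
    E.nabla.app D m ∈ N.carrier U

/-- The connection on a horizontal submodule. -/
def LogConn.sub (E : LogConn f I) (N : SubPresheaf E.mod) (hN : N.IsLocal) (hh : N.IsHorizontal) :
    LogConn f I where
  mod := N.toModules hN
  nabla :=
    { app := fun {U} D =>
        ({ toFun := fun m => ⟨E.nabla.app D m.1, hh U D m.1 m.2⟩
           map_zero' := Subtype.ext (map_zero (E.nabla.app D))
           map_add' := fun _ _ => Subtype.ext (map_add (E.nabla.app D) _ _) } :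
           N.carrier U →+ N.carrier U)
      leibniz := fun D a _ => Subtype.ext (E.nabla.leibniz D a _)
      add_der := fun D D' _ => Subtype.ext (E.nabla.add_der D D' _)
      smul_der := fun a D _ => Subtype.ext (E.nabla.smul_der a D _)
      bracket := fun D D' _ => Subtype.ext (E.nabla.bracket D D' _)
      res := fun h D _ => Subtype.ext (E.nabla.res h D _) }

/-- The inclusion of a horizontal submodule. -/
def LogConn.subι (E : LogConn f I) (N : SubPresheaf E.mod) (hN : N.IsLocal)
    (hh : N.IsHorizontal) : E.sub N hN hh ⟶ E where
  hom := modHom (M := N.toModules hN) (fun U => (N.carrier U).subtype) fun _ _ _ _ => rfl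
  horizontal _ _ := rfl

/-! ### Quotients -/

section Quotient

variable {M : X.Modules}

/-- Restriction of sections as a semilinear map. -/
def resMₛₗ (M : X.Modules) {U V : X.Opens} (h : V ≤ U) : Γ(M, U) →ₛₗ[resO h] Γ(M, V) where
  toFun := resM M h
  map_add' := map_add _
  map_smul' := resM_smul M h

/-- Restriction of sections of the presheaf quotient. -/
def SubPresheaf.resQuot (N : SubPresheaf M) {U V : X.Opens} (h : V ≤ U) :
    (Γ(M, U) ⧸ N.carrier U) →ₛₗ[resO h] (Γ(M, V) ⧸ N.carrier V) :=
  Submodule.mapQ _ _ (resMₛₗ M h) fun _ hm => N.res_mem h hm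

/-- The presheaf of groups underlying the presheaf quotient. -/
def SubPresheaf.quotPresheaf (N : SubPresheaf M) : TopCat.Presheaf Ab.{u} X where
  obj U := AddCommGrpCat.of (Γ(M, U.unop) ⧸ N.carrier U.unop)
  map i := AddCommGrpCat.ofHom (N.resQuot i.unop.le).toAddMonoidHom
  map_id U := AddCommGrpCat.hom_ext (AddMonoidHom.ext fun m => by
    obtain ⟨m, rfl⟩ := (N.carrier U.unop).mkQ_surjective m
    exact congrArg (N.carrier U.unop).mkQ (resM_self M (U := U.unop) m))
  map_comp {U V W} i j := AddCommGrpCat.hom_ext (AddMonoidHom.ext fun m => by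
    obtain ⟨m, rfl⟩ := (N.carrier U.unop).mkQ_surjective m
    exact congrArg (N.carrier W.unop).mkQ (resM_resM M i.unop.le j.unop.le m).symm)

instance (N : SubPresheaf M) (U : X.Opensᵒᵖ) :
    Module (X.ringCatSheaf.obj.obj U) (N.quotPresheaf.obj U) :=
  inferInstanceAs (Module Γ(X, U.unop) (Γ(M, U.unop) ⧸ N.carrier U.unop))

/-- The presheaf quotient of a module by a family of submodules. -/
def SubPresheaf.preQuot (N : SubPresheaf M) : X.PresheafOfModules :=
  PresheafOfModules.ofPresheaf (R := X.ringCatSheaf.obj) N.quotPresheaf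
    fun _ _ i a m => (N.resQuot i.unop.le).map_smulₛₗ a m

/-- The quotient of a module by a family of submodules. -/
def SubPresheaf.quot (N : SubPresheaf M) : X.Modules := sheafify N.preQuot

/-- The canonical map from sections to sections of the quotient. -/
def SubPresheaf.quotπ (N : SubPresheaf M) (U : X.Opens) :
    Γ(M, U) →ₗ[Γ(X, U)] Γ(N.quot, U) :=
  (show (Γ(M, U) ⧸ N.carrier U) →ₗ[Γ(X, U)] Γ(N.quot, U) from toSh N.preQuot U) ∘ₗ
    (N.carrier U).mkQ

variable {N : SubPresheaf M}

lemma SubPresheaf.quotπ_res {U V : X.Opens} (h : V ≤ U) (m : Γ(M, U)) :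
    N.quotπ V (resM M h m) = resM N.quot h (N.quotπ U m) :=
  toSh_res N.preQuot h ((N.carrier U).mkQ m)

lemma SubPresheaf.quotπ_eq_zero {U : X.Opens} {m : Γ(M, U)} (hm : m ∈ N.carrier U) :
    N.quotπ U m = 0 := by
  have : (N.carrier U).mkQ m = 0 := (Submodule.Quotient.mk_eq_zero _).2 hm
  change toSh N.preQuot U ((N.carrier U).mkQ m) = 0
  rw [this]
  exact map_zero (toSh N.preQuot U)

/-- Sheafification identifies presheaf sections only when they agree locally, so without locality of
`N` nothing more can be concluded. -/
lemma SubPresheaf.locally_mem_of_quotπ_eq_zero {U : X.Opens} {m : Γ(M, U)}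
    (hm : N.quotπ U m = 0) :
    ∀ x ∈ U, ∃ (V : X.Opens) (h : V ≤ U), x ∈ V ∧ resM M h m ∈ N.carrier V := by
  intro x hx
  obtain ⟨V, hV, hxV, h⟩ := toSh_locInj N.preQuot ((N.carrier U).mkQ m) 0
    (hm.trans (map_zero (toSh N.preQuot U)).symm) x hx
  refine ⟨V, hV, hxV, ?_⟩
  rw [map_zero] at h
  exact (Submodule.Quotient.mk_eq_zero _).1 h

lemma SubPresheaf.mem_of_quotπ_eq_zero (hN : N.IsLocal) {U : X.Opens} {m : Γ(M, U)}
    (hm : N.quotπ U m = 0) : m ∈ N.carrier U :=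
  hN _ _ (locally_mem_of_quotπ_eq_zero hm)

lemma SubPresheaf.exists_quotπ {U : X.Opens} (c : Γ(N.quot, U)) :
    ∀ x ∈ U, ∃ (V : X.Opens) (h : V ≤ U), x ∈ V ∧ ∃ m, N.quotπ V m = resM N.quot h c := by
  intro x hx
  obtain ⟨V, hV, hxV, t, ht⟩ := toSh_locSurj N.preQuot c x hx
  obtain ⟨m, rfl⟩ := (N.carrier V).mkQ_surjective t
  exact ⟨V, hV, hxV, m, ht⟩

/-- Exactness of localization: injectivity for the quotient is `exists_pow_smul_mem_affine`, and
surjectivity descends from `M`. Locality of the family is not needed, so this applies to the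
presheaf image of a morphism. -/
lemma SubPresheaf.Extends.preIsLocalizing (hM : IsLocalizing M) (hN : N.Extends) :
    PreIsLocalizing N.preQuot where
  inj {U} hU g m h := by
    obtain ⟨m, rfl⟩ := (N.carrier U).mkQ_surjective m
    obtain ⟨k, hk⟩ := hN.exists_pow_smul_mem_affine hM hU g m
      ((Submodule.Quotient.mk_eq_zero _).1 h)
    exact ⟨k, (Submodule.Quotient.mk_eq_zero _).2 hk⟩
  surj {U} hU g s := by
    obtain ⟨s, rfl⟩ := (N.carrier (X.basicOpen g)).mkQ_surjective s
    obtain ⟨k, m, hm⟩ := hM.surj hU g s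
    exact ⟨k, (N.carrier U).mkQ m, congrArg (N.carrier (X.basicOpen g)).mkQ hm⟩

lemma SubPresheaf.quot_isCoherent (hM : IsCoherent M) (hN : N.Extends) : IsCoherent N.quot := by
  have := hM.isQuasicoherent
  refine (hN.preIsLocalizing (IsLocalizing.of_isQuasicoherent M)).isCoherent fun U hU => ?_
  have := hM.finite U hU
  exact inferInstanceAs (Module.Finite Γ(X, U) (Γ(M, U) ⧸ N.carrier U))

end Quotient

section QuotientNabla

variable {f : X ⟶ S} {I : X.IdealSheafData} {E : LogConn f I} {N : SubPresheaf E.mod}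

lemma SubPresheaf.quotπ_ext {M : X.Modules} {N : SubPresheaf M} {U : X.Opens}
    (c c' A B : Γ(N.quot, U))
    (H : ∀ (V : X.Opens) (h : V ≤ U) (m m' : Γ(M, V)), N.quotπ V m = resM _ h c →
      N.quotπ V m' = resM _ h c' → resM _ h A = resM _ h B) : A = B := by
  refine eqM_of_locally _ _ _ fun x hx => ?_
  obtain ⟨V, hV, hxV, m, hm⟩ := exists_quotπ c x hx
  obtain ⟨W, hW, hxW, m', hm'⟩ := exists_quotπ c' x hx
  refine ⟨V ⊓ W, inf_le_left.trans hV, ⟨hxV, hxW⟩, ?_⟩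
  refine H _ _ (resM _ inf_le_left m) (resM _ inf_le_right m') ?_ ?_
  · rw [quotπ_res, hm, resM_resM]
  · rw [quotπ_res, hm', resM_resM]

/-- The difference of two lifts lies locally in `N`, which is stable under the connection. -/
lemma SubPresheaf.IsHorizontal.quotπ_nabla_eq (hN : N.IsHorizontal) {U : X.Opens}
    (D : LogDer f I U) {m m' : Γ(E.mod, U)} (h : N.quotπ U m = N.quotπ U m') :
    N.quotπ U (E.nabla.app D m) = N.quotπ U (E.nabla.app D m') := by
  rw [← sub_eq_zero, ← map_sub] at h ⊢
  rw [← map_sub]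
  refine eqM_of_locally _ _ _ fun x hx => ?_
  obtain ⟨V, hV, hxV, hm⟩ := locally_mem_of_quotπ_eq_zero h x hx
  refine ⟨V, hV, hxV, ?_⟩
  rw [map_zero, ← quotπ_res, E.nabla.res]
  exact quotπ_eq_zero (hN _ _ _ hm)

/-- Lift locally, differentiate, project, and glue; independence of the lift is the agreement on
overlaps. -/
lemma SubPresheaf.IsHorizontal.exists_nabla (hN : N.IsHorizontal) {U : X.Opens}
    (D : LogDer f I U) (c : Γ(N.quot, U)) :
    ∃ c' : Γ(N.quot, U), ∀ (V : X.Opens) (h : V ≤ U) (m : Γ(E.mod, V)),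
      N.quotπ V m = resM _ h c → resM _ h c' = N.quotπ V (E.nabla.app (D.restrict h) m) := by
  obtain ⟨c', hc'⟩ := exists_glue N.quot U
    (fun V a => ∃ (h : V ≤ U) (m : Γ(E.mod, V)), N.quotπ V m = resM _ h c ∧
      a = N.quotπ V (E.nabla.app (D.restrict h) m))
    (by
      rintro V W h _ _ ⟨hV, m, hm, rfl⟩
      refine ⟨h.trans hV, resM _ h m, ?_, ?_⟩
      · rw [quotπ_res, hm, resM_resM]
      · rw [← quotπ_res, E.nabla.res]
        rfl)
    (by
      rintro V _ _ _ ⟨h, m, hm, rfl⟩ ⟨_, m', hm', rfl⟩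
      exact hN.quotπ_nabla_eq _ (hm.trans hm'.symm))
    (by
      intro x hx
      obtain ⟨V, hV, hxV, m, hm⟩ := exists_quotπ c x hx
      exact ⟨V, hV, hxV, _, hV, m, hm, rfl⟩)
  exact ⟨c', fun V h m hm => hc' V h _ ⟨h, m, hm, rfl⟩⟩

/-- The operator induced by a derivation on the quotient by a horizontal family of submodules. -/
def SubPresheaf.IsHorizontal.quotApp (hN : N.IsHorizontal) {U : X.Opens}
    (D : LogDer f I U) (c : Γ(N.quot, U)) : Γ(N.quot, U) := (hN.exists_nabla D c).choose

lemma SubPresheaf.IsHorizontal.resM_quotApp (hN : N.IsHorizontal) {U V : X.Opens} (h : V ≤ U)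
    (D : LogDer f I U) (c : Γ(N.quot, U)) {m : Γ(E.mod, V)} (hm : N.quotπ V m = resM _ h c) :
    resM _ h (hN.quotApp D c) = N.quotπ V (E.nabla.app (D.restrict h) m) :=
  (hN.exists_nabla D c).choose_spec V h m hm

lemma SubPresheaf.IsHorizontal.quotApp_quotπ (hN : N.IsHorizontal) {U : X.Opens}
    (D : LogDer f I U) (m : Γ(E.mod, U)) :
    hN.quotApp D (N.quotπ U m) = N.quotπ U (E.nabla.app D m) := by
  rw [← resM_self N.quot (hN.quotApp D _), hN.resM_quotApp le_rfl D _ (resM_self _ _).symm]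
  rfl

lemma SubPresheaf.IsHorizontal.quotApp_res (hN : N.IsHorizontal) {U V : X.Opens} (h : V ≤ U)
    (D : LogDer f I U) (c : Γ(N.quot, U)) :
    resM _ h (hN.quotApp D c) = hN.quotApp (D.restrict h) (resM _ h c) := by
  refine quotπ_ext (resM _ h c) (resM _ h c) _ _ fun W hW m _ hm _ => ?_
  rw [hN.resM_quotApp hW _ _ hm, resM_resM]
  rw [resM_resM] at hm
  rw [hN.resM_quotApp _ _ _ hm]
  rfl

lemma LogDer.smul_restrict {U V : X.Opens} (h : V ≤ U) (a : Γ(X, U)) (D : LogDer f I U) :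
    (a • D).restrict h = resO h a • D.restrict h := by
  ext W hW b
  change resO _ a * _ = resO _ (resO _ a) * _
  rw [resO_resO]
  rfl

/-- The connection on the quotient by a horizontal family of submodules. -/
def SubPresheaf.IsHorizontal.quotNabla (hN : N.IsHorizontal) : Nabla f I N.quot where
  app {U} D := AddMonoidHom.mk' (hN.quotApp D) fun c c' => by
    refine quotπ_ext c c' _ _ fun V h m m' hm hm' => ?_
    simp only [hN.quotApp_res, map_add]
    rw [← hm, ← hm', ← map_add (N.quotπ V) m m', hN.quotApp_quotπ, hN.quotApp_quotπ,
      hN.quotApp_quotπ, map_add, map_add]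
  leibniz {U} D a c := by
    refine quotπ_ext c c _ _ fun V h m _ hm _ => ?_
    change resM _ h (hN.quotApp D _) = resM _ h (_ + _ • hN.quotApp D c)
    have h1 : resO h (D.val a) = (D.restrict h).val (resO h a) := D.app_res le_rfl h a
    simp only [hN.quotApp_res, map_add, resM_smul]
    rw [← hm, ← map_smul]
    simp only [hN.quotApp_quotπ]
    rw [E.nabla.leibniz, map_add, map_smul, map_smul, h1]
  add_der {U} D D' c := by
    refine quotπ_ext c c _ _ fun V h m _ hm _ => ?_
    change resM _ h (hN.quotApp _ c) = resM _ h (hN.quotApp D c + hN.quotApp D' c)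
    simp only [hN.quotApp_res, map_add]
    rw [← hm]
    simp only [hN.quotApp_quotπ]
    rw [← map_add, ← E.nabla.add_der]
    rfl
  smul_der {U} a D c := by
    refine quotπ_ext c c _ _ fun V h m _ hm _ => ?_
    change resM _ h (hN.quotApp _ c) = resM _ h (a • hN.quotApp D c)
    simp only [hN.quotApp_res, resM_smul, LogDer.smul_restrict]
    rw [← hm]
    simp only [hN.quotApp_quotπ]
    rw [E.nabla.smul_der, map_smul]
  bracket {U} D D' c := by
    refine quotπ_ext c c _ _ fun V h m _ hm _ => ?_
    change resM _ h (hN.quotApp _ c) = resM _ h (hN.quotApp D (hN.quotApp D' c) -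
      hN.quotApp D' (hN.quotApp D c))
    simp only [hN.quotApp_res, map_sub]
    rw [← hm]
    simp only [hN.quotApp_quotπ]
    rw [← map_sub, ← E.nabla.bracket]
    rfl
  res {U V} h D c := hN.quotApp_res h D c

/-- The quotient of a module with connection by a horizontal family of submodules. -/
def LogConn.quot (E : LogConn f I) (N : SubPresheaf E.mod) (hN : N.IsHorizontal) :
    LogConn f I := ⟨N.quot, hN.quotNabla⟩

/-- The projection onto the quotient. -/
def LogConn.quotProj (E : LogConn f I) (N : SubPresheaf E.mod) (hN : N.IsHorizontal) :
    E ⟶ E.quot N hN where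
  hom := modHom N.quotπ fun _ _ h m => SubPresheaf.quotπ_res h m
  horizontal D m := (hN.quotApp_quotπ D m).symm

end QuotientNabla

/-! ### Kernels, images, monomorphisms, epimorphisms -/

section Sheaves

variable {M N : X.Modules}

lemma hom_app_smul (φ : M ⟶ N) {U : X.Opens} (a : Γ(X, U)) (m : Γ(M, U)) :
    φ.app U (a • m) = a • φ.app U m := φ.app_smul a m

/-- The linear map induced on sections. -/
def appₗ (φ : M ⟶ N) (U : X.Opens) : Γ(M, U) →ₗ[Γ(X, U)] Γ(N, U) where
  toFun := φ.app U
  map_add' := map_add (φ.app U).hom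
  map_smul' := hom_app_smul φ

lemma appₗ_apply (φ : M ⟶ N) (U : X.Opens) (m : Γ(M, U)) : appₗ φ U m = φ.app U m := rfl

/-- The kernel of a morphism. -/
def SubPresheaf.ker (φ : M ⟶ N) : SubPresheaf M where
  carrier U := LinearMap.ker (appₗ φ U)
  res_mem {U V} h m hm := by
    rw [LinearMap.mem_ker, appₗ_apply] at hm ⊢
    rw [← resM_app, hm, map_zero]

lemma SubPresheaf.mem_ker {φ : M ⟶ N} {U : X.Opens} {m : Γ(M, U)} :
    m ∈ (SubPresheaf.ker φ).carrier U ↔ φ.app U m = 0 := Iff.rfl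

/-- The image of a morphism of modules, as a presheaf. -/
def SubPresheaf.im (φ : M ⟶ N) : SubPresheaf N where
  carrier U := LinearMap.range (appₗ φ U)
  res_mem {U V} h m hm := by
    obtain ⟨m, rfl⟩ := hm
    exact ⟨resM M h m, (resM_app φ h m).symm⟩

lemma SubPresheaf.mem_im {φ : M ⟶ N} {U : X.Opens} {n : Γ(N, U)} :
    n ∈ (SubPresheaf.im φ).carrier U ↔ ∃ m, φ.app U m = n := Iff.rfl

lemma SubPresheaf.ker_isLocal (φ : M ⟶ N) : (SubPresheaf.ker φ).IsLocal := by
  intro U m h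
  refine mem_ker.2 (eqM_of_locally _ _ _ fun x hx => ?_)
  obtain ⟨V, hV, hxV, h0⟩ := h x hx
  exact ⟨V, hV, hxV, by rw [resM_app, map_zero]; exact mem_ker.1 h0⟩

/-- Two powers of g are used: the first extends s to a section m of `M` over `U`, the second kills
φ(m), which vanishes on D(g). -/
lemma SubPresheaf.ker_extends (φ : M ⟶ N) (hM : IsLocalizing M) (hN : IsLocalizing N) :
    (SubPresheaf.ker φ).Extends := by
  intro U hU g s hs
  obtain ⟨k, m, hm⟩ := hM.surj hU g s
  obtain ⟨l, hl⟩ := hN.inj hU g (φ.app U m) (by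
    rw [resM_app, hm, hom_app_smul, mem_ker.1 hs, smul_zero])
  refine ⟨l + k, g ^ l • m, mem_ker.2 (by rw [hom_app_smul, hl]), ?_⟩
  rw [resM_smul, hm, smul_smul, map_pow, pow_add]

lemma SubPresheaf.im_extends (φ : M ⟶ N) (hM : IsLocalizing M) : (SubPresheaf.im φ).Extends := by
  rintro U hU g _ ⟨s, rfl⟩
  obtain ⟨k, m, hm⟩ := hM.surj hU g s
  refine ⟨k, φ.app U m, ⟨m, rfl⟩, ?_⟩
  rw [resM_app, hm, hom_app_smul, appₗ_apply]

/-- Injectivity makes local preimages unique, hence gluable; in general the presheaf image is not a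
sheaf. -/
lemma SubPresheaf.im_isLocal (φ : M ⟶ N) (h : ∀ U, Function.Injective (φ.app U)) :
    (SubPresheaf.im φ).IsLocal := by
  intro U n hn
  obtain ⟨m, hm⟩ := exists_glue M U (fun V m => ∃ h : V ≤ U, φ.app V m = resM N h n)
    (by
      rintro V W hW _ m ⟨hV, hm⟩
      exact ⟨hW.trans hV, by rw [← resM_app, hm, resM_resM]⟩)
    (by
      rintro V _ m m' ⟨_, hm⟩ ⟨_, hm'⟩
      exact h V (hm.trans hm'.symm))
    (by
      intro x hx
      obtain ⟨V, hV, hxV, m, hm⟩ := hn x hx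
      exact ⟨V, hV, hxV, m, hV, hm⟩)
  refine ⟨m, eqM_of_locally _ _ _ fun x hx => ?_⟩
  obtain ⟨V, hV, hxV, m', hm'⟩ := hn x hx
  refine ⟨V, hV, hxV, ?_⟩
  rw [appₗ_apply, resM_app, hm V hV m' ⟨hV, hm'⟩]
  exact hm'

end Sheaves

variable {f : X ⟶ S} {I : X.IdealSheafData}

lemma SubPresheaf.ker_isHorizontal {E F : LogConn f I} (φ : E ⟶ F) :
    (SubPresheaf.ker φ.hom).IsHorizontal := by
  intro U D m hm
  rw [mem_ker] at hm ⊢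
  rw [φ.horizontal, hm, map_zero]

lemma SubPresheaf.im_isHorizontal {E F : LogConn f I} (φ : E ⟶ F) :
    (SubPresheaf.im φ.hom).IsHorizontal := by
  rintro U D _ ⟨m, rfl⟩
  exact ⟨E.nabla.app D m, φ.horizontal D m⟩

/-- The zero morphism. -/
def LogConn.zeroHom (E F : LogConn f I) : E ⟶ F where
  hom := 0
  horizontal D _ := (map_zero (F.nabla.app D)).symm

lemma IsCoherent.isLocalizing {M : X.Modules} (hM : IsCoherent M) : IsLocalizing M :=
  have := hM.isQuasicoherent
  IsLocalizing.of_isQuasicoherent M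

/-- The kernel is coherent and horizontal, hence an object of the category. Its inclusion and the
zero morphism agree after composition with φ, so they are equal. -/
lemma CLog.injective_of_mono [IsLocallyNoetherian X] {E F : CLog f I} (φ : E ⟶ F) [Mono φ]
    (U : X.Opens) : Function.Injective (φ.hom.hom.app U) := by
  rw [injective_iff_map_eq_zero]
  intro m hm
  let N := SubPresheaf.ker φ.hom.hom
  have hl : N.IsLocal := SubPresheaf.ker_isLocal _
  have hh : N.IsHorizontal := SubPresheaf.ker_isHorizontal φ.hom
  let K : CLog f I := ⟨E.obj.sub N hl hh, N.toModules_isCoherent hl E.property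
    (SubPresheaf.ker_extends _ E.property.isLocalizing F.property.isLocalizing)⟩
  let ι : K ⟶ E := ObjectProperty.homMk (E.obj.subι N hl hh)
  let z : K ⟶ E := ObjectProperty.homMk (LogConn.zeroHom _ _)
  have h : ι ≫ φ = z ≫ φ := by
    refine ObjectProperty.hom_ext _ (LogConn.Hom.ext (modHom_ext fun V n => ?_))
    exact (show φ.hom.hom.app V (show N.carrier V from n).1 = 0 from
      (show N.carrier V from n).2).trans (map_zero (φ.hom.hom.app V).hom).symm
  have h2 := (cancel_mono φ).1 h
  have h3 : ι.hom.hom.app U (⟨m, hm⟩ : N.carrier U) = z.hom.hom.app U (⟨m, hm⟩ : N.carrier U) := by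
    rw [h2]
  exact h3

/-- The cokernel is an object of the category. The projection onto it and the zero morphism agree
after φ, so the projection vanishes, which says that sections lie locally in the image. -/
lemma CLog.locally_surjective_of_epi {E F : CLog f I} (φ : E ⟶ F) [Epi φ]
    {U : X.Opens} (n : Γ(F.obj.mod, U)) : ∀ x ∈ U, ∃ (V : X.Opens) (h : V ≤ U), x ∈ V ∧
      ∃ m, φ.hom.hom.app V m = resM _ h n := by
  let N := SubPresheaf.im φ.hom.hom
  have hh : N.IsHorizontal := SubPresheaf.im_isHorizontal φ.hom
  let Q : CLog f I := ⟨F.obj.quot N hh, SubPresheaf.quot_isCoherent F.property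
    (SubPresheaf.im_extends _ E.property.isLocalizing)⟩
  let π : F ⟶ Q := ObjectProperty.homMk (F.obj.quotProj N hh)
  let z : F ⟶ Q := ObjectProperty.homMk (LogConn.zeroHom _ _)
  have h : φ ≫ π = φ ≫ z := by
    refine ObjectProperty.hom_ext _ (LogConn.Hom.ext (modHom_ext fun V m => ?_))
    exact SubPresheaf.quotπ_eq_zero (N := N) ⟨m, rfl⟩
  have h2 := (cancel_epi φ).1 h
  have h3 : π.hom.hom.app U n = z.hom.hom.app U n := by rw [h2]
  exact SubPresheaf.locally_mem_of_quotπ_eq_zero (N := N) h3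

/-! ### Isomorphisms from equal images or equal kernels -/

section IsoCriteria

variable {f : X ⟶ S} {I : X.IdealSheafData} {B C G : LogConn f I}

/-- The fibre product of two monomorphisms, as a correspondence. -/
def Corr.ofInjective (φ : B ⟶ G) (ψ : C ⟶ G) (hψ : ∀ U, Function.Injective (ψ.hom.app U))
    (h : ∀ {U : X.Opens} (m : Γ(G.mod, U)), (∃ x, φ.hom.app U x = m) → ∃ y, ψ.hom.app U y = m) :
    Corr B C where
  rel U := LinearMap.eqLocus (appₗ φ.hom U ∘ₗ LinearMap.fst _ _ _)
    (appₗ ψ.hom U ∘ₗ LinearMap.snd _ _ _)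
  res {U V} hV {b c} hbc := by
    change φ.hom.app V (resM _ hV b) = ψ.hom.app V (resM _ hV c)
    rw [← resM_app, ← resM_app]
    exact congrArg (resM G.mod hV) hbc
  nabla {U} D {b c} hbc := by
    change φ.hom.app U (B.nabla.app D b) = ψ.hom.app U (C.nabla.app D c)
    rw [φ.horizontal, ψ.horizontal]
    exact congrArg (G.nabla.app D) hbc
  unique {U} {c} h := hψ U (by
    rw [map_zero]
    exact (show φ.hom.app U 0 = ψ.hom.app U c from h).symm.trans (map_zero _))
  total {U} b x hx := by
    obtain ⟨c, hc⟩ := h _ ⟨b, rfl⟩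
    exact ⟨U, le_rfl, hx, c, by rw [resM_self]; exact hc.symm⟩

/-- Monomorphisms with the same image have isomorphic sources. -/
def Corr.isoOfInjective (φ : B ⟶ G) (ψ : C ⟶ G) (hφ : ∀ U, Function.Injective (φ.hom.app U))
    (hψ : ∀ U, Function.Injective (ψ.hom.app U))
    (h : ∀ {U : X.Opens} (m : Γ(G.mod, U)),
      (∃ x, φ.hom.app U x = m) ↔ ∃ y, ψ.hom.app U y = m) : B ≅ C :=
  Corr.iso (Corr.ofInjective φ ψ hψ fun m => (h m).1) (Corr.ofInjective ψ φ hφ fun m => (h m).2)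
    fun _ _ _ => eq_comm

/-- The correspondence defined by two epimorphisms with the same source. -/
def Corr.ofSurjective (φ : G ⟶ B) (ψ : G ⟶ C)
    (hφ : ∀ (U : X.Opens) (b : Γ(B.mod, U)), ∀ x ∈ U, ∃ (V : X.Opens) (h : V ≤ U), x ∈ V ∧
      ∃ m, φ.hom.app V m = resM _ h b)
    (h : ∀ {U : X.Opens} (m : Γ(G.mod, U)), φ.hom.app U m = 0 → ψ.hom.app U m = 0) :
    Corr B C where
  rel U := LinearMap.range ((appₗ φ.hom U).prod (appₗ ψ.hom U))
  res {U V} hV {b c} hbc := by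
    obtain ⟨m, hm⟩ := hbc
    obtain ⟨rfl, rfl⟩ := Prod.ext_iff.1 hm
    exact ⟨resM _ hV m, Prod.ext (resM_app φ.hom hV m).symm (resM_app ψ.hom hV m).symm⟩
  nabla {U} D {b c} hbc := by
    obtain ⟨m, hm⟩ := hbc
    obtain ⟨rfl, rfl⟩ := Prod.ext_iff.1 hm
    exact ⟨G.nabla.app D m, Prod.ext (φ.horizontal D m) (ψ.horizontal D m)⟩
  unique {U} {c} hc := by
    obtain ⟨m, hm⟩ := hc
    obtain ⟨h0, rfl⟩ := Prod.ext_iff.1 hm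
    exact h m h0
  total {U} b x hx := by
    obtain ⟨V, hV, hxV, m, hm⟩ := hφ U b x hx
    exact ⟨V, hV, hxV, ψ.hom.app V m, m, Prod.ext hm rfl⟩

/-- Epimorphisms with the same kernel have isomorphic targets. -/
def Corr.isoOfSurjective (φ : G ⟶ B) (ψ : G ⟶ C)
    (hφ : ∀ (U : X.Opens) (b : Γ(B.mod, U)), ∀ x ∈ U, ∃ (V : X.Opens) (h : V ≤ U), x ∈ V ∧
      ∃ m, φ.hom.app V m = resM _ h b)
    (hψ : ∀ (U : X.Opens) (b : Γ(C.mod, U)), ∀ x ∈ U, ∃ (V : X.Opens) (h : V ≤ U), x ∈ V ∧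
      ∃ m, ψ.hom.app V m = resM _ h b)
    (h : ∀ {U : X.Opens} (m : Γ(G.mod, U)), φ.hom.app U m = 0 ↔ ψ.hom.app U m = 0) : B ≅ C :=
  Corr.iso (Corr.ofSurjective φ ψ hφ fun m => (h m).1) (Corr.ofSurjective ψ φ hψ fun m => (h m).2)
    fun U b c => by
      constructor <;> rintro ⟨m, hm⟩ <;> obtain ⟨rfl, rfl⟩ := Prod.ext_iff.1 hm <;>
        exact ⟨m, rfl⟩

end IsoCriteria

/-! ### Extension across the boundary -/

section Extension

variable {X' : Scheme.{u}} (j : X' ⟶ X) [IsOpenImmersion j]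

lemma image_preimage_le (U : X.Opens) : j ''ᵁ (j ⁻¹ᵁ U) ≤ U := by
  rintro _ ⟨x, hx, rfl⟩
  exact hx

lemma preimage_le_preimage {U V : X.Opens} (h : V ≤ U) : j ⁻¹ᵁ V ≤ j ⁻¹ᵁ U := fun _ hx => h hx

lemma le_preimage_image (V : X'.Opens) : V ≤ j ⁻¹ᵁ (j ''ᵁ V) := fun x hx => ⟨x, hx, rfl⟩

lemma appIso_inv_app_preimage (U : X.Opens) (a : Γ(X, U)) :
    (j.appIso (j ⁻¹ᵁ U)).inv (j.app U a) = resO (image_preimage_le j U) a :=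
  CategoryTheory.congr_fun (j.app_appIso_inv U) a

/-- The restriction of a logarithmic derivation to an open subscheme. -/
def LogDer.pull {f : X ⟶ S} {I : X.IdealSheafData} {U : X.Opens} (D : LogDer f I U) :
    LogDer (j ≫ f) ⊤ (j ⁻¹ᵁ U) where
  app V hV :=
    let e := (j.appIso V).commRingCatIsoToRingEquiv
    Derivation.mk' (AddMonoidHom.toIntLinearMap (e.toAddMonoidHom.comp
      ((D.app (j ''ᵁ V) ((j.image_mono hV).trans
        (image_preimage_le j U))).toLinearMap.toAddMonoidHom.comp e.symm.toAddMonoidHom)))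
      (by intro a b; simp)
  app_res {V W} hV h a := by
    change resO h ((j.appIso V).hom (D.app _ _ ((j.appIso V).inv a))) =
      (j.appIso W).hom (D.app _ _ ((j.appIso W).inv (resO h a)))
    rw [resO_appIso_inv, ← D.app_res]
    exact (CategoryTheory.congr_fun (j.appIso_hom_naturality (homOfLE h).op) _).symm
  app_base {V} hV T hT s := by
    change (j.appIso V).hom (D.app _ _ ((j.appIso V).inv _)) = 0
    have hT' : j ''ᵁ V ≤ f ⁻¹ᵁ T := by
      rintro _ ⟨x, hx, rfl⟩
      exact hT hx
    have : (j.appIso V).inv ((j ≫ f).appLE T V hT s) = f.appLE T (j ''ᵁ V) hT' s := by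
      rw [← Scheme.Hom.appLE_comp_appLE j f T (j ''ᵁ V) V hT' (le_preimage_image j V),
        CommRingCat.comp_apply, ← Scheme.Hom.appIso_hom', Iso.hom_inv_id_apply]
    rw [this, D.app_base, map_zero]
  app_ideal V hV a _ := trivial

/-- The connection on the restriction acts through `LogDer.extend`. This identity lets it be
compared with the connection on `X` for derivations that come from `X`. -/
lemma LogDer.pull_extend {f : X ⟶ S} {I : X.IdealSheafData}
    (hI : Disjoint (j.opensRange : Set X) (I.support : Set X)) {U : X.Opens} (D : LogDer f I U) :
    ((D.pull j).extend j hI : LogDer f I _) = D.restrict (image_preimage_le j U) := by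
  ext W hW a
  refine (openImmersionEquiv_symm_eq j W (hW.trans (image_le_range j _)) _ _).2 ?_
  change (j.appIso _).hom (D.app _ _ ((j.appIso _).inv (j.app W a))) = j.app W (D.app _ _ a)
  rw [appIso_inv_app_preimage, ← D.app_res (hW.trans (image_preimage_le j U)),
    ← appIso_inv_app_preimage, Iso.inv_hom_id_apply]

variable {j}

lemma smul_restrict {M : X.Modules} {V : X'.Opens} (a : Γ(X, j ''ᵁ V)) (m : Γ(M, j ''ᵁ V)) :
    (((j.appIso V).hom a • (show Γ(M.restrict j, V) from m) : Γ(M.restrict j, V)) :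
      Γ(M, j ''ᵁ V)) = a • m := by
  change (j.appIso V).inv ((j.appIso V).hom a) • m = _
  rw [Iso.hom_inv_id_apply]

variable (j) in
/-- The restriction of a section to an open subscheme. -/
def toRestrict (M : X.Modules) (U : X.Opens) : Γ(M, U) →+ Γ(M.restrict j, j ⁻¹ᵁ U) :=
  (resM M (image_preimage_le j U) : Γ(M, U) →+ Γ(M, j ''ᵁ (j ⁻¹ᵁ U)))

lemma toRestrict_smul (M : X.Modules) {U : X.Opens} (a : Γ(X, U)) (m : Γ(M, U)) :
    toRestrict j M U (a • m) = j.app U a • toRestrict j M U m := by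
  refine (resM_smul M (image_preimage_le j U) a m).trans ?_
  rw [← appIso_inv_app_preimage]
  rfl

lemma toRestrict_res (M : X.Modules) {U V : X.Opens} (h : V ≤ U) (h' : j ⁻¹ᵁ V ≤ j ⁻¹ᵁ U)
    (m : Γ(M, U)) :
    toRestrict j M V (resM M h m) = resM (M.restrict j) h' (toRestrict j M U m) :=
  (resM_resM M h (image_preimage_le j V) m).trans
    (resM_resM M (image_preimage_le j U) (j.image_mono h') m).symm

lemma resM_toRestrict (M : X.Modules) {V : X'.Opens} {U : X.Opens} (h : j ''ᵁ V ≤ U)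
    (h' : V ≤ j ⁻¹ᵁ U) (m : Γ(M, U)) :
    resM (M.restrict j) h' (toRestrict j M U m) = resM M h m :=
  resM_resM M (image_preimage_le j U) (j.image_mono h') m

lemma toRestrict_nabla {f : X ⟶ S} {I : X.IdealSheafData}
    (hI : Disjoint (j.opensRange : Set X) (I.support : Set X)) (E : LogConn f I) {U : X.Opens}
    (D : LogDer f I U) (m : Γ(E.mod, U)) : toRestrict j E.mod U (E.nabla.app D m) =
      ((restrictFunctor j f hI).obj E).nabla.app (D.pull j) (toRestrict j E.mod U m) := by
  refine (E.nabla.res (image_preimage_le j U) D m).trans ?_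
  rw [← LogDer.pull_extend j hI]
  rfl

/-- The sections of `M` whose restriction to an open subscheme belongs to a given family. -/
def SubPresheaf.extend {M : X.Modules} (N : SubPresheaf (M.restrict j)) : SubPresheaf M where
  carrier U :=
    { ((N.carrier (j ⁻¹ᵁ U)).toAddSubgroup.comap (toRestrict j M U)) with
      smul_mem' := fun a m hm => by
        change toRestrict j M U (a • m) ∈ N.carrier _
        rw [toRestrict_smul]
        exact (N.carrier _).smul_mem _ hm }
  res_mem {U V} h m hm := by
    change toRestrict j M V (resM M h m) ∈ N.carrier _
    rw [toRestrict_res M h (preimage_le_preimage j h)]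
    exact N.res_mem _ hm

lemma SubPresheaf.mem_extend {M : X.Modules} {N : SubPresheaf (M.restrict j)} {U : X.Opens}
    {m : Γ(M, U)} : m ∈ N.extend.carrier U ↔ toRestrict j M U m ∈ N.carrier (j ⁻¹ᵁ U) := Iff.rfl

/-- Over opens contained in `X'` the extended family is `N` again; this is why the extension
restricts to the object one started from. -/
lemma SubPresheaf.mem_extend_image {M : X.Modules} {N : SubPresheaf (M.restrict j)}
    {V : X'.Opens} {m : Γ(M, j ''ᵁ V)} : m ∈ N.extend.carrier (j ''ᵁ V) ↔
      (show Γ(M.restrict j, V) from m) ∈ N.carrier V := by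
  rw [mem_extend]
  constructor
  · intro h
    have := N.res_mem (le_preimage_image j V) h
    rwa [resM_toRestrict M le_rfl, resM_self] at this
  · intro h
    exact N.res_mem (j.preimage_image_eq V).le h

lemma SubPresheaf.extend_isLocal {M : X.Modules} {N : SubPresheaf (M.restrict j)}
    (hN : N.IsLocal) : N.extend.IsLocal := by
  intro U m h
  refine mem_extend.2 (hN _ _ fun x hx => ?_)
  obtain ⟨V, hV, hxV, hm⟩ := h (j x) hx
  refine ⟨j ⁻¹ᵁ V, preimage_le_preimage j hV, hxV, ?_⟩
  rw [← toRestrict_res M hV]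
  exact hm

/-- A logarithmic derivation restricts to a derivation on `X'`, and restriction of sections
intertwines the two operators. -/
lemma SubPresheaf.extend_isHorizontal {f : X ⟶ S} {I : X.IdealSheafData}
    (hI : Disjoint (j.opensRange : Set X) (I.support : Set X)) {E : LogConn f I}
    {N : SubPresheaf ((restrictFunctor j f hI).obj E).mod} (hN : N.IsHorizontal) :
    (SubPresheaf.extend (M := E.mod) N).IsHorizontal := by
  intro U D m hm
  change toRestrict j E.mod U _ ∈ N.carrier _
  rw [toRestrict_nabla hI]
  exact hN _ (D.pull j) _ hm

/-- The coherence of the extension rests on this. Extend g^k s to a section m of `M` over `U`; on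
j⁻¹(D(g)) it lies in `N`, so `exists_pow_smul_mem` on the quasi-compact open j⁻¹(U) gives a power of
g that moves its restriction to j⁻¹(U) into `N`. -/
lemma SubPresheaf.extend_extends [IsLocallyNoetherian X] {M : X.Modules}
    {N : SubPresheaf (M.restrict j)} (hM : IsLocalizing M) (hM' : IsLocalizing (M.restrict j))
    (hl : N.IsLocal) (hN : N.Extends) : N.extend.Extends := by
  intro U hU g s hs
  obtain ⟨k, m, hm⟩ := hM.surj hU g s
  have hg : X'.basicOpen (j.app U g) = j ⁻¹ᵁ X.basicOpen g := (Scheme.preimage_basicOpen j g).symm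
  have hc : IsCompact ((j ⁻¹ᵁ U : X'.Opens) : Set X') := by
    -- An open immersion into a locally noetherian scheme is quasi-compact.
    have : QuasiCompact j := inferInstance
    exact this.isCompact_preimage _ U.isOpen hU.isCompact
  have h1 : resM M (X.basicOpen_le g) m ∈ N.extend.carrier _ := by
    rw [hm]
    exact Submodule.smul_mem _ _ hs
  rw [mem_extend, toRestrict_res M _ (preimage_le_preimage j (X.basicOpen_le g))] at h1
  have h2 := N.res_mem hg.le h1
  rw [resM_resM] at h2
  obtain ⟨l, hl⟩ := hN.exists_pow_smul_mem hM' hl hc (j.app U g) _ h2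
  refine ⟨l + k, g ^ l • m, ?_, ?_⟩
  · rw [mem_extend, toRestrict_smul, map_pow]
    exact hl
  · rw [resM_smul, hm, smul_smul, map_pow, pow_add]

end Extension

/-! ### Subobjects and quotients of restrictions -/

section SubQuotient

variable {X' : Scheme.{u}} {j : X' ⟶ X} [IsOpenImmersion j] {f : X ⟶ S} {I : X.IdealSheafData}
  (hI : Disjoint (j.opensRange : Set X) (I.support : Set X)) {E : LogConn f I}

/-- The model consists of the sections of `E` whose restriction lies in the image of φ. Its
restriction and `F` are then subobjects of the restriction of `E` with the same image. -/
lemma exists_sub_extension [IsLocallyNoetherian X] (hE : IsCoherent E.mod) {F : LogConn (j ≫ f) ⊤}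
    (hF : IsCoherent F.mod) (φ : F ⟶ (restrictFunctor j f hI).obj E)
    (hφ : ∀ U, Function.Injective (φ.hom.app U)) :
    ∃ E' : LogConn f I, IsCoherent E'.mod ∧ Nonempty ((restrictFunctor j f hI).obj E' ≅ F) := by
  let N := SubPresheaf.im φ.hom
  have hl : N.IsLocal := SubPresheaf.im_isLocal _ hφ
  have hh : N.IsHorizontal := SubPresheaf.im_isHorizontal φ
  have he : N.Extends := SubPresheaf.im_extends _ hF.isLocalizing
  let N' : SubPresheaf E.mod := SubPresheaf.extend (M := E.mod) N
  have hl' : N'.IsLocal := SubPresheaf.extend_isLocal hl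
  have hh' : N'.IsHorizontal := SubPresheaf.extend_isHorizontal hI hh
  have he' : N'.Extends := SubPresheaf.extend_extends hE.isLocalizing
    (hE.restrict j).isLocalizing hl he
  let E' := E.sub N' hl' hh'
  let ι : (restrictFunctor j f hI).obj E' ⟶ (restrictFunctor j f hI).obj E :=
    (restrictFunctor j f hI).map (E.subι N' hl' hh')
  have hι (U) : Function.Injective (ι.hom.app U) := fun _ _ h => Subtype.ext h
  have hιm {U : X'.Opens} (m : Γ(((restrictFunctor j f hI).obj E).mod, U)) :
      (∃ x, ι.hom.app U x = m) ↔ ∃ y, φ.hom.app U y = m := by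
    refine Iff.trans ?_ ((SubPresheaf.mem_extend_image (M := E.mod) (N := N) (m := m)).trans
      SubPresheaf.mem_im)
    exact ⟨fun ⟨x, hx⟩ => hx ▸ (show N'.carrier _ from x).2, fun h =>
      ⟨(⟨m, h⟩ : N'.carrier _), rfl⟩⟩
  refine ⟨E', N'.toModules_isCoherent hl' hE he', ⟨Corr.isoOfInjective ι φ hι hφ hιm⟩⟩

/-- The model is the quotient of `E` by the sections restricting into the kernel of ψ. Its
restriction and `Q` are then quotients of the restriction of `E` with the same kernel. -/
lemma exists_quot_extension [IsLocallyNoetherian X] (hE : IsCoherent E.mod) {Q : LogConn (j ≫ f) ⊤}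
    (hQ : IsCoherent Q.mod) (ψ : (restrictFunctor j f hI).obj E ⟶ Q)
    (hψ : ∀ (U : X'.Opens) (q : Γ(Q.mod, U)), ∀ x ∈ U, ∃ (V : X'.Opens) (h : V ≤ U), x ∈ V ∧
      ∃ m, ψ.hom.app V m = resM _ h q) :
    ∃ E' : LogConn f I, IsCoherent E'.mod ∧ Nonempty ((restrictFunctor j f hI).obj E' ≅ Q) := by
  let N := SubPresheaf.ker ψ.hom
  have hl : N.IsLocal := SubPresheaf.ker_isLocal _
  have hh : N.IsHorizontal := SubPresheaf.ker_isHorizontal ψ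
  have he : N.Extends := SubPresheaf.ker_extends _ (hE.restrict j).isLocalizing hQ.isLocalizing
  let N' : SubPresheaf E.mod := SubPresheaf.extend (M := E.mod) N
  have hl' : N'.IsLocal := SubPresheaf.extend_isLocal hl
  have hh' : N'.IsHorizontal := SubPresheaf.extend_isHorizontal hI hh
  have he' : N'.Extends := SubPresheaf.extend_extends hE.isLocalizing
    (hE.restrict j).isLocalizing hl he
  let E' := E.quot N' hh'
  let π : (restrictFunctor j f hI).obj E ⟶ (restrictFunctor j f hI).obj E' :=
    (restrictFunctor j f hI).map (E.quotProj N' hh')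
  refine ⟨E', SubPresheaf.quot_isCoherent hE he', ⟨Corr.isoOfSurjective π ψ ?_ hψ ?_⟩⟩
  -- Local surjectivity of the projection is known on opens of `X`; lifts are found there and
  -- restricted along `j`.
  · intro U (c : Γ(N'.quot, j ''ᵁ U)) x hx
    obtain ⟨V, hV, hxV, m, hm⟩ := SubPresheaf.exists_quotπ (N := N') (U := j ''ᵁ U) c (j x)
      ⟨x, hx, rfl⟩
    have h1 : j ⁻¹ᵁ V ≤ U := preimage_le j hV
    refine ⟨j ⁻¹ᵁ V, h1, hxV, toRestrict j E.mod V m, ?_⟩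
    change N'.quotπ _ (resM E.mod (image_preimage_le j V) m) = resM _ (j.image_mono h1) _
    rw [SubPresheaf.quotπ_res, hm, resM_resM]
  · intro U m
    refine Iff.trans ?_ ((SubPresheaf.mem_extend_image (M := E.mod) (N := N) (m := m)).trans
      SubPresheaf.mem_ker)
    exact ⟨fun h => SubPresheaf.mem_of_quotπ_eq_zero hl' h, fun h => SubPresheaf.quotπ_eq_zero h⟩

end SubQuotient

/-! ### Coherence of tensor products -/

section TensorLocalization

open TensorProduct

lemma isUnit_algebraMap_end {A M' : Type u} (B : Type u) [CommRing A] [CommRing B] [Algebra A B]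
    (g : A) [IsLocalization.Away g B] [AddCommGroup M'] [Module A M'] [Module B M']
    [IsScalarTower A B M'] : IsUnit (algebraMap A (Module.End A M') g) := by
  have := (IsLocalization.Away.algebraMap_isUnit (S := B) g).map
    (Algebra.lsmul A A M' : B →ₐ[A] Module.End A M')
  rwa [AlgHom.commutes] at this

variable {A B M N M' N' : Type u} [CommRing A] [CommRing B] [Algebra A B] (g : A)
  [IsLocalization.Away g B] [AddCommGroup M] [Module A M] [AddCommGroup N] [Module A N]
  [AddCommGroup M'] [Module A M'] [Module B M'] [IsScalarTower A B M']
  [AddCommGroup N'] [Module A N'] [Module B N'] [IsScalarTower A B N']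

/-- Since B is a localization of A, the tensor products of M' and N' over B and over A coincide, and
over A the map φ ⊗ ψ is again a localization. -/
lemma tensor_localization (φ : M →ₗ[A] M') (ψ : N →ₗ[A] N') [IsLocalizedModule.Away g φ]
    [IsLocalizedModule.Away g ψ] (T : M ⊗[A] N →+ M' ⊗[B] N')
    (hT : ∀ m n, T (m ⊗ₜ n) = φ m ⊗ₜ ψ n) :
    (∀ t, T t = 0 → ∃ k : ℕ, g ^ k • t = 0) ∧
      ∀ s, ∃ (k : ℕ) (t : M ⊗[A] N), T t = algebraMap A B g ^ k • s := by
  let e : M' ⊗[B] N' ≃ₗ[B] M' ⊗[A] N' :=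
    IsLocalization.moduleTensorEquiv (Submonoid.powers g) B M' N'
  have he (m : M') (n : N') : e (m ⊗ₜ n) = m ⊗ₜ n := rfl
  have heT (t : M ⊗[A] N) : e (T t) = TensorProduct.map φ ψ t := by
    induction t using TensorProduct.induction_on with
    | zero => simp only [map_zero]
    | add s t hs ht => simp only [map_add, hs, ht]
    | tmul m n => rw [hT, he, TensorProduct.map_tmul]
  have : IsLocalizedModule.Away g (TensorProduct.map φ ψ) := inferInstance
  refine ⟨fun t ht => ?_, fun s => ?_⟩
  · obtain ⟨k, hk⟩ := IsLocalizedModule.Away.exists_of_eq g (f := TensorProduct.map φ ψ)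
      (x := t) (y := 0) (by rw [← heT, ht, map_zero, map_zero])
    exact ⟨k, by rw [hk, smul_zero]⟩
  · obtain ⟨⟨t, _, k, rfl⟩, hk⟩ :=
      IsLocalizedModule.surj (Submonoid.powers g) (TensorProduct.map φ ψ) (e s)
    refine ⟨k, t, e.injective ?_⟩
    rw [heT, map_smul, ← map_pow, algebraMap_smul]
    exact hk.symm

end TensorLocalization

section Tensor

variable {M N : X.Modules}

lemma IsLocalizing.tensorPre (hM : IsLocalizing M) (hN : IsLocalizing N) :
    PreIsLocalizing (tensorPre M N) := by
  have key : ∀ {U : X.Opens} (_ : IsAffineOpen U) (g : Γ(X, U)),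
      (∀ t : TSec M N U, resT M N (X.basicOpen_le g) t = 0 → ∃ k : ℕ, g ^ k • t = 0) ∧
      ∀ s : TSec M N (X.basicOpen g), ∃ (k : ℕ) (t : TSec M N U),
        resT M N (X.basicOpen_le g) t = resO (X.basicOpen_le g) g ^ k • s := by
    intro U hU g
    let : Algebra Γ(X, U) Γ(X, X.basicOpen g) := (resO (X.basicOpen_le g)).toAlgebra
    have : IsLocalization.Away g Γ(X, X.basicOpen g) := hU.isLocalization_basicOpen g
    let := Module.compHom Γ(M, X.basicOpen g) (resO (X.basicOpen_le g))
    let := Module.compHom Γ(N, X.basicOpen g) (resO (X.basicOpen_le g))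
    have : IsScalarTower Γ(X, U) Γ(X, X.basicOpen g) Γ(M, X.basicOpen g) :=
      IsScalarTower.of_algebraMap_smul fun _ _ => rfl
    have : IsScalarTower Γ(X, U) Γ(X, X.basicOpen g) Γ(N, X.basicOpen g) :=
      IsScalarTower.of_algebraMap_smul fun _ _ => rfl
    let φ : Γ(M, U) →ₗ[Γ(X, U)] Γ(M, X.basicOpen g) :=
      { resM M (X.basicOpen_le g) with map_smul' := resM_smul M _ }
    let ψ : Γ(N, U) →ₗ[Γ(X, U)] Γ(N, X.basicOpen g) :=
      { resM N (X.basicOpen_le g) with map_smul' := resM_smul N _ }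
    have : IsLocalizedModule.Away g φ := .mk_of_addCommGroup
      (isUnit_algebraMap_end Γ(X, X.basicOpen g) g)
      (fun s => by
        obtain ⟨k, m, h⟩ := hM.surj hU g s
        refine ⟨k, m, Eq.trans ?_ h.symm⟩
        rw [← map_pow]
        rfl)
      (hM.inj hU g)
    have : IsLocalizedModule.Away g ψ := .mk_of_addCommGroup
      (isUnit_algebraMap_end Γ(X, X.basicOpen g) g)
      (fun s => by
        obtain ⟨k, m, h⟩ := hN.surj hU g s
        refine ⟨k, m, Eq.trans ?_ h.symm⟩
        rw [← map_pow]
        rfl)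
      (hN.inj hU g)
    exact tensor_localization g φ ψ (resT M N (X.basicOpen_le g)) (fun m n => rfl)
  exact ⟨fun hU g => (key hU g).1, fun hU g => (key hU g).2⟩

theorem IsCoherent.tensor (hM : IsCoherent M) (hN : IsCoherent N) : IsCoherent (tensor M N) :=
  (hM.isLocalizing.tensorPre hN.isLocalizing).isCoherent fun U hU => by
    have := hM.finite U hU
    have := hN.finite U hU
    exact inferInstanceAs (Module.Finite Γ(X, U) (TSec M N U))

end Tensor

/-! ### Restriction of tensor products -/

section TensorAddMap

open TensorProduct

variable {A B M N M' N' : Type u} [CommRing A] [CommRing B] (σ : A →+* B)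
  [AddCommGroup M] [Module A M] [AddCommGroup N] [Module A N]
  [AddCommGroup M'] [Module B M'] [AddCommGroup N'] [Module B N']

/-- The tensor product of two semilinear maps. -/
def tensorAddMap (φ : M →+ M') (ψ : N →+ N') (hφ : ∀ a m, φ (a • m) = σ a • φ m)
    (hψ : ∀ a n, ψ (a • n) = σ a • ψ n) : M ⊗[A] N →+ M' ⊗[B] N' :=
  TensorProduct.liftAddHom
    { toFun := fun m =>
        { toFun := fun n => φ m ⊗ₜ ψ n
          map_zero' := by simp
          map_add' := fun n n' => by simp only [map_add, TensorProduct.tmul_add] }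
      map_zero' := by ext n; simp
      map_add' := fun m m' => by
        ext n
        simp only [map_add, TensorProduct.add_tmul, AddMonoidHom.coe_mk, ZeroHom.coe_mk,
          AddMonoidHom.add_apply] }
    (fun a m n => by
      simp only [AddMonoidHom.coe_mk, ZeroHom.coe_mk, hφ, hψ, TensorProduct.smul_tmul])

lemma tensorAddMap_tmul (φ : M →+ M') (ψ : N →+ N') (hφ : ∀ a m, φ (a • m) = σ a • φ m)
    (hψ : ∀ a n, ψ (a • n) = σ a • ψ n) (m : M) (n : N) :
    tensorAddMap σ φ ψ hφ hψ (m ⊗ₜ n) = φ m ⊗ₜ ψ n := rfl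

lemma tensorAddMap_smul (φ : M →+ M') (ψ : N →+ N') (hφ : ∀ a m, φ (a • m) = σ a • φ m)
    (hψ : ∀ a n, ψ (a • n) = σ a • ψ n) (a : A) (t : M ⊗[A] N) :
    tensorAddMap σ φ ψ hφ hψ (a • t) = σ a • tensorAddMap σ φ ψ hφ hψ t := by
  induction t using TensorProduct.induction_on with
  | zero => simp only [map_zero, smul_zero]
  | add s t hs ht => simp only [map_add, hs, ht, smul_add]
  | tmul m n =>
    rw [TensorProduct.smul_tmul', tensorAddMap_tmul, tensorAddMap_tmul, hφ,
      TensorProduct.smul_tmul']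

end TensorAddMap

section TensorRestrict

open TensorProduct

variable {X' : Scheme.{u}} {j : X' ⟶ X} [IsOpenImmersion j] {f : X ⟶ S} {I : X.IdealSheafData}
  {hI : Disjoint (j.opensRange : Set X) (I.support : Set X)} {E F : LogConn (j ≫ f) ⊤}
  {E' F' : LogConn f I} (α : E ≅ (restrictFunctor j f hI).obj E')
  (β : F ≅ (restrictFunctor j f hI).obj F')

/-- An isomorphism with a restriction, on sections. -/
def isoApp (V : X'.Opens) : Γ(E.mod, V) →+ Γ(E'.mod, j ''ᵁ V) := (α.hom.hom.app V).hom

/-- The inverse of an isomorphism with a restriction, on sections. -/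
def isoInvApp (V : X'.Opens) : Γ(E'.mod, j ''ᵁ V) →+ Γ(E.mod, V) := (α.inv.hom.app V).hom

lemma isoApp_smul (V : X'.Opens) (a : Γ(X', V)) (m : Γ(E.mod, V)) :
    isoApp α V (a • m) = (j.appIso V).inv.hom a • isoApp α V m :=
  hom_app_smul α.hom.hom a m

lemma isoInvApp_smul (V : X'.Opens) (a : Γ(X, j ''ᵁ V)) (m : Γ(E'.mod, j ''ᵁ V)) :
    isoInvApp α V (a • m) = (j.appIso V).hom.hom a • isoInvApp α V m := by
  rw [← smul_restrict]
  exact hom_app_smul α.inv.hom _ _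

lemma isoInvApp_isoApp (V : X'.Opens) (m : Γ(E.mod, V)) : isoInvApp α V (isoApp α V m) = m :=
  congrArg (fun φ : E ⟶ E => φ.hom.app V m) α.hom_inv_id

lemma isoApp_isoInvApp (V : X'.Opens) (m : Γ(E'.mod, j ''ᵁ V)) :
    isoApp α V (isoInvApp α V m) = m :=
  congrArg (fun φ : (restrictFunctor j f hI).obj E' ⟶ _ => φ.hom.app V m) α.inv_hom_id

lemma isoApp_res {V W : X'.Opens} (h : W ≤ V) (m : Γ(E.mod, V)) :
    isoApp α W (resM _ h m) = resM _ (j.image_mono h) (isoApp α V m) :=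
  (resM_app α.hom.hom h m).symm

lemma isoApp_nabla {V : X'.Opens} (D : LogDer (j ≫ f) ⊤ V) (m : Γ(E.mod, V)) :
    isoApp α V (E.nabla.app D m) = E'.nabla.app (D.extend j hI) (isoApp α V m) :=
  α.hom.horizontal D m

/-- The tensor product of two isomorphisms, on sections of the presheaf tensor product. -/
def tensorIsoApp (V : X'.Opens) : TSec E.mod F.mod V →+ TSec E'.mod F'.mod (j ''ᵁ V) :=
  tensorAddMap (j.appIso V).inv.hom (isoApp α V) (isoApp β V) (isoApp_smul α V) (isoApp_smul β V)

lemma tensorIsoApp_bijective (V : X'.Opens) : Function.Bijective (tensorIsoApp α β V) := by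
  let ψ : TSec E'.mod F'.mod (j ''ᵁ V) →+ TSec E.mod F.mod V :=
    tensorAddMap (j.appIso V).hom.hom (isoInvApp α V) (isoInvApp β V) (isoInvApp_smul α V)
      (isoInvApp_smul β V)
  refine Function.bijective_iff_has_inverse.2 ⟨ψ, fun t => ?_, fun t => ?_⟩
  · induction t using TensorProduct.induction_on with
    | zero => simp only [map_zero]
    | add s t hs ht => simp only [map_add, hs, ht]
    | tmul m n =>
      exact congrArg₂ (· ⊗ₜ ·) (isoInvApp_isoApp α V m) (isoInvApp_isoApp β V n)
  · induction t using TensorProduct.induction_on with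
    | zero => simp only [map_zero]
    | add s t hs ht => simp only [map_add, hs, ht]
    | tmul m n =>
      exact congrArg₂ (· ⊗ₜ ·) (isoApp_isoInvApp α V m) (isoApp_isoInvApp β V n)

lemma tensorIsoApp_res {V W : X'.Opens} (h : W ≤ V) (t : TSec E.mod F.mod V) :
    tensorIsoApp α β W (resT _ _ h t) = resT _ _ (j.image_mono h) (tensorIsoApp α β V t) := by
  induction t using TensorProduct.induction_on with
  | zero => simp only [map_zero]
  | add s t hs ht => simp only [map_add, hs, ht]
  | tmul m n => exact congrArg₂ (· ⊗ₜ ·) (isoApp_res α h m) (isoApp_res β h n)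

lemma tensorIsoApp_nabla {V : X'.Opens} (D : LogDer (j ≫ f) ⊤ V) (t : TSec E.mod F.mod V) :
    tensorIsoApp α β V (tensorPreApp E.nabla F.nabla D t) =
      tensorPreApp E'.nabla F'.nabla (D.extend j hI) (tensorIsoApp α β V t) := by
  induction t using TensorProduct.induction_on with
  | zero => simp only [map_zero]
  | add s t hs ht => simp only [map_add, hs, ht]
  | tmul m n =>
    have h (m n) : tensorIsoApp α β V (m ⊗ₜ n) = isoApp α V m ⊗ₜ isoApp β V n := rfl
    simp only [tensorPreApp_tmul, map_add, h, isoApp_nabla]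

/-- The tensor product of two isomorphisms, with values in the associated sheaf. -/
def toTensorRestrict (V : X'.Opens) : TSec E.mod F.mod V →ₗ[Γ(X', V)]
    Γ(((restrictFunctor j f hI).obj (E'.tensor F')).mod, V) where
  toFun t := toTensor E'.mod F'.mod (j ''ᵁ V) (tensorIsoApp α β V t)
  map_add' s t := by
    rw [map_add, map_add]
    rfl
  map_smul' a t := by
    rw [tensorIsoApp, tensorAddMap_smul, map_smul]
    rfl

lemma toTensorRestrict_res {V W : X'.Opens} (h : W ≤ V) (t : TSec E.mod F.mod V) :
    toTensorRestrict α β W (resT _ _ h t) = resM _ h (toTensorRestrict α β V t) := by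
  change toTensor _ _ _ _ = resM (tensor E'.mod F'.mod) (j.image_mono h) (toTensor _ _ _ _)
  rw [tensorIsoApp_res, toTensor_res]

/-- Both maps out of the presheaf tensor product are horizontal, so the set of pairs of values at a
common element is stable under the connections. -/
lemma toTensor_toTensorRestrict_nabla {V : X'.Opens} (D : LogDer (j ≫ f) ⊤ V)
    (t : TSec E.mod F.mod V) :
    toTensor _ _ V (tensorPreApp E.nabla F.nabla D t) =
        (E.tensor F).nabla.app D (toTensor _ _ V t) ∧
      toTensorRestrict α β V (tensorPreApp E.nabla F.nabla D t) =
        ((restrictFunctor j f hI).obj (E'.tensor F')).nabla.app D (toTensorRestrict α β V t) := by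
  refine ⟨(tensorApp_toTensor E.nabla F.nabla D t).symm, ?_⟩
  change toTensor _ _ _ _ = tensorApp E'.nabla F'.nabla _ (toTensor _ _ _ _)
  rw [tensorIsoApp_nabla, tensorApp_toTensor]

/-- The tensor product commutes with restriction to an open subscheme. -/
def tensorRestrictIso : E.tensor F ≅ (restrictFunctor j f hI).obj (E'.tensor F') :=
  Corr.iso
    -- Both sides are locally images of the presheaf tensor product of `E` and `F`; the graph
    -- relates the two images of one element.
    { rel := fun V => LinearMap.range ((toTensor E.mod F.mod V).prod (toTensorRestrict α β V))
      res := by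
        rintro U V h b c ⟨t, ht⟩
        obtain ⟨rfl, rfl⟩ := Prod.ext_iff.1 ht
        exact ⟨resT _ _ h t, Prod.ext (toTensor_res _ _ h t) (toTensorRestrict_res α β h t)⟩
      nabla := by
        rintro U D b c ⟨t, ht⟩
        obtain ⟨rfl, rfl⟩ := Prod.ext_iff.1 ht
        exact ⟨_, Prod.ext (toTensor_toTensorRestrict_nabla α β D t).1
          (toTensor_toTensorRestrict_nabla α β D t).2⟩
      unique := by
        rintro U c ⟨t, ht⟩
        obtain ⟨h0, rfl⟩ := Prod.ext_iff.1 ht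
        refine eqM_of_locally _ _ _ fun x hx => ?_
        obtain ⟨V, hV, hxV, h⟩ := toTensor_locInj _ _ t 0 (h0.trans (map_zero _).symm) x hx
        refine ⟨V, hV, hxV, ?_⟩
        refine (toTensorRestrict_res α β hV t).symm.trans ?_
        rw [h, map_zero, map_zero, map_zero]
      total := by
        intro U b x hx
        obtain ⟨V, hV, hxV, t, ht⟩ := toTensor_locSurj _ _ b x hx
        exact ⟨V, hV, hxV, _, t, Prod.ext ht rfl⟩ }
    { rel := fun V => LinearMap.range ((toTensorRestrict α β V).prod (toTensor E.mod F.mod V))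
      res := by
        rintro U V h b c ⟨t, ht⟩
        obtain ⟨rfl, rfl⟩ := Prod.ext_iff.1 ht
        exact ⟨resT _ _ h t, Prod.ext (toTensorRestrict_res α β h t) (toTensor_res _ _ h t)⟩
      nabla := by
        rintro U D b c ⟨t, ht⟩
        obtain ⟨rfl, rfl⟩ := Prod.ext_iff.1 ht
        exact ⟨_, Prod.ext (toTensor_toTensorRestrict_nabla α β D t).2
          (toTensor_toTensorRestrict_nabla α β D t).1⟩
      unique := by
        rintro U c ⟨t, ht⟩
        obtain ⟨h0, rfl⟩ := Prod.ext_iff.1 ht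
        refine eqM_of_locally _ _ _ fun x hx => ?_
        obtain ⟨V, hV, hxV, h⟩ := toTensor_locInj E'.mod F'.mod (tensorIsoApp α β U t) 0
          (h0.trans (map_zero _).symm) (j x) ⟨x, hx, rfl⟩
        have hVU := preimage_le j hV
        refine ⟨j ⁻¹ᵁ V, hVU, hxV, ?_⟩
        refine (toTensor_res _ _ hVU t).symm.trans ?_
        -- The vanishing takes place on an open `V` of `X`; restricted to j(j⁻¹(V)), it is
        -- transferred to `X'` by injectivity of `tensorIsoApp`.
        have : resT E.mod F.mod hVU t = 0 := by
          refine (tensorIsoApp_bijective α β _).1 ?_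
          rw [tensorIsoApp_res, map_zero]
          have h1 := congrArg (resT _ _ (image_preimage_le j V)) h
          rw [map_zero, map_zero] at h1
          refine Eq.trans ?_ h1
          exact (resP_resP (tensorPre E'.mod F'.mod) hV (image_preimage_le j V) _).symm
        rw [this, map_zero]
        exact (map_zero _).symm
      total := by
        intro U b x hx
        obtain ⟨V, hV, hxV, t, ht⟩ := toTensor_locSurj E'.mod F'.mod b (j x) ⟨x, hx, rfl⟩
        have hVU := preimage_le j hV
        obtain ⟨t', ht'⟩ := (tensorIsoApp_bijective α β (j ⁻¹ᵁ V)).2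
          (resT _ _ (image_preimage_le j V) t)
        refine ⟨j ⁻¹ᵁ V, hVU, hxV, _, t', Prod.ext ?_ rfl⟩
        change toTensor _ _ _ (tensorIsoApp α β (j ⁻¹ᵁ V) t') =
          resM (tensor E'.mod F'.mod) (j.image_mono hVU) b
        rw [ht', toTensor_res, ht]
        exact resM_resM (tensor E'.mod F'.mod) hV _ b }
    (fun U b c => by
      constructor <;> rintro ⟨t, ht⟩ <;> obtain ⟨h1, h2⟩ := Prod.ext_iff.1 ht <;>
        exact ⟨t, Prod.ext h2 h1⟩)

end TensorRestrict

/-! ### Coherence of duals -/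

section Dual

lemma exists_glue_fun (U : X.Opens) (R : ∀ V : X.Opens, Γ(X, V) → Prop)
    (hres : ∀ (V W : X.Opens) (h : W ≤ V), V ≤ U → ∀ a, R V a → R W (resO h a))
    (huniq : ∀ V : X.Opens, V ≤ U → ∀ a a', R V a → R V a' → a = a')
    (hex : ∀ x ∈ U, ∃ V : X.Opens, V ≤ U ∧ x ∈ V ∧ ∃ a, R V a) :
    ∃ a : Γ(X, U), ∀ (V : X.Opens) (h : V ≤ U) (a' : Γ(X, V)), R V a' → resO h a = a' :=
  exists_glue (SheafOfModules.unit X.ringCatSheaf) U R hres huniq hex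

lemma isUnit_resO_basicOpen {U V : X.Opens} (g : Γ(X, U)) (h : V ≤ U) (hg : V ≤ X.basicOpen g) :
    IsUnit (resO h g) := by
  rw [← resO_resO (X.basicOpen_le g) hg]
  exact (X.toRingedSpace.isUnit_res_basicOpen g).map (resO hg)

variable {M : X.Modules}

/-- On the open `V ≤ U`, the section `m` is a fraction with numerator in `Γ(M, U)`, which the linear
form `L` sends to `c`. -/
def FractionValue {U : X.Opens} (L : Γ(M, U) →ₗ[Γ(X, U)] Γ(X, U)) {V : X.Opens} (hV : V ≤ U)
    (m : Γ(M, V)) (c : Γ(X, V)) : Prop :=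
  ∃ (g : Γ(X, U)) (n : Γ(M, U)), IsUnit (resO hV g) ∧ resM M hV n = resO hV g • m ∧
    resO hV (L n) = resO hV g * c

namespace FractionValue

variable {U : X.Opens} {L : Γ(M, U) →ₗ[Γ(X, U)] Γ(X, U)}

lemma res {V W : X.Opens} {hV : V ≤ U} (h : W ≤ V) {m : Γ(M, V)} {c : Γ(X, V)}
    (H : FractionValue L hV m c) : FractionValue L (h.trans hV) (resM M h m) (resO h c) := by
  obtain ⟨g, n, hg, h1, h2⟩ := H
  refine ⟨g, n, ?_, ?_, ?_⟩
  · rw [← resO_resO hV h]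
    exact hg.map _
  · rw [← resM_resM M hV h, h1, resM_smul, resO_resO]
  · rw [← resO_resO hV h, h2, map_mul, resO_resO]

lemma add {V : X.Opens} {hV : V ≤ U} {m m' : Γ(M, V)} {c c' : Γ(X, V)}
    (H : FractionValue L hV m c) (H' : FractionValue L hV m' c') :
    FractionValue L hV (m + m') (c + c') := by
  obtain ⟨g, n, hg, h1, h2⟩ := H
  obtain ⟨g', n', hg', h1', h2'⟩ := H'
  refine ⟨g * g', g' • n + g • n', ?_, ?_, ?_⟩
  · rw [map_mul]
    exact hg.mul hg'
  · rw [map_add, resM_smul, resM_smul, h1, h1', smul_smul, smul_smul, map_mul, smul_add,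
      mul_comm (resO hV g')]
  · simp only [map_add, map_smul, smul_eq_mul, map_mul, h2, h2']
    ring

lemma smul {V : X.Opens} {hV : V ≤ U} {m : Γ(M, V)} {c : Γ(X, V)}
    (H : FractionValue L hV m c) {a : Γ(X, V)} {b d : Γ(X, U)} (hd : IsUnit (resO hV d))
    (hb : resO hV b = resO hV d * a) :
    FractionValue L hV (a • m) (a * c) := by
  obtain ⟨g, n, hg, h1, h2⟩ := H
  refine ⟨d * g, b • n, ?_, ?_, ?_⟩
  · rw [map_mul]
    exact hd.mul hg
  · rw [resM_smul, h1, hb, smul_smul, smul_smul, map_mul]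
    congr 1
    ring
  · rw [map_smul, smul_eq_mul, map_mul, h2, hb, map_mul]
    ring

/-- On a basic open D(g) inside `V`, n is killed by a power of g, hence so is L(n), while g is
invertible there. -/
lemma unique_zero (hU : IsAffineOpen U) (hM : IsLocalizing M) {V : X.Opens} {hV : V ≤ U}
    {n : Γ(M, U)} (h : resM M hV n = 0) : resO hV (L n) = 0 := by
  refine eqO_of_locally _ _ fun x hx => ?_
  obtain ⟨g, hgV, hxg⟩ := hU.exists_basicOpen_le ⟨x, hx⟩ (hV hx)
  refine ⟨X.basicOpen g, hgV, hxg, ?_⟩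
  obtain ⟨k, hk⟩ := hM.inj hU g n (by rw [← resM_resM M hV hgV, h, map_zero])
  have hu := (isUnit_resO_basicOpen g (X.basicOpen_le g) le_rfl).pow k
  have h2 := congrArg (resO (X.basicOpen_le g)) (congrArg L hk)
  rw [map_smul, map_zero, map_zero, smul_eq_mul, map_mul, map_pow] at h2
  rw [resO_resO, map_zero]
  exact (hu.mul_right_eq_zero).1 h2

/-- Cross-multiplication of the two fractions reduces this to `unique_zero`. -/
lemma unique (hU : IsAffineOpen U) (hM : IsLocalizing M) {V : X.Opens} {hV : V ≤ U}
    {m : Γ(M, V)} {c c' : Γ(X, V)} (H : FractionValue L hV m c) (H' : FractionValue L hV m c') :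
    c = c' := by
  obtain ⟨g, n, hg, h1, h2⟩ := H
  obtain ⟨g', n', hg', h1', h2'⟩ := H'
  have h := unique_zero (L := L) hU hM (hV := hV) (n := g' • n - g • n') (by
    rw [map_sub, resM_smul, resM_smul, h1, h1', smul_smul, smul_smul, mul_comm, sub_self])
  rw [map_sub, map_smul, map_smul, smul_eq_mul, smul_eq_mul, map_sub, map_mul, map_mul, h2, h2',
    sub_eq_zero, mul_left_comm] at h
  exact hg'.mul_left_cancel (hg.mul_left_cancel h)

lemma exists_locally (hU : IsAffineOpen U) (hM : IsLocalizing M) (L : Γ(M, U) →ₗ[Γ(X, U)] Γ(X, U))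
    {V : X.Opens} (hV : V ≤ U) (m : Γ(M, V)) : ∀ x ∈ V, ∃ (W : X.Opens) (h : W ≤ V), x ∈ W ∧
      ∃ c, FractionValue L (h.trans hV) (resM M h m) c := by
  intro x hx
  obtain ⟨g, hgV, hxg⟩ := hU.exists_basicOpen_le ⟨x, hx⟩ (hV hx)
  refine ⟨X.basicOpen g, hgV, hxg, ?_⟩
  obtain ⟨k, n, h⟩ := hM.surj hU g (resM M hgV m)
  have hu := (isUnit_resO_basicOpen g (X.basicOpen_le g) le_rfl).pow k
  obtain ⟨c, hc⟩ := hu.dvd (a := resO (X.basicOpen_le g) (L n))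
  refine ⟨c, g ^ k, n, ?_, ?_, ?_⟩
  · rwa [map_pow]
  · rw [h, map_pow]
  · rw [hc, map_pow]

/-- A function on `V` is a quotient of functions on `U` only after shrinking to basic opens of `U`,
so homogeneity holds locally. -/
lemma smul_locally (hU : IsAffineOpen U) {V : X.Opens} {hV : V ≤ U} {m : Γ(M, V)} {c : Γ(X, V)}
    (H : FractionValue L hV m c) (a : Γ(X, V)) : ∀ x ∈ V, ∃ (W : X.Opens) (h : W ≤ V), x ∈ W ∧
      FractionValue L (h.trans hV) (resM M h (a • m)) (resO h (a * c)) := by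
  intro x hx
  obtain ⟨g, hgV, hxg⟩ := hU.exists_basicOpen_le ⟨x, hx⟩ (hV hx)
  refine ⟨X.basicOpen g, hgV, hxg, ?_⟩
  let : Algebra Γ(X, U) Γ(X, X.basicOpen g) := (resO (X.basicOpen_le g)).toAlgebra
  have : IsLocalization.Away g Γ(X, X.basicOpen g) := hU.isLocalization_basicOpen g
  obtain ⟨k, b, hb⟩ := IsLocalization.Away.surj g (resO hgV a)
  have hu := (isUnit_resO_basicOpen g (X.basicOpen_le g) le_rfl).pow k
  rw [resM_smul, map_mul]
  refine (H.res hgV).smul (b := b) (d := g ^ k) (by rwa [map_pow]) ?_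
  rw [map_pow, mul_comm]
  exact hb.symm

end FractionValue

/-- On an affine open, a linear form on global sections extends to all sections. -/
lemma exists_dualSec_extending (hM : IsLocalizing M) {U : X.Opens} (hU : IsAffineOpen U)
    (L : Γ(M, U) →ₗ[Γ(X, U)] Γ(X, U)) : ∃ φ : DualSec M U, φ.app U le_rfl = L := by
  -- The value at m is glued from the values L(n)/g on opens where m is the fraction n/g.
  have key : ∀ (V : X.Opens) (hV : V ≤ U) (m : Γ(M, V)), ∃ c : Γ(X, V),
      ∀ (W : X.Opens) (h : W ≤ V) (c' : Γ(X, W)),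
        FractionValue L (h.trans hV) (resM M h m) c' → resO h c = c' := by
    intro V hV m
    obtain ⟨c, hc⟩ := exists_glue_fun V
      (fun W c' => ∃ h : W ≤ V, FractionValue L (h.trans hV) (resM M h m) c')
      (by
        rintro W W' h - a ⟨h', H⟩
        refine ⟨h.trans h', ?_⟩
        have := H.res h
        rwa [resM_resM] at this)
      (by
        rintro W - a a' ⟨_, H⟩ ⟨_, H'⟩
        exact H.unique hU hM H')
      (by
        intro x hx
        obtain ⟨W, h, hxW, c, H⟩ := FractionValue.exists_locally hU hM L hV m x hx
        exact ⟨W, h, hxW, c, h, H⟩)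
    exact ⟨c, fun W h c' H => hc W h c' ⟨h, H⟩⟩
  choose F hF using key
  have hloc : ∀ (V : X.Opens) (hV : V ≤ U) (m : Γ(M, V)), ∀ x ∈ V,
      ∃ (W : X.Opens) (h : W ≤ V), x ∈ W ∧
        FractionValue L (h.trans hV) (resM M h m) (resO h (F V hV m)) := by
    intro V hV m x hx
    obtain ⟨W, h, hxW, c, H⟩ := FractionValue.exists_locally hU hM L hV m x hx
    exact ⟨W, h, hxW, by rwa [hF V hV m W h c H]⟩
  refine ⟨⟨fun V hV =>
    { toFun := F V hV
      map_add' := fun m m' => eqO_of_locally _ _ fun x hx => ?_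
      map_smul' := fun a m => eqO_of_locally _ _ fun x hx => ?_ }, ?_⟩, ?_⟩
  · obtain ⟨W, h, hxW, H⟩ := hloc V hV m x hx
    obtain ⟨W', h', hxW', H'⟩ := hloc V hV m' x hx
    refine ⟨W ⊓ W', inf_le_left.trans h, ⟨hxW, hxW'⟩, ?_⟩
    have H1 := (H.res (inf_le_left : W ⊓ W' ≤ W)).add (H'.res (inf_le_right : W ⊓ W' ≤ W'))
    rw [resM_resM, resM_resM, resO_resO, resO_resO, ← map_add, ← map_add] at H1
    exact hF V hV _ _ _ _ H1
  · obtain ⟨W, h, hxW, H⟩ := hloc V hV m x hx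
    obtain ⟨W', h', hxW', H'⟩ := H.smul_locally hU (resO h a) x hxW
    refine ⟨W', h'.trans h, hxW', hF V hV _ _ _ _ ?_⟩
    rw [← resM_smul, resM_resM, ← map_mul, resO_resO] at H'
    exact H'
  · intro V W hV h m
    refine eqO_of_locally _ _ fun x hx => ?_
    obtain ⟨W', h', hxW', H⟩ := hloc V hV m x (h hx)
    refine ⟨W' ⊓ W, inf_le_right, ⟨hxW', hx⟩, ?_⟩
    have H1 := H.res (inf_le_left : W' ⊓ W ≤ W')
    rw [resM_resM, resO_resO, ← resM_resM M h inf_le_right, ← resO_resO h inf_le_right] at H1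
    exact (hF W (h.trans hV) (resM M h m) _ _ _ H1).symm
  · refine LinearMap.ext fun m => ?_
    rw [← resO_self (L m), ← resO_self (DualSec.app _ _ _ m)]
    -- Over `U` itself, m is a fraction with denominator 1.
    refine hF U le_rfl m U le_rfl _ ⟨1, m, ?_, ?_, ?_⟩
    · rw [map_one]
      exact isUnit_one
    · rw [map_one, one_smul]
    · rw [map_one, one_mul]

/-- Over a basic open every section becomes, after multiplication by a unit, the restriction of a
section over `U`. -/
lemma dualSec_eq_zero (hM : IsLocalizing M) {U : X.Opens} (hU : IsAffineOpen U)
    (φ : DualSec M U) (h : ∀ m, φ.app U le_rfl m = 0) : φ = 0 := by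
  refine DualSec.ext' fun V hV m => eqO_of_locally _ _ fun x hx => ?_
  obtain ⟨g, hgV, hxg⟩ := hU.exists_basicOpen_le ⟨x, hx⟩ (hV hx)
  refine ⟨X.basicOpen g, hgV, hxg, ?_⟩
  obtain ⟨k, n, hn⟩ := hM.surj hU g (resM M hgV m)
  have hu := (isUnit_resO_basicOpen g (X.basicOpen_le g) le_rfl).pow k
  rw [φ.app_res, DualSec.zero_app, map_zero]
  refine (hu.mul_right_eq_zero).1 ?_
  rw [← smul_eq_mul, ← map_smul, ← hn, ← φ.app_res le_rfl, h, map_zero]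

variable (M) in
/-- A section of the dual gives a linear form on sections. -/
def dualEval (U : X.Opens) : DualSec M U →ₗ[Γ(X, U)] (Γ(M, U) →ₗ[Γ(X, U)] Γ(X, U)) where
  toFun φ := φ.app U le_rfl
  map_add' _ _ := rfl
  map_smul' a _ := LinearMap.ext fun _ => congrArg (· * _) (resO_self a)

lemma dualEval_injective (hM : IsLocalizing M) {U : X.Opens} (hU : IsAffineOpen U) :
    Function.Injective (dualEval M U) := by
  rw [injective_iff_map_eq_zero]
  exact fun φ h => dualSec_eq_zero hM hU φ fun m => LinearMap.congr_fun h m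

lemma dualEval_res {U V : X.Opens} (h : V ≤ U) (φ : DualSec M U) (m : Γ(M, U)) :
    dualEval M V (DualSec.res h φ) (resM M h m) = resO h (dualEval M U φ m) :=
  (φ.app_res le_rfl h m).symm

/-- A surjection from A^n embeds the linear forms on N into those on A^n, a noetherian module. -/
lemma finite_linearForms {A N : Type u} [CommRing A] [IsNoetherianRing A] [AddCommGroup N]
    [Module A N] [Module.Finite A N] : Module.Finite A (N →ₗ[A] A) := by
  obtain ⟨n, p, hp⟩ := Module.Finite.exists_fin' A N
  exact Module.Finite.of_injective (LinearMap.lcomp A A p) fun φ ψ h =>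
    LinearMap.ext fun m => by
      obtain ⟨m, rfl⟩ := hp m
      exact LinearMap.congr_fun h m

/-- Hom out of a finitely presented module commutes with localization. Sections of the dual over an
affine open are linear forms on sections, by `dualEval_injective` and `exists_dualSec_extending`. -/
theorem IsCoherent.isLocalizing_dual [IsLocallyNoetherian X] (hM : IsCoherent M) :
    IsLocalizing (dual M) := by
  have hL := hM.isLocalizing
  have key : ∀ {U : X.Opens} (_ : IsAffineOpen U) (g : Γ(X, U)),
      (∀ φ : DualSec M U, DualSec.res (X.basicOpen_le g) φ = 0 → ∃ k : ℕ, g ^ k • φ = 0) ∧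
      ∀ s : DualSec M (X.basicOpen g), ∃ (k : ℕ) (φ : DualSec M U),
        DualSec.res (X.basicOpen_le g) φ = resO (X.basicOpen_le g) g ^ k • s := by
    intro U hU g
    have : IsNoetherianRing Γ(X, U) := IsLocallyNoetherian.component_noetherian ⟨U, hU⟩
    have := hM.finite U hU
    have : Module.FinitePresentation Γ(X, U) Γ(M, U) := Module.finitePresentation_of_finite _ _
    let : Algebra Γ(X, U) Γ(X, X.basicOpen g) := (resO (X.basicOpen_le g)).toAlgebra
    have : IsLocalization.Away g Γ(X, X.basicOpen g) := hU.isLocalization_basicOpen g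
    let ρ := Algebra.linearMap Γ(X, U) Γ(X, X.basicOpen g)
    have hρ (a : Γ(X, U)) : ρ a = resO (X.basicOpen_le g) a := rfl
    refine ⟨fun φ hφ => ?_, fun s => ?_⟩
    -- Finite generation gives one power of g that kills the values of the linear form on all
    -- sections.
    · obtain ⟨⟨_, k, rfl⟩, hk⟩ := Module.Finite.exists_smul_of_comp_eq_of_isLocalizedModule
        (Submonoid.powers g) ρ (dualEval M U φ) 0 (LinearMap.ext fun m => by
          rw [LinearMap.comp_apply, hρ, ← dualEval_res, hφ, map_zero]
          exact (map_zero ρ).symm)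
      refine ⟨k, dualEval_injective hL hU ?_⟩
      rw [map_smul, map_zero]
      exact hk.trans (smul_zero _)
    · let ψ : Γ(M, U) →ₗ[Γ(X, U)] Γ(X, X.basicOpen g) :=
        { toFun := fun m => dualEval M _ s (resM M (X.basicOpen_le g) m)
          map_add' := fun m m' => by rw [map_add, map_add]
          map_smul' := fun a m => by
            rw [resM_smul, map_smul]
            rfl }
      -- Finite presentation clears the denominators of ψ with a single power of g.
      obtain ⟨L, ⟨_, k, rfl⟩, hk⟩ :=
        Module.FinitePresentation.exists_lift_of_isLocalizedModule (Submonoid.powers g) ρ ψ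
      obtain ⟨φ, rfl⟩ := exists_dualSec_extending hL hU L
      refine ⟨k, φ, dualEval_injective hL (hU.basicOpen g) (LinearMap.ext fun m => ?_)⟩
      -- The two forms agree on restrictions from `U`; every section over D(g) is one up to the unit
      -- g^l.
      obtain ⟨l, n, hn⟩ := hL.surj hU g m
      have hu := (isUnit_resO_basicOpen g (X.basicOpen_le g) le_rfl).pow l
      refine hu.mul_left_cancel ?_
      rw [← smul_eq_mul, ← smul_eq_mul, ← map_smul, ← map_smul, ← hn, dualEval_res, map_smul,
        LinearMap.smul_apply, smul_eq_mul, ← map_pow]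
      exact LinearMap.congr_fun hk n
  exact ⟨fun hU g => (key hU g).1, fun hU g => (key hU g).2⟩

/-- For finiteness, the embedding into linear forms suffices, by noetherianity. -/
theorem IsCoherent.dual [IsLocallyNoetherian X] (hM : IsCoherent M) : IsCoherent (dual M) where
  isQuasicoherent := hM.isLocalizing_dual.isQuasicoherent
  finite U hU := by
    have : IsNoetherianRing Γ(X, U) := IsLocallyNoetherian.component_noetherian ⟨U, hU⟩
    have := hM.finite U hU
    have := finite_linearForms (A := Γ(X, U)) (N := Γ(M, U))
    exact Module.Finite.of_injective (dualEval M U) (dualEval_injective hM.isLocalizing hU)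

end Dual

/-! ### Restriction of duals -/

section DualRestrict

variable {X' : Scheme.{u}} {j : X' ⟶ X} [IsOpenImmersion j] {f : X ⟶ S} {I : X.IdealSheafData}
  {hI : Disjoint (j.opensRange : Set X) (I.support : Set X)} {E : LogConn (j ≫ f) ⊤}
  {E' : LogConn f I} (α : E ≅ (restrictFunctor j f hI).obj E')

lemma isoInvApp_res {V W : X'.Opens} (h : W ≤ V) (m : Γ(E'.mod, j ''ᵁ V)) :
    isoInvApp α W (resM _ (j.image_mono h) m) = resM _ h (isoInvApp α V m) := by
  obtain ⟨m, rfl⟩ : ∃ n, isoApp α V n = m := ⟨_, isoApp_isoInvApp α V m⟩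
  rw [← isoApp_res, isoInvApp_isoApp, isoInvApp_isoApp]

/-- The transport of a linear form along an isomorphism with a restriction. -/
def dualIsoApp {V : X'.Opens} (ψ : DualSec E'.mod (j ''ᵁ V)) : DualSec E.mod V where
  app W hW :=
    { toFun := fun m => (j.appIso W).hom (ψ.app (j ''ᵁ W) (j.image_mono hW) (isoApp α W m))
      map_add' := fun m m' => by rw [map_add, map_add, map_add]
      map_smul' := fun a m => by
        rw [isoApp_smul, map_smul, smul_eq_mul, map_mul]
        exact congrArg (· * _) (Iso.inv_hom_id_apply (j.appIso W) a) }
  app_res {W W'} hW h m := by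
    change resO h ((j.appIso W).hom _) =
      (j.appIso W').hom (ψ.app _ _ (isoApp α W' (resM _ h m)))
    rw [isoApp_res, ← ψ.app_res (j.image_mono hW) (j.image_mono h)]
    exact (CategoryTheory.congr_fun (j.appIso_hom_naturality (homOfLE h).op) _).symm

lemma dualIsoApp_app {V : X'.Opens} (ψ : DualSec E'.mod (j ''ᵁ V)) (W : X'.Opens) (hW : W ≤ V)
    (m : Γ(E.mod, W)) : (dualIsoApp α ψ).app W hW m =
      (j.appIso W).hom (ψ.app (j ''ᵁ W) (j.image_mono hW) (isoApp α W m)) := rfl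

lemma dualIsoApp_add {V : X'.Opens} (ψ ψ' : DualSec E'.mod (j ''ᵁ V)) :
    dualIsoApp α (ψ + ψ') = dualIsoApp α ψ + dualIsoApp α ψ' :=
  DualSec.ext' fun W hW m => by
    rw [DualSec.add_app, dualIsoApp_app, DualSec.add_app, map_add]
    rfl

lemma dualIsoApp_smul {V : X'.Opens} (a : Γ(X', V)) (ψ : DualSec E'.mod (j ''ᵁ V)) :
    dualIsoApp α ((show Γ(X, j ''ᵁ V) from (j.appIso V).inv a) • ψ) = a • dualIsoApp α ψ :=
  DualSec.ext' fun W hW m => by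
    rw [DualSec.smul_app, dualIsoApp_app, dualIsoApp_app, DualSec.smul_app, map_mul,
      ← resO_appIso_inv, Iso.inv_hom_id_apply]

lemma dualIsoApp_injective {V : X'.Opens} {ψ : DualSec E'.mod (j ''ᵁ V)}
    (h : dualIsoApp α ψ = 0) : ψ = 0 := by
  refine DualSec.ext' fun W hW m => eqO_of_locally _ _ fun x hx => ?_
  obtain ⟨y, hy, rfl⟩ := hW hx
  -- An open `W` inside j(V) is tested on j(j⁻¹(W)), where every section comes from `E` through
  -- `isoApp`.
  refine ⟨j ''ᵁ (j ⁻¹ᵁ W), image_preimage_le j W, ⟨y, hx, rfl⟩, ?_⟩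
  rw [ψ.app_res, DualSec.zero_app, map_zero, ← isoApp_isoInvApp α _ (resM _ _ m)]
  have h1 := congrArg (fun φ : DualSec E.mod V => φ.app (j ⁻¹ᵁ W) (preimage_le j hW)
    (isoInvApp α _ (resM _ (image_preimage_le j W) m))) h
  have h2 := congrArg (j.appIso (j ⁻¹ᵁ W)).inv h1
  rw [DualSec.zero_app, map_zero, dualIsoApp_app, Iso.hom_inv_id_apply] at h2
  exact h2

/-- The inverse of the transport of linear forms. -/
def dualIsoInvApp {V : X'.Opens} (φ : DualSec E.mod V) : DualSec E'.mod (j ''ᵁ V) where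
  app W hW :=
    { toFun := fun m => (openImmersionEquiv j W (hW.trans (image_le_range j V))).symm
        (φ.app (j ⁻¹ᵁ W) (preimage_le j hW)
          (isoInvApp α _ (resM _ (image_preimage_le j W) m)))
      map_add' := fun m m' => by simp only [map_add]
      map_smul' := fun a m => by
        rw [resM_smul, isoInvApp_smul, map_smul, smul_eq_mul, map_mul, ← appIso_inv_app_preimage]
        refine congrArg (· * _) ((openImmersionEquiv_symm_eq j _ _ _ _).2 ?_)
        exact Iso.inv_hom_id_apply (j.appIso (j ⁻¹ᵁ W)) (j.app W a) }
  app_res {W W'} hW h m := by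
    symm
    refine (openImmersionEquiv_symm_eq j _ _ _ _).2 ?_
    rw [resO_app]
    refine Eq.trans ?_ (congrArg (resO (preimage_le_preimage j h))
      ((openImmersionEquiv j W (hW.trans (image_le_range j V))).apply_symm_apply _).symm)
    rw [φ.app_res, ← isoInvApp_res, resM_resM, resM_resM]

lemma dualIsoApp_dualIsoInvApp {V : X'.Opens} (φ : DualSec E.mod V) :
    dualIsoApp α (dualIsoInvApp α φ) = φ := by
  refine DualSec.ext' fun W hW m => ?_
  rw [dualIsoApp_app]
  have : (dualIsoInvApp α φ).app (j ''ᵁ W) (j.image_mono hW) (isoApp α W m) =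
      (j.appIso W).inv (φ.app W hW m) := by
    refine (openImmersionEquiv_symm_eq j _ _ _ _).2 ?_
    rw [app_appIso_inv_eq, φ.app_res, ← isoInvApp_isoApp α _ (resM _ _ m), isoApp_res]
  rw [this, Iso.inv_hom_id_apply]

lemma LogDer.appIso_hom_extend {V : X'.Opens} (D : LogDer (j ≫ f) ⊤ V) {W : X'.Opens}
    (hW : W ≤ V) (b : Γ(X, j ''ᵁ W)) :
    (j.appIso W).hom ((D.extend j hI : LogDer f I _).app (j ''ᵁ W) (j.image_mono hW) b) =
      D.app W hW ((j.appIso W).hom b) := by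
  have := (D.restrict hW).extend_appIso_inv j hI ((j.appIso W).hom b)
  rw [Iso.hom_inv_id_apply] at this
  refine (congrArg (j.appIso W).hom this).trans ?_
  rw [Iso.inv_hom_id_apply]
  rfl

lemma dualIsoApp_nabla {V : X'.Opens} (D : LogDer (j ≫ f) ⊤ V)
    (ψ : DualSec E'.mod (j ''ᵁ V)) :
    dualIsoApp α (E'.nabla.dualApp (D.extend j hI) ψ) = E.nabla.dualApp D (dualIsoApp α ψ) := by
  refine DualSec.ext' fun W hW m => ?_
  change (j.appIso W).hom ((D.extend j hI : LogDer f I _).app _ _ _ - ψ.app _ _ _) =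
    D.app W hW ((j.appIso W).hom _) -
      (j.appIso W).hom (ψ.app _ _ (isoApp α W (E.nabla.app (D.restrict hW) m)))
  rw [map_sub, LogDer.appIso_hom_extend, isoApp_nabla]
  rfl

/-- The transport of linear forms, as a horizontal morphism. -/
def dualRestrictHom : (restrictFunctor j f hI).obj E'.dual ⟶ E.dual where
  hom := modHom (fun V =>
    { toFun := fun ψ => (dualIsoApp α (show DualSec E'.mod (j ''ᵁ V) from ψ) : DualSec E.mod V)
      map_add' := dualIsoApp_add α
      map_smul' := dualIsoApp_smul α }) fun _ _ _ _ => rfl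
  horizontal D ψ := dualIsoApp_nabla α D ψ

/-- The dual commutes with restriction to an open subscheme. -/
def dualRestrictIso : E.dual ≅ (restrictFunctor j f hI).obj E'.dual :=
  -- The transport is bijective on sections; having the same image as the identity, it is an
  -- isomorphism.
  (Corr.isoOfInjective (dualRestrictHom α) (𝟙 _)
    (fun _ => (injective_iff_map_eq_zero _).2 fun _ h => dualIsoApp_injective α h)
    (fun _ _ _ h => h)
    (fun m => ⟨fun _ => ⟨m, rfl⟩, fun _ => ⟨_, dualIsoApp_dualIsoInvApp α m⟩⟩)).symm

end DualRestrict

/-! ### Regular-singular connections -/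

section RegularSingular

variable {f : X ⟶ S} {I : X.IdealSheafData}

/-- Unfolds the essential image, with the isomorphism taken between connections rather than in the
full subcategory of coherent ones. -/
lemma regularSingular_iff (E : C (starHom f I)) : regularSingular f I E ↔ ∃ E' : LogConn f I,
    IsCoherent E'.mod ∧ Nonempty (E.obj ≅
      (restrictFunctor (complementOpen I).ι f (complementOpen_disjoint I)).obj E') := by
  constructor
  · rintro ⟨E', ⟨e⟩⟩
    exact ⟨E'.obj, E'.property, ⟨((coherentProp (starHom f I) ⊤).ι.mapIso e).symm⟩⟩
  · rintro ⟨E', h, ⟨e⟩⟩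
    exact ⟨⟨E', h⟩, ⟨ObjectProperty.isoMk _ e.symm⟩⟩

theorem regularSingular_of_mono [IsLocallyNoetherian X] {E F : C (starHom f I)} (φ : F ⟶ E)
    [Mono φ] (hE : regularSingular f I E) : regularSingular f I F := by
  obtain ⟨E', hE', ⟨α⟩⟩ := (regularSingular_iff E).1 hE
  obtain ⟨F', hF', ⟨e⟩⟩ := exists_sub_extension (complementOpen_disjoint I) hE' F.property
    (φ.hom ≫ α.hom) (fun U => by
      have h1 : Function.Injective (α.hom.hom.app U) :=
        Function.LeftInverse.injective (isoInvApp_isoApp α U)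
      exact h1.comp (CLog.injective_of_mono φ U))
  exact (regularSingular_iff F).2 ⟨F', hF', ⟨e.symm⟩⟩

theorem regularSingular_of_epi [IsLocallyNoetherian X] {E Q : C (starHom f I)} (ψ : E ⟶ Q)
    [Epi ψ] (hE : regularSingular f I E) : regularSingular f I Q := by
  obtain ⟨E', hE', ⟨α⟩⟩ := (regularSingular_iff E).1 hE
  obtain ⟨Q', hQ', ⟨e⟩⟩ := exists_quot_extension (complementOpen_disjoint I) hE' Q.property
    (α.inv ≫ ψ.hom) (fun U n x hx => by
      obtain ⟨V, h, hxV, m, hm⟩ := CLog.locally_surjective_of_epi ψ n x hx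
      refine ⟨V, h, hxV, isoApp α V m, ?_⟩
      exact (congrArg (ψ.hom.hom.app V) (isoInvApp_isoApp α V m)).trans hm)
  exact (regularSingular_iff Q).2 ⟨Q', hQ', ⟨e.symm⟩⟩

theorem regularSingular_tensor {E F : C (starHom f I)} (hE : regularSingular f I E)
    (hF : regularSingular f I F) :
    regularSingular f I ⟨E.obj.tensor F.obj, E.property.tensor F.property⟩ := by
  obtain ⟨E', hE', ⟨α⟩⟩ := (regularSingular_iff E).1 hE
  obtain ⟨F', hF', ⟨β⟩⟩ := (regularSingular_iff F).1 hF
  exact (regularSingular_iff _).2 ⟨E'.tensor F', hE'.tensor hF', ⟨tensorRestrictIso α β⟩⟩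

theorem regularSingular_dual [IsLocallyNoetherian X] {E : C (starHom f I)}
    (hE : regularSingular f I E) :
    regularSingular f I ⟨E.obj.dual, IsCoherent.dual E.property⟩ := by
  obtain ⟨E', hE', ⟨α⟩⟩ := (regularSingular_iff E).1 hE
  exact (regularSingular_iff _).2 ⟨E'.dual, hE'.dual, ⟨dualRestrictIso α⟩⟩

end RegularSingular

end RegSing

end

/-! ### The four closure properties -/

theorem proposition16p01 {S X : Scheme.{u}} [IsNoetherian S]
    (s : S ⟶ Spec (CommRingCat.of (ULift.{u} ℂ)))
    (f : X ⟶ S) [Smooth f] (Y : X.IdealSheafData) (hY : RegSing.IsRelativeNCD f Y) :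
    (RegSing.regularSingular f Y).IsClosedUnderSubobjects ∧
    (RegSing.regularSingular f Y).IsClosedUnderQuotients ∧
    (∀ E F : RegSing.C (RegSing.starHom f Y),
      RegSing.regularSingular f Y E → RegSing.regularSingular f Y F →
        ∃ h : RegSing.coherentProp (RegSing.starHom f Y) ⊤ (E.obj.tensor F.obj),
          RegSing.regularSingular f Y ⟨E.obj.tensor F.obj, h⟩) ∧
    (∀ E : RegSing.C (RegSing.starHom f Y), RegSing.regularSingular f Y E →
      ∃ h : RegSing.coherentProp (RegSing.starHom f Y) ⊤ E.obj.dual,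
        RegSing.regularSingular f Y ⟨E.obj.dual, h⟩) := by
  -- Smooth morphisms are locally of finite type, and `S` is noetherian.
  have : IsLocallyNoetherian X := LocallyOfFiniteType.isLocallyNoetherian f
  exact ⟨⟨fun φ _ hE => RegSing.regularSingular_of_mono φ hE⟩,
    ⟨fun ψ _ hE => RegSing.regularSingular_of_epi ψ hE⟩,
    fun _ _ hE hF => ⟨_, RegSing.regularSingular_tensor hE hF⟩,
    fun _ hE => ⟨_, RegSing.regularSingular_dual hE⟩⟩
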